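/- **Model.** Let $G=(V,E)$ be a connected undirected graph with $n\ge 3$ nodes and diameter $D$, and let $s\in V$ be a source that initially is the only node knowing $k\ge 1$ messages. In each synchronous round every node either broadcasts a packet or is silent. A silent node with exactly one broadcasting neighbour receives that neighbour's packet, unless a fault occurs; otherwise it receives nothing, and silence, collisions and faults are indistinguishable. Faults are independent over nodes and rounds and have constant probability $p\in[0,1)$: with *sender faults* a broadcasting node transmits noise with probability $p$, with *receiver faults* a listening node with exactly one broadcasting neighbour receives noise with probability $p$. A *coding schedule* fixes, for each node and round, a function from what the node initially knows and has received so far to "silent" or a packet, and a decoding function for each node; it *succeeds* if at the end all nodes output all $k$ messages. The *coding throughput* of $(G,s)$ is $\limsup_{k\to\infty} k/T_k$, where $T_k$ is the least number of rounds of a coding schedule, with messages and packets of $O(\log(nk))$ bits, that broadcasts any $k$ messages with success probability at least $1-1/k$. **Algorithm.** A ranked BFS tree of $G$ is a BFS tree rooted at $s$ in which leaves have rank $1$ and an inner node with maximal child rank $r$ has rank $r$ if exactly one child has rank $r$, and rank $r+1$ otherwise. A tree edge is *fast* if its ends have equal rank, and a node is *fast* if it is the parent in a fast edge. The tree is a *gathering-broadcasting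 spanning tree* (GBST) if, whenever $(u,v)$ and $(u',v')$ are fast edges (parent, child) with $u\ne u'$, $v,v'$ on the same level and of the same rank, $u$ and $v'$ are not adjacent in $G$. Let $r_{\max}$ be the largest rank, $L=\lceil\log_2 n\rceil$, $S=\lceil\log_2 L\rceil$. The *virtual distance* of a node is its distance from $s$ after adding to $G$ a directed shortcut from each node to every node reachable from it by a path of fast edges directed from parent to child. *Robust FASTBC* with parameter $c$, in its oblivious form, lets nodes broadcast in round $t$ as follows. If $t$ is odd and $\tau=(t-1)/2$, each node whose virtual distance is congruent to $\tau$ modulo $3$ broadcasts, independently, with probability $2^{-(\lfloor \tau/3\rfloor \bmod L)}$. If $t$ is even, a fast node of level $l$ and rank $r$ broadcasts iff $\lfloor l/S\rfloor-6r\equiv\lfloor (t/2)/(cS)\rfloor \pmod{6r_{\max}}$ and $l\equiv t\pmod 3$. Combined with *random linear network coding* over a fixed finite field $\mathbb F$, messages are vectors over $\mathbb F$, a packet consists of a coefficient vector in $\mathbb F^k$ and the corresponding combination of the messages, a node that broadcasts sends a uniformly random linear combination of the packets it knows, and a node decodes when its packets determine the messages. **Statement.** Every connected graph with $n\ge3$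 nodes and source $s$ has a GBST, and for every $p\in[0,1)$, in both fault models: 1. For every finite field $\mathbb F$ and every sufficiently large $c$ (depending on $p,\mathbb F$) there is a constant $C=C(p,\mathbb F,c)$ such that for all $G,s$ as above, every GBST and all $k\ge1$, Robust FASTBC with random linear network coding, run for any number $$T\ \ge\ C\,(D+k\log n\log\log n+\log^2 n\log\log n)$$ of rounds, broadcasts any $k$ messages with probability at least $1-\frac1{nk}$ (over the faults and the choices of the algorithm). 2. For messages of $a\lceil\log_2(nk)\rceil$ bits there are coding schedules with packets of $A\lceil\log_2(nk)\rceil$ bits that broadcast any $k\ge 1$ messages in at most $C'(D+k\log n\log\log n+\log^2 n\log\log n)$ rounds with probability at least $1-\frac1{nk}$. Here $A$ depends only on $a$, and $C'$ only on $a$ and $p$. 3. Consequently (with the same $a$, $A$), every such $(G,s)$ has coding throughput at least $\frac{\theta}{\log n\,\log\log n}$, where $\theta>0$ depends only on $a$ and $p$. -/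

import Mathlib

open MeasureTheory Filter

/-! ### The noisy radio network model -/

/-- Sender faults or receiver faults. -/
inductive FaultModel where
  | sender
  | receiver

/-- A static coding schedule with `T` rounds.  In round `r` node `u` applies `act r u` to its initial
knowledge (`some m` for the source, `none` for every other node) and to its reception history (one
entry per past round, newest first; `none` means that no packet was received), and either stays
silent (`none`) or broadcasts a packet.  After the last round `decode u` computes the output of `u`. -/
structure CodingSchedule (V Msgs Packet : Type) (T : ℕ) where
  act : Fin T → V → Option Msgs → List (Option Packet) → Option Packet
  decode : V → Option Msgs → List (Option Packet) → Option Msgs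

section RadioModel

open Classical in
/-- What `v` receives in one round, where `x u` is the packet broadcast by `u` (`none` if silent) and
`fault` marks the nodes with a fault in this round: `v` must be silent and have exactly one
broadcasting neighbour `u`, and the relevant node (`u` for sender faults, `v` for receiver faults)
must not be faulty.  Silence, collisions and faults cannot be distinguished by `v`. -/
noncomputable def receive {V Packet : Type} (G : SimpleGraph V) (model : FaultModel)
    (x : V → Option Packet) (fault : V → Bool) (v : V) : Option Packet :=
  if h : x v = none ∧ ∃! u, G.Adj u v ∧ x u ≠ none then
    let u := h.2.choose
    let culprit := match model with
      | FaultModel.sender => u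
      | FaultModel.receiver => v
    if fault culprit = true then none else x u
  else none

open Classical in
/-- Only the source initially knows the messages. -/
noncomputable def initialKnowledge {V Msgs : Type} (s : V) (m : Msgs) (u : V) : Option Msgs :=
  if u = s then some m else none

/-- The reception history of every node after the first `r` rounds (of at most `T`). -/
noncomputable def history {V Msgs Packet : Type} {T : ℕ} (G : SimpleGraph V) (s : V)
    (model : FaultModel) (S : CodingSchedule V Msgs Packet T) (m : Msgs)
    (fault : Fin T → V → Bool) : ℕ → V → List (Option Packet)
  | 0, _ => []
  | r + 1, v =>
    if h : r < T then
      receive G model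
        (fun u => S.act ⟨r, h⟩ u (initialKnowledge s m u) (history G s model S m fault r u))
        (fault ⟨r, h⟩) v :: history G s model S m fault r v
    else history G s model S m fault r v

/-- After all `T` rounds every node outputs all the messages. -/
def Succeeds {V Msgs Packet : Type} {T : ℕ} (G : SimpleGraph V) (s : V)
    (model : FaultModel) (S : CodingSchedule V Msgs Packet T) (m : Msgs)
    (fault : Fin T → V → Bool) : Prop :=
  ∀ u, S.decode u (initialKnowledge s m u) (history G s model S m fault T u) = some m

/-- A coin that shows `true` with probability `p` (for `0 ≤ p ≤ 1`). -/
noncomputable def coin (p : ℝ) : Measure Bool :=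
  ENNReal.ofReal p • Measure.dirac true + ENNReal.ofReal (1 - p) • Measure.dirac false

instance (p : ℝ) : IsFiniteMeasure (coin p) :=
  ⟨by simp [coin, ENNReal.add_lt_top]⟩

theorem coin_isProbabilityMeasure {p : ℝ} (h0 : 0 ≤ p) (h1 : p ≤ 1) :
    IsProbabilityMeasure (coin p) :=
  ⟨by simp [coin, ← ENNReal.ofReal_add h0 (sub_nonneg.2 h1)]⟩

/-- Independent faults with probability `p`, one for each round and node. -/
noncomputable def faultMeasure (V : Type) [Fintype V] (T : ℕ) (p : ℝ) :
    Measure (Fin T → V → Bool) :=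
  Measure.pi fun _ => Measure.pi fun _ => coin p

instance (V : Type) [Fintype V] (T : ℕ) (p : ℝ) : IsFiniteMeasure (faultMeasure V T p) := by
  unfold faultMeasure; infer_instance

/-- Bit strings of length `a * ⌈log₂ (n k)⌉`. -/
abbrev LogBits (a n k : ℕ) : Type := Fin (a * Nat.clog 2 (n * k)) → Bool

/-- The coding throughput of `(G, s)` with fault probability `p`: the limsup, as `k → ∞`, of `k`
divided by the least number of rounds of a coding schedule that broadcasts `k` messages (of
`a * ⌈log₂ (n k)⌉` bits, with packets of `A * ⌈log₂ (n k)⌉` bits) with probability at least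
`1 - 1 / k`, whatever the messages are. -/
noncomputable def codingThroughput {V : Type} [Fintype V] (G : SimpleGraph V) (s : V)
    (model : FaultModel) (p : ℝ) (a A : ℕ) : ENNReal :=
  limsup (fun k : ℕ => (k : ENNReal) /
    ⨅ T ∈ {T : ℕ | ∃ S : CodingSchedule V (Fin k → LogBits a (Fintype.card V) k)
        (LogBits A (Fintype.card V) k) T,
        ∀ m, 1 - 1 / (k : ℝ) ≤ (faultMeasure V T p).real {f | Succeeds G s model S m f}},
      (T : ENNReal)) atTop

end RadioModel

/-! ### Gathering-broadcasting spanning trees -/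

/-- A ranked breadth-first search tree of `G` rooted at `s`; `v` is a child of `u` if `v ≠ s` and
`parent v = u`, and the value `parent s` plays no role.  Leaves have rank `1`; an inner node whose
maximal child rank `r` is attained by exactly one child has rank `r`, and if it is attained by at
least two children the rank is `r + 1`. -/
structure RankedBFSTree {V : Type} (G : SimpleGraph V) (s : V) where
  parent : V → V
  rank : V → ℕ
  adj_parent : ∀ v, v ≠ s → G.Adj (parent v) v
  dist_parent : ∀ v, v ≠ s → G.dist s (parent v) + 1 = G.dist s v
  rank_leaf : ∀ u, (∀ v, v ≠ s → parent v ≠ u) → rank u = 1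
  rank_of_unique : ∀ u v, v ≠ s → parent v = u →
    (∀ w, w ≠ s → parent w = u → w ≠ v → rank w < rank v) → rank u = rank v
  rank_of_tie : ∀ u v v', v ≠ s → v' ≠ s → v ≠ v' → parent v = u → parent v' = u →
    rank v = rank v' → (∀ w, w ≠ s → parent w = u → rank w ≤ rank v) → rank u = rank v + 1

namespace RankedBFSTree

variable {V : Type} {G : SimpleGraph V} {s : V}

/-- `u` is the parent of `v` and they have the same rank. -/
def FastEdge (𝒯 : RankedBFSTree G s) (u v : V) : Prop :=
  v ≠ s ∧ 𝒯.parent v = u ∧ 𝒯.rank v = 𝒯.rank u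

/-- A node is fast if one of its children has the same rank. -/
def Fast (𝒯 : RankedBFSTree G s) (u : V) : Prop := ∃ v, 𝒯.FastEdge u v

/-- Two fast edges with distinct parents, of the same rank and on the same level, are not joined by
an edge of `G` from the parent of one to the child of the other: simultaneous transmissions along
them do not interfere. -/
def IsGBST (𝒯 : RankedBFSTree G s) : Prop :=
  ∀ u v u' v', 𝒯.FastEdge u v → 𝒯.FastEdge u' v' → u ≠ u' →
    G.dist s v = G.dist s v' → 𝒯.rank v = 𝒯.rank v' → ¬ G.Adj u v'

/-- The largest rank. -/
def maxRank [Fintype V] (𝒯 : RankedBFSTree G s) : ℕ := Finset.univ.sup 𝒯.rank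

/-- The distance from `s` in the directed graph that consists of all edges of `G`, in both
directions, and of a shortcut from each node on a fast stretch to every later node of the stretch. -/
noncomputable def virtualDist (𝒯 : RankedBFSTree G s) (v : V) : ℕ :=
  sInf {d | ∃ x : ℕ → V, x 0 = s ∧ x d = v ∧
    ∀ i < d, G.Adj (x i) (x (i + 1)) ∨ Relation.TransGen 𝒯.FastEdge (x i) (x (i + 1))}

end RankedBFSTree

/-! ### Robust FASTBC with random linear network coding -/

/-- `⌈log₂ n⌉`, the number of rounds of a Decay phase. -/
def decayLength (n : ℕ) : ℕ := Nat.clog 2 n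

/-- `⌈log₂ ⌈log₂ n⌉⌉`, the block size. -/
def blockSize (n : ℕ) : ℕ := Nat.clog 2 (Nat.clog 2 n)

/-- The transmission probability of the Decay step in round `t` (used for odd `t` only).  Three
consecutive odd rounds, one for each residue of the virtual distance modulo 3, use the same value. -/
noncomputable def decayProb (n t : ℕ) : ℝ :=
  (2 : ℝ)⁻¹ ^ ((t / 2 / 3) % decayLength n)

/-- Who broadcasts in round `t` of Robust FASTBC with parameter `c`, in its oblivious form: the
decision does not depend on what a node has received.  In odd rounds the nodes whose virtual distance
has the residue that is currently served broadcast if their Decay coin says so.  In even rounds a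
fast node of level `l` and rank `r` broadcasts if `⌊l/S⌋ - 6 r ≡ ⌊(t/2)/(c S)⌋ (mod 6 r_max)` and
`l ≡ t (mod 3)`. -/
def Broadcasts {V : Type} [Fintype V] {G : SimpleGraph V} {s : V} (𝒯 : RankedBFSTree G s) (c t : ℕ)
    (u : V) (decayCoin : Bool) : Prop :=
  let S := blockSize (Fintype.card V)
  if t % 2 = 1 then
    t / 2 ≡ 𝒯.virtualDist u [MOD 3] ∧ decayCoin = true
  else
    𝒯.Fast u ∧
      ((G.dist s u / S : ℕ) : ℤ) - 6 * (𝒯.rank u : ℤ) ≡ ((t / 2 / (c * S) : ℕ) : ℤ)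
        [ZMOD 6 * (𝒯.maxRank : ℤ)] ∧
      G.dist s u ≡ t [MOD 3]

section RLNC

variable {F : Type} [Field F]

/-- `k` messages, each a vector of length `ℓ`. -/
abbrev FieldMessages (F : Type) (k ℓ : ℕ) : Type := Fin k → Fin ℓ → F

/-- A packet is a coefficient vector together with the corresponding combination of the messages. -/
abbrev RLNCPacket (F : Type) (k ℓ : ℕ) : Type := (Fin k → F) × (Fin ℓ → F)

/-- The packets a node knows: the source has the packets `(eᵢ, mᵢ)`, and every node has the packets
it received. -/
def knownPackets {k ℓ : ℕ} (init : Option (FieldMessages F k ℓ))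
    (hist : List (Option (RLNCPacket F k ℓ))) : List (RLNCPacket F k ℓ) :=
  (match init with
    | some m => List.ofFn fun i => (Pi.single i 1, m i)
    | none => []) ++ hist.reduceOption

/-- The linear combination of a list of packets with the given coefficients (of which there are at
least as many as packets whenever this is used). -/
def combine {k ℓ N : ℕ} (α : Fin N → F) (L : List (RLNCPacket F k ℓ)) : RLNCPacket F k ℓ :=
  (List.zipWith (fun a v => a • v) (List.ofFn α) L).sum

open Classical in
/-- Decoding: output the message vector that satisfies all known linear equations, if it is
unique. -/
noncomputable def rlncDecode {k ℓ : ℕ} (L : List (RLNCPacket F k ℓ)) :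
    Option (FieldMessages F k ℓ) :=
  if h : ∃! m : FieldMessages F k ℓ, ∀ y ∈ L, ∑ i, y.1 i • m i = y.2 then some h.choose else none

/-- The random choices of the algorithm: for each round and node a Decay coin and the coefficients
of a linear combination. -/
abbrev Seed (V F : Type) (k T : ℕ) : Type := Fin T → V → Bool × (Fin (k + T) → F)

/-- All choices are independent, the coin of round `t` shows `true` with probability `decayProb n t`,
and the coefficients are uniform in `F`. -/
noncomputable def seedMeasure (V F : Type) [Fintype V] [MeasurableSpace F] (k T : ℕ) :
    Measure (Seed V F k T) :=
  Measure.pi fun t => Measure.pi fun _ =>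
    (coin (decayProb (Fintype.card V) t)).prod
      (Measure.pi fun _ => ProbabilityTheory.uniformOn Set.univ)

open Classical in
/-- Robust FASTBC with random linear network coding, run for `T` rounds: whenever a node is told to
broadcast it sends a random linear combination of the packets it knows. -/
noncomputable def robustFastbcRLNC {V : Type} [Fintype V] {G : SimpleGraph V} {s : V}
    (𝒯 : RankedBFSTree G s) (c : ℕ) {k T : ℕ} (ℓ : ℕ) (seed : Seed V F k T) :
    CodingSchedule V (FieldMessages F k ℓ) (RLNCPacket F k ℓ) T where
  act t u init hist :=
    if Broadcasts 𝒯 c t u (seed t u).1 then some (combine (seed t u).2 (knownPackets init hist))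
    else none
  decode _ init hist := rlncDecode (knownPackets init hist)

end RLNC

/-- `D + k log n log log n + log² n log log n`. -/
noncomputable def roundBound (n D k : ℕ) : ℝ :=
  D + k * Real.log n * Real.log (Real.log n) + Real.log n ^ 2 * Real.log (Real.log n)

/-!
A GBST is built from the deepest level upwards: among all choices of the parents of a level, one
with the fewest pairs (parent, rank of the child) has no interfering fast edges.

Random linear network coding is analysed by testing the packets against a nonzero vector `μ`: a node
knows all messages once, for every `μ`, it has a packet whose coefficient vector is not orthogonal
to `μ`, and a random combination of packets one of which passes this test passes it with constant
probability. For a fixed `μ` this is the spread of a single message. Every node has virtual distance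
`O(log n)`. A shortcut is crossed in the even rounds, where the fast edges of a GBST do not collide
and a block of `S ≈ log log n` levels is crossed in one turn, unless one of its edges fails too
often; every other edge is crossed in the odd rounds, by Decay. The probabilities of being
uninformed satisfy linear inequalities, which compare them with an explicit envelope: it decays
exponentially in units of `L S` rounds, so that after `O(D + (k + L) L S)` rounds it beats the
number of test vectors.

Packets with `k` coefficients are too long for the second claim. There the messages are sent in
batches of `log (n k)` messages that follow each other through strips of the graph; a packet then
only has to name its batch and the coefficients in the batch.
-/

/-! ### Existence of a GBST -/

section Existence

variable {V : Type*}

theorem dist_le_dist_add_one {G : SimpleGraph V} {u v : V} (s : V) (h : G.Adj u v) :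
    G.dist s v ≤ G.dist s u + 1 := by
  have := h.diff_dist_adj (u := s)
  omega

theorem dist_lt_card [Fintype V] {G : SimpleGraph V} (hG : G.Connected) (u v : V) :
    G.dist u v < Fintype.card V := by
  obtain ⟨p, hp, hlength⟩ := hG.exists_path_of_dist u v
  exact hlength ▸ hp.length_lt

theorem exists_adj_dist_add_one_eq {G : SimpleGraph V} (hG : G.Connected) {s v : V} (hv : v ≠ s) :
    ∃ u, G.Adj u v ∧ G.dist s u + 1 = G.dist s v := by
  obtain ⟨p, hp⟩ := hG.exists_walk_length_eq_dist v s
  cases p with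
  | nil => exact absurd rfl hv
  | @cons _ u _ hvu p =>
    have hle := SimpleGraph.dist_le p
    have hge := dist_le_dist_add_one s hvu.symm
    rw [SimpleGraph.Walk.length_cons, SimpleGraph.dist_comm] at hp
    rw [SimpleGraph.dist_comm] at hle
    exact ⟨u, hvu.symm, by omega⟩

open Classical in
/-- The rank of a node with children `C` of ranks `ρ`. -/
noncomputable def rankFromChildren (C : Finset V) (ρ : V → ℕ) : ℕ :=
  if C = ∅ then 1 else if ∃! v, v ∈ C ∧ ρ v = C.sup ρ then C.sup ρ else C.sup ρ + 1

open Classical in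
theorem rankFromChildren_congr {C : Finset V} {ρ ρ' : V → ℕ} (h : ∀ v ∈ C, ρ v = ρ' v) :
    rankFromChildren C ρ = rankFromChildren C ρ' := by
  have hsup : C.sup ρ = C.sup ρ' := Finset.sup_congr rfl h
  have hmax : (∃! v, v ∈ C ∧ ρ v = C.sup ρ) ↔ ∃! v, v ∈ C ∧ ρ' v = C.sup ρ' :=
    existsUnique_congr fun v => and_congr_right fun hv => by rw [h v hv, hsup]
  exact if_congr Iff.rfl rfl (if_congr hmax hsup (congrArg (· + 1) hsup))

theorem sup_eq_of_forall_le {C : Finset V} {ρ : V → ℕ} {v : V} (hv : v ∈ C)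
    (h : ∀ w ∈ C, ρ w ≤ ρ v) : C.sup ρ = ρ v :=
  le_antisymm (Finset.sup_le h) (Finset.le_sup hv)

theorem rankFromChildren_eq_of_forall_lt {C : Finset V} {ρ : V → ℕ} {v : V} (hv : v ∈ C)
    (h : ∀ w ∈ C, w ≠ v → ρ w < ρ v) : rankFromChildren C ρ = ρ v := by
  have hsup : C.sup ρ = ρ v := sup_eq_of_forall_le hv fun w hw => by
    rcases eq_or_ne w v with rfl | hwv
    exacts [le_rfl, (h w hw hwv).le]
  rw [rankFromChildren, if_neg (Finset.ne_empty_of_mem hv), if_pos, hsup]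
  exact ⟨v, ⟨hv, hsup.symm⟩, fun w hw => by_contra fun hwv => (h w hw.1 hwv).ne (hw.2.trans hsup)⟩

theorem rankFromChildren_eq_succ_of_tie {C : Finset V} {ρ : V → ℕ} {v v' : V} (hv : v ∈ C)
    (hv' : v' ∈ C) (hne : v ≠ v') (heq : ρ v = ρ v') (h : ∀ w ∈ C, ρ w ≤ ρ v) :
    rankFromChildren C ρ = ρ v + 1 := by
  have hsup : C.sup ρ = ρ v := sup_eq_of_forall_le hv h
  rw [rankFromChildren, if_neg (Finset.ne_empty_of_mem hv), if_neg, hsup]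
  exact fun hunique => hne (hunique.unique ⟨hv, hsup.symm⟩ ⟨hv', heq.symm.trans hsup.symm⟩)

theorem eq_of_rankFromChildren_eq {C : Finset V} {ρ : V → ℕ} {v w : V} (hv : v ∈ C) (hw : w ∈ C)
    (h : rankFromChildren C ρ = ρ v) (hwv : ρ w = ρ v) : w = v := by
  have hle : ρ v ≤ C.sup ρ := Finset.le_sup hv
  rw [rankFromChildren, if_neg (Finset.ne_empty_of_mem hv)] at h
  split_ifs at h with hunique
  · exact hunique.unique ⟨hw, hwv.trans h.symm⟩ ⟨hv, h.symm⟩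
  · omega

variable {G : SimpleGraph V} {s : V}

/-- `f` assigns to every node but the root a neighbour on the previous level. -/
def IsBFSParent (G : SimpleGraph V) (s : V) (f : V → V) : Prop :=
  ∀ v, v ≠ s → G.Adj (f v) v ∧ G.dist s (f v) + 1 = G.dist s v

theorem exists_isBFSParent (hG : G.Connected) (s : V) : ∃ f, IsBFSParent G s f := by
  choose! f hf using fun v (hv : v ≠ s) => exists_adj_dist_add_one_eq hG hv
  exact ⟨f, hf⟩

theorem ne_of_dist_eq_succ {v : V} {l : ℕ} (h : G.dist s v = l + 1) : v ≠ s := by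
  rintro rfl
  simp at h

variable [Fintype V]

open Classical in
/-- The children of `u` with respect to a parent function. -/
noncomputable def childrenOf (s : V) (f : V → V) (u : V) : Finset V :=
  Finset.univ.filter fun v => v ≠ s ∧ f v = u

@[simp]
theorem mem_childrenOf {f : V → V} {u v : V} : v ∈ childrenOf s f u ↔ v ≠ s ∧ f v = u := by
  simp [childrenOf]

open Classical in
/-- The pairs `(f v, ρ v)` of the nodes `v` on level `l`.  A parent function with the fewest such
pairs has no interfering fast edges into level `l`. -/
noncomputable def parentRankPairs (G : SimpleGraph V) (s : V) (ρ : V → ℕ) (l : ℕ) (f : V → V) :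
    Finset (V × ℕ) :=
  (Finset.univ.filter fun v => G.dist s v = l).image fun v => (f v, ρ v)

open Classical in
theorem mem_parentRankPairs {ρ : V → ℕ} {l : ℕ} {f : V → V} {y : V × ℕ} :
    y ∈ parentRankPairs G s ρ l f ↔ ∃ v, G.dist s v = l ∧ (f v, ρ v) = y := by
  simp [parentRankPairs]

open Classical in
/-- A fast child is the only child of its rank, so moving it to another parent removes the pair of
its old parent; the pair of its new parent is there already. -/
theorem card_parentRankPairs_update_lt {ρ : V → ℕ} {l : ℕ} {f : V → V} {v v' : V}
    (hv : G.dist s v = l + 1) (hv' : G.dist s v' = l + 1) (hρ : ρ v = ρ v') (hne : f v ≠ f v')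
    (hrank : rankFromChildren (childrenOf s f (f v')) ρ = ρ v') :
    (parentRankPairs G s ρ (l + 1) (Function.update f v' (f v))).card <
      (parentRankPairs G s ρ (l + 1) f).card := by
  refine Finset.card_lt_card (Finset.ssubset_iff_of_subset ?_ |>.2
    ⟨(f v', ρ v'), mem_parentRankPairs.2 ⟨v', hv', rfl⟩, ?_⟩)
  · intro y hy
    obtain ⟨x, hx, rfl⟩ := mem_parentRankPairs.1 hy
    rcases eq_or_ne x v' with rfl | hxv
    · exact mem_parentRankPairs.2 ⟨v, hv, by rw [Function.update_self, hρ]⟩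
    · exact mem_parentRankPairs.2 ⟨x, hx, by rw [Function.update_of_ne hxv]⟩
  · rw [mem_parentRankPairs]
    rintro ⟨x, hx, hpair⟩
    obtain ⟨hfx, hρx⟩ := Prod.mk.inj hpair
    rcases eq_or_ne x v' with rfl | hxv
    · exact hne (by rwa [Function.update_self] at hfx)
    · rw [Function.update_of_ne hxv] at hfx
      exact hxv (eq_of_rankFromChildren_eq (mem_childrenOf.2 ⟨ne_of_dist_eq_succ hv', rfl⟩)
        (mem_childrenOf.2 ⟨ne_of_dist_eq_succ hx, hfx⟩) hrank hρx)

theorem IsBFSParent.exists_not_adj_on_level {f : V → V} (hf : IsBFSParent G s f) (ρ : V → ℕ)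
    (l : ℕ) :
    ∃ g, IsBFSParent G s g ∧ (∀ v, G.dist s v ≠ l + 1 → g v = f v) ∧
      ∀ v v', G.dist s v = l + 1 → G.dist s v' = l + 1 → ρ v = ρ v' → g v ≠ g v' →
        rankFromChildren (childrenOf s g (g v')) ρ = ρ v' → ¬ G.Adj (g v) v' := by
  classical
  obtain ⟨g, ⟨hg, hgf⟩, hmin⟩ := Set.exists_min_image
    {g | IsBFSParent G s g ∧ ∀ v, G.dist s v ≠ l + 1 → g v = f v}
    (fun g => (parentRankPairs G s ρ (l + 1) g).card) (Set.toFinite _) ⟨f, hf, fun _ _ => rfl⟩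
  refine ⟨g, hg, hgf, fun v v' hv hv' hρ hne hrank hadj => ?_⟩
  refine (hmin (Function.update g v' (g v)) ⟨fun x hx => ?_, fun x hx => ?_⟩).not_gt
    (card_parentRankPairs_update_lt hv hv' hρ hne hrank)
  · rcases eq_or_ne x v' with rfl | hxv
    · rw [Function.update_self]
      exact ⟨hadj, by rw [(hg v (ne_of_dist_eq_succ hv)).2, hv, hv']⟩
    · rw [Function.update_of_ne hxv]
      exact hg x hx
  · rw [Function.update_of_ne (by rintro rfl; exact hx hv'), hgf x hx]

/-- `f` and `ρ` are the parents and ranks of a GBST as far as the levels from `l` on are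
concerned. -/
structure IsGBSTFrom (G : SimpleGraph V) (s : V) (f : V → V) (ρ : V → ℕ) (l : ℕ) : Prop where
  isBFSParent : IsBFSParent G s f
  rank_eq : ∀ u, l ≤ G.dist s u → ρ u = rankFromChildren (childrenOf s f u) ρ
  not_adj : ∀ v v', l < G.dist s v → G.dist s v = G.dist s v' → ρ v = ρ v' → ρ v' = ρ (f v') →
    f v ≠ f v' → ¬ G.Adj (f v) v'

theorem IsGBSTFrom.exists_pred {f : V → V} {ρ : V → ℕ} {l : ℕ} (h : IsGBSTFrom G s f ρ (l + 1)) :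
    ∃ g ρ', IsGBSTFrom G s g ρ' l := by
  classical
  obtain ⟨g, hg, hgf, hnot_adj⟩ := h.isBFSParent.exists_not_adj_on_level ρ l
  let ρ' : V → ℕ := fun u => if G.dist s u = l then rankFromChildren (childrenOf s g u) ρ else ρ u
  have hρ'_of_ne : ∀ u, G.dist s u ≠ l → ρ' u = ρ u := fun u hu => if_neg hu
  have hρ'_of_eq : ∀ u, G.dist s u = l → ρ' u = rankFromChildren (childrenOf s g u) ρ :=
    fun u hu => if_pos hu
  have hchildren : ∀ u, G.dist s u ≠ l → childrenOf s g u = childrenOf s f u := by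
    intro u hu
    ext v
    simp only [mem_childrenOf]
    refine and_congr_right fun hv => ?_
    by_cases hvl : G.dist s v = l + 1
    · have hfv := (h.isBFSParent v hv).2
      have hgv := (hg v hv).2
      constructor <;> rintro rfl <;> omega
    · rw [hgf v hvl]
  refine ⟨g, ρ', hg, fun u hu => ?_, fun v v' hl hd hρ hfast hne => ?_⟩
  · have hcongr : rankFromChildren (childrenOf s g u) ρ' = rankFromChildren (childrenOf s g u) ρ :=
      rankFromChildren_congr fun v hv => hρ'_of_ne v <| by
        obtain ⟨hvs, rfl⟩ := mem_childrenOf.1 hv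
        have := (hg v hvs).2
        omega
    rw [hcongr]
    by_cases hul : G.dist s u = l
    · exact hρ'_of_eq u hul
    · rw [hρ'_of_ne u hul, h.rank_eq u (by omega), hchildren u hul]
  · have hv's : v' ≠ s := by
      rintro rfl
      rw [SimpleGraph.dist_self] at hd
      omega
    have hgv' := (hg v' hv's).2
    rw [hρ'_of_ne v (by omega), hρ'_of_ne v' (by omega)] at hρ
    rw [hρ'_of_ne v' (by omega)] at hfast
    by_cases hvl : G.dist s v = l + 1
    · exact hnot_adj v v' hvl (hd ▸ hvl) hρ hne (by rw [hfast, hρ'_of_eq _ (by omega)])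
    · rw [hρ'_of_ne _ (by omega), hgf v' (by omega)] at hfast
      rw [hgf v hvl, hgf v' (by omega)] at hne
      rw [hgf v hvl]
      exact h.not_adj v v' (by omega) hd hρ hfast hne

theorem exists_isGBSTFrom (hG : G.Connected) (s : V) (l : ℕ) : ∃ f ρ, IsGBSTFrom G s f ρ l := by
  obtain ⟨j, hj⟩ : ∃ j, Fintype.card V ≤ l + j := ⟨Fintype.card V, Nat.le_add_left _ _⟩
  induction j generalizing l with
  | zero =>
    obtain ⟨f, hf⟩ := exists_isBFSParent hG s
    have hlt : ∀ u, G.dist s u < l := fun u => (dist_lt_card hG s u).trans_le hj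
    exact ⟨f, 0, hf, fun u hu => absurd (hlt u) hu.not_gt, fun v _ hv => absurd (hlt v) hv.not_gt⟩
  | succ j ih =>
    obtain ⟨f, ρ, h⟩ := ih (l + 1) (by omega)
    exact h.exists_pred

end Existence

theorem exists_isGBST {V : Type} [Finite V] {G : SimpleGraph V} (hG : G.Connected) (s : V) :
    ∃ 𝒯 : RankedBFSTree G s, 𝒯.IsGBST := by
  cases nonempty_fintype V
  obtain ⟨f, ρ, hf, hρ, hnot_adj⟩ := exists_isGBSTFrom hG s 0
  refine ⟨⟨f, ρ, fun v hv => (hf v hv).1, fun v hv => (hf v hv).2, ?rank_leaf, ?rank_of_unique,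
    ?rank_of_tie⟩, ?isGBST⟩
  case rank_leaf =>
    intro u hu
    have hempty : childrenOf s f u = ∅ := Finset.eq_empty_of_forall_notMem fun v hv =>
      hu v (mem_childrenOf.1 hv).1 (mem_childrenOf.1 hv).2
    rw [hρ u (Nat.zero_le _), rankFromChildren, if_pos hempty]
  case rank_of_unique =>
    intro u v hv hvu hlt
    rw [hρ u (Nat.zero_le _)]
    exact rankFromChildren_eq_of_forall_lt (mem_childrenOf.2 ⟨hv, hvu⟩) fun w hw =>
      hlt w (mem_childrenOf.1 hw).1 (mem_childrenOf.1 hw).2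
  case rank_of_tie =>
    intro u v v' hv hv' hne hvu hv'u heq hle
    rw [hρ u (Nat.zero_le _)]
    exact rankFromChildren_eq_succ_of_tie (mem_childrenOf.2 ⟨hv, hvu⟩)
      (mem_childrenOf.2 ⟨hv', hv'u⟩) hne heq fun w hw =>
        hle w (mem_childrenOf.1 hw).1 (mem_childrenOf.1 hw).2
  case isGBST =>
    rintro u v u' v' ⟨hv, rfl, -⟩ ⟨-, rfl, hfast'⟩ hne hd hrank
    exact hnot_adj v v' (hG.pos_dist_of_ne hv.symm) hd hrank hfast' hne

/-! ### Ranks, virtual distances and fast turns -/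

/-- `u` is the only broadcasting neighbour of the silent node `w`, where `B` marks the broadcasting
nodes. -/
structure IsSoleBroadcaster {V : Type*} (G : SimpleGraph V) (B : V → Prop) (u w : V) : Prop where
  adj : G.Adj u w
  broadcasts : B u
  silent : ¬ B w
  others_silent : ∀ x, G.Adj x w → x ≠ u → ¬ B x

/-- The fast edges that leave nodes of level `l` and rank `r` are served in the even round `t`,
where `S` is the block size and `R` the maximal rank. -/
def IsFastTurn (S R c l r t : ℕ) : Prop :=
  ((l / S : ℕ) : ℤ) - 6 * r ≡ ((t / 2 / (c * S) : ℕ) : ℤ) [ZMOD 6 * R] ∧ l ≡ t [MOD 3]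

theorem IsFastTurn.rank_eq {S R c l r r' t : ℕ} (h : IsFastTurn S R c l r t)
    (h' : IsFastTurn S R c l r' t) (hr : 1 ≤ r) (hr' : 1 ≤ r') (hrR : r ≤ R) (hr'R : r' ≤ R) :
    r = r' := by
  obtain ⟨q, hq⟩ := (h.1.trans h'.1.symm).dvd
  have hdvd : (R : ℤ) ∣ r - r' := ⟨q, by linarith⟩
  have hlt : |(r : ℤ) - r'| < R := by
    rw [abs_lt]
    omega
  have := Int.eq_zero_of_abs_lt_dvd hdvd hlt
  omega

namespace RankedBFSTree

section Rank

variable {V : Type} {G : SimpleGraph V} {s : V} (𝒯 : RankedBFSTree G s)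

theorem exists_child_rank_max [Fintype V] {v : V} (hv : v ≠ s) :
    ∃ x ∈ childrenOf s 𝒯.parent (𝒯.parent v),
      (∀ w ∈ childrenOf s 𝒯.parent (𝒯.parent v), 𝒯.rank w ≤ 𝒯.rank x) ∧
      (𝒯.rank (𝒯.parent v) = 𝒯.rank x ∨
        ∃ y ∈ childrenOf s 𝒯.parent (𝒯.parent v), y ≠ x ∧ 𝒯.rank y = 𝒯.rank x ∧
          𝒯.rank (𝒯.parent v) = 𝒯.rank x + 1) := by
  obtain ⟨x, hx, hmax⟩ := Finset.exists_max_image (childrenOf s 𝒯.parent (𝒯.parent v)) 𝒯.rank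
    ⟨v, mem_childrenOf.2 ⟨hv, rfl⟩⟩
  refine ⟨x, hx, hmax, ?_⟩
  simp only [mem_childrenOf, and_imp] at hx hmax ⊢
  by_cases! htie : ∃ y, y ≠ s ∧ 𝒯.parent y = 𝒯.parent v ∧ y ≠ x ∧ 𝒯.rank y = 𝒯.rank x
  · obtain ⟨y, hy, hyv, hyx, hrank⟩ := htie
    exact Or.inr ⟨y, ⟨hy, hyv⟩, hyx, hrank,
      𝒯.rank_of_tie _ x y hx.1 hy hyx.symm hx.2 hyv hrank.symm hmax⟩
  · exact Or.inl (𝒯.rank_of_unique _ x hx.1 hx.2 fun w hw hwv hwx =>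
      lt_of_le_of_ne (hmax w hw hwv) (htie w hw hwv hwx))

theorem rank_le_rank_parent [Finite V] {v : V} (hv : v ≠ s) :
    𝒯.rank v ≤ 𝒯.rank (𝒯.parent v) := by
  cases nonempty_fintype V
  obtain ⟨x, -, hmax, hrank⟩ := 𝒯.exists_child_rank_max hv
  refine (hmax v (mem_childrenOf.2 ⟨hv, rfl⟩)).trans ?_
  rcases hrank with hrank | ⟨_, -, -, -, hrank⟩ <;> omega

theorem one_le_rank [Finite V] (hG : G.Connected) (u : V) : 1 ≤ 𝒯.rank u := by
  cases nonempty_fintype V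
  obtain ⟨j, hj⟩ : ∃ j, Fintype.card V ≤ G.dist s u + j := ⟨Fintype.card V, by omega⟩
  induction j generalizing u with
  | zero => exact absurd (dist_lt_card hG s u) (by omega)
  | succ j ih =>
    by_cases! hchild : ∃ v, v ≠ s ∧ 𝒯.parent v = u
    · obtain ⟨v, hv, rfl⟩ := hchild
      exact (ih v (by have := 𝒯.dist_parent v hv; omega)).trans (𝒯.rank_le_rank_parent hv)
    · rw [𝒯.rank_leaf u hchild]

theorem rank_le_rank_root [Finite V] (hG : G.Connected) (v : V) : 𝒯.rank v ≤ 𝒯.rank s := by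
  obtain ⟨j, hj⟩ : ∃ j, G.dist s v = j := ⟨_, rfl⟩
  induction j generalizing v with
  | zero => exact (congrArg 𝒯.rank (hG.dist_eq_zero_iff.1 hj).symm).le
  | succ j ih =>
    have hv : v ≠ s := ne_of_dist_eq_succ hj
    exact (𝒯.rank_le_rank_parent hv).trans (ih _ (by have := 𝒯.dist_parent v hv; omega))

variable [Fintype V]

theorem rank_le_maxRank (v : V) : 𝒯.rank v ≤ 𝒯.maxRank := Finset.le_sup (Finset.mem_univ v)

theorem two_pow_rank_le_one_add_sum (hG : G.Connected) (u : V) :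
    2 ^ (𝒯.rank u - 1) ≤ 1 + ∑ v ∈ childrenOf s 𝒯.parent u, 2 ^ (𝒯.rank v - 1) := by
  classical
  rcases (childrenOf s 𝒯.parent u).eq_empty_or_nonempty with hempty | ⟨v, hv⟩
  · rw [𝒯.rank_leaf u fun v hv hvu =>
      Finset.notMem_empty v (hempty ▸ mem_childrenOf.2 ⟨hv, hvu⟩)]
    simp
  · obtain ⟨hvs, rfl⟩ := mem_childrenOf.1 hv
    obtain ⟨x, hx, -, hrank | ⟨y, hy, hyx, hxy, hrank⟩⟩ := 𝒯.exists_child_rank_max hvs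
    · rw [hrank]
      exact (Finset.single_le_sum (f := fun v => 2 ^ (𝒯.rank v - 1)) (fun _ _ => Nat.zero_le _)
        hx).trans (Nat.le_add_left _ _)
    · have hpair := Finset.sum_le_sum_of_subset (f := fun v => 2 ^ (𝒯.rank v - 1))
        (Finset.insert_subset hx (Finset.singleton_subset_iff.2 hy))
      rw [Finset.sum_pair hyx.symm, hxy] at hpair
      calc 2 ^ (𝒯.rank (𝒯.parent v) - 1) = 2 ^ (𝒯.rank x - 1 + 1) := by
            have := 𝒯.one_le_rank hG x
            congr 1
            omega
        _ ≤ _ := by rw [pow_succ]; omega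

theorem sum_sum_childrenOf_le (f : V → ℕ) (l : ℕ) :
    ∑ u with G.dist s u = l, ∑ v ∈ childrenOf s 𝒯.parent u, f v ≤
      ∑ v with G.dist s v = l + 1, f v := by
  classical
  rw [← Finset.sum_biUnion]
  · refine Finset.sum_le_sum_of_subset fun v hv => ?_
    obtain ⟨u, hu, hvu⟩ := Finset.mem_biUnion.1 hv
    obtain ⟨hvs, rfl⟩ := mem_childrenOf.1 hvu
    exact Finset.mem_filter.2 ⟨Finset.mem_univ v,
      (𝒯.dist_parent v hvs).symm.trans (congrArg (· + 1) (Finset.mem_filter.1 hu).2)⟩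
  · exact fun u _ u' _ hne => Finset.disjoint_left.2 fun v hv hv' =>
      hne ((mem_childrenOf.1 hv).2.symm.trans (mem_childrenOf.1 hv').2)

theorem sum_two_pow_rank_le_card (hG : G.Connected) (l : ℕ) :
    ∑ u with G.dist s u = l, 2 ^ (𝒯.rank u - 1) ≤
      (Finset.univ.filter fun u => l ≤ G.dist s u).card := by
  classical
  obtain ⟨j, hj⟩ : ∃ j, Fintype.card V ≤ l + j := ⟨Fintype.card V, Nat.le_add_left _ _⟩
  induction j generalizing l with
  | zero =>
    rw [Finset.sum_eq_zero]
    · exact Nat.zero_le _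
    · intro u hu
      have := dist_lt_card hG s u
      have := (Finset.mem_filter.1 hu).2
      omega
  | succ j ih =>
    have hsplit : (Finset.univ.filter fun u => l ≤ G.dist s u).card =
        (Finset.univ.filter fun u => G.dist s u = l).card +
          (Finset.univ.filter fun u => l + 1 ≤ G.dist s u).card := by
      rw [← Finset.card_union_of_disjoint (Finset.disjoint_filter.2 fun u _ => by omega),
        ← Finset.filter_or]
      congr 1
      exact Finset.filter_congr fun u _ => by omega
    calc ∑ u with G.dist s u = l, 2 ^ (𝒯.rank u - 1)
        ≤ ∑ u with G.dist s u = l, (1 + ∑ v ∈ childrenOf s 𝒯.parent u, 2 ^ (𝒯.rank v - 1)) :=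
          Finset.sum_le_sum fun u _ => 𝒯.two_pow_rank_le_one_add_sum hG u
      _ = (Finset.univ.filter fun u => G.dist s u = l).card +
            ∑ u with G.dist s u = l, ∑ v ∈ childrenOf s 𝒯.parent u, 2 ^ (𝒯.rank v - 1) := by
          rw [Finset.sum_add_distrib, Finset.sum_const, smul_eq_mul, mul_one]
      _ ≤ _ := by
          rw [hsplit]
          exact Nat.add_le_add_left
            ((𝒯.sum_sum_childrenOf_le _ l).trans (ih (l + 1) (by omega))) _

theorem rank_le_clog_add_one (hG : G.Connected) (v : V) :
    𝒯.rank v ≤ Nat.clog 2 (Fintype.card V) + 1 := by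
  have hroot : 2 ^ (𝒯.rank s - 1) ≤ 2 ^ Nat.clog 2 (Fintype.card V) :=
    calc 2 ^ (𝒯.rank s - 1) ≤ ∑ u with G.dist s u = 0, 2 ^ (𝒯.rank u - 1) :=
          Finset.single_le_sum (f := fun u => 2 ^ (𝒯.rank u - 1)) (fun _ _ => Nat.zero_le _)
            (by simp)
      _ ≤ _ := 𝒯.sum_two_pow_rank_le_card hG 0
      _ ≤ Fintype.card V := Finset.card_le_univ _
      _ ≤ _ := Nat.le_pow_clog one_lt_two _
  have := (Nat.pow_le_pow_iff_right one_lt_two).1 hroot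
  have := 𝒯.rank_le_rank_root hG v
  omega

theorem maxRank_le_clog_add_one (hG : G.Connected) :
    𝒯.maxRank ≤ Nat.clog 2 (Fintype.card V) + 1 :=
  Finset.sup_le fun v _ => 𝒯.rank_le_clog_add_one hG v

end Rank

section VirtualDist

variable {V : Type} {G : SimpleGraph V} {s : V} (𝒯 : RankedBFSTree G s)

theorem virtualDist_le {v : V} {d : ℕ} (x : ℕ → V) (h0 : x 0 = s) (hd : x d = v)
    (h : ∀ i < d, G.Adj (x i) (x (i + 1)) ∨ Relation.TransGen 𝒯.FastEdge (x i) (x (i + 1))) :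
    𝒯.virtualDist v ≤ d := Nat.sInf_le ⟨x, h0, hd, h⟩

theorem exists_virtualDist_path (hG : G.Connected) (v : V) :
    ∃ x : ℕ → V, x 0 = s ∧ x (𝒯.virtualDist v) = v ∧ ∀ i < 𝒯.virtualDist v,
      G.Adj (x i) (x (i + 1)) ∨ Relation.TransGen 𝒯.FastEdge (x i) (x (i + 1)) := by
  refine Nat.sInf_mem (s := {d | ∃ x : ℕ → V, x 0 = s ∧ x d = v ∧
    ∀ i < d, G.Adj (x i) (x (i + 1)) ∨ Relation.TransGen 𝒯.FastEdge (x i) (x (i + 1))}) ?_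
  obtain ⟨p⟩ := hG.preconnected s v
  exact ⟨p.length, p.getVert, p.getVert_zero, p.getVert_length,
    fun i hi => Or.inl (p.adj_getVert_succ hi)⟩

theorem virtualDist_root : 𝒯.virtualDist s = 0 :=
  Nat.le_zero.1 (𝒯.virtualDist_le (fun _ => s) rfl rfl fun _ h => absurd h (Nat.not_lt_zero _))

theorem virtualDist_eq_zero_iff (hG : G.Connected) {v : V} : 𝒯.virtualDist v = 0 ↔ v = s := by
  refine ⟨fun h => ?_, fun h => h ▸ 𝒯.virtualDist_root⟩
  obtain ⟨x, h0, hd, -⟩ := 𝒯.exists_virtualDist_path hG v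
  rw [h, h0] at hd
  exact hd.symm

theorem virtualDist_le_add_one (hG : G.Connected) {u v : V}
    (h : G.Adj u v ∨ Relation.TransGen 𝒯.FastEdge u v) :
    𝒯.virtualDist v ≤ 𝒯.virtualDist u + 1 := by
  obtain ⟨x, h0, hd, hx⟩ := 𝒯.exists_virtualDist_path hG u
  refine 𝒯.virtualDist_le (fun i => if i ≤ 𝒯.virtualDist u then x i else v) (by simpa using h0)
    (by simp) fun i hi => ?_
  rcases Nat.lt_succ_iff_lt_or_eq.1 hi with hi | rfl
  · simpa [hi.le, Nat.succ_le_of_lt hi] using hx i hi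
  · simpa [hd] using h

theorem virtualDist_le_add_one_of_reflTransGen (hG : G.Connected) {u v : V}
    (h : Relation.ReflTransGen 𝒯.FastEdge u v) : 𝒯.virtualDist v ≤ 𝒯.virtualDist u + 1 := by
  rcases Relation.reflTransGen_iff_eq_or_transGen.1 h with rfl | h
  exacts [Nat.le_succ _, 𝒯.virtualDist_le_add_one hG (Or.inr h)]

theorem exists_virtualDist_pred (hG : G.Connected) {v : V} {d : ℕ} (h : 𝒯.virtualDist v = d + 1) :
    ∃ u, 𝒯.virtualDist u = d ∧ (G.Adj u v ∨ Relation.TransGen 𝒯.FastEdge u v) := by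
  obtain ⟨x, h0, hd, hx⟩ := 𝒯.exists_virtualDist_path hG v
  rw [h] at hd hx
  have hlast := hx d (Nat.lt_succ_self d)
  rw [hd] at hlast
  refine ⟨x d, le_antisymm (𝒯.virtualDist_le x h0 rfl fun i hi => hx i (by omega)) ?_, hlast⟩
  have := 𝒯.virtualDist_le_add_one hG hlast
  omega

theorem exists_adj_or_fastEdge (hG : G.Connected) {w : V} {d : ℕ} (h : 𝒯.virtualDist w = d + 1) :
    (∃ u, G.Adj u w ∧ 𝒯.virtualDist u = d) ∨
      (𝒯.FastEdge (𝒯.parent w) w ∧ 𝒯.virtualDist (𝒯.parent w) = d + 1) := by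
  by_cases hslow : ∃ u, G.Adj u w ∧ 𝒯.virtualDist u = d
  · exact Or.inl hslow
  obtain ⟨u, hu, huw | huw⟩ := 𝒯.exists_virtualDist_pred hG h
  · exact absurd ⟨u, huw, hu⟩ hslow
  obtain ⟨x, hux, hxw⟩ := Relation.TransGen.tail'_iff.1 huw
  obtain ⟨hws, rfl, hrank⟩ := hxw
  have hadj : G.Adj (𝒯.parent w) w := 𝒯.adj_parent w hws
  have hne : 𝒯.virtualDist (𝒯.parent w) ≠ d := fun hx => hslow ⟨_, hadj, hx⟩
  have hlower := 𝒯.virtualDist_le_add_one hG (Or.inl hadj)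
  have hupper := 𝒯.virtualDist_le_add_one_of_reflTransGen hG hux
  exact Or.inr ⟨⟨hws, rfl, hrank⟩, by omega⟩

/-- Along the tree path from the root, the rank drops with every slow edge, and two slow edges are
joined by at most one shortcut. -/
theorem exists_reflTransGen_virtualDist_add_le [Finite V] (hG : G.Connected) (v : V) :
    ∃ x, Relation.ReflTransGen 𝒯.FastEdge x v ∧
      𝒯.virtualDist x + 2 * 𝒯.rank v ≤ 2 * 𝒯.rank s := by
  obtain ⟨j, hj⟩ : ∃ j, G.dist s v = j := ⟨_, rfl⟩
  induction j generalizing v with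
  | zero =>
    obtain rfl := hG.dist_eq_zero_iff.1 hj
    exact ⟨s, .refl, by rw [virtualDist_root, zero_add]⟩
  | succ j ih =>
    have hvs : v ≠ s := ne_of_dist_eq_succ hj
    obtain ⟨x, hx, hle⟩ := ih (𝒯.parent v) (by have := 𝒯.dist_parent v hvs; omega)
    by_cases hfast : 𝒯.rank v = 𝒯.rank (𝒯.parent v)
    · exact ⟨x, hx.tail ⟨hvs, rfl, hfast⟩, hfast ▸ hle⟩
    · have hrank := 𝒯.rank_le_rank_parent hvs
      have hv := 𝒯.virtualDist_le_add_one hG (Or.inl (𝒯.adj_parent v hvs))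
      have hparent := 𝒯.virtualDist_le_add_one_of_reflTransGen hG hx
      exact ⟨v, .refl, by omega⟩

theorem virtualDist_le_clog [Fintype V] (hG : G.Connected) (v : V) :
    𝒯.virtualDist v ≤ 2 * Nat.clog 2 (Fintype.card V) + 1 := by
  obtain ⟨x, hx, hle⟩ := 𝒯.exists_reflTransGen_virtualDist_add_le hG v
  have hroot := 𝒯.rank_le_clog_add_one hG s
  have hrank := 𝒯.one_le_rank hG v
  have hv := 𝒯.virtualDist_le_add_one_of_reflTransGen hG hx
  omega

end VirtualDist

section Broadcasts

variable {V : Type} [Fintype V] {G : SimpleGraph V} {s : V} {𝒯 : RankedBFSTree G s}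

theorem broadcasts_odd_iff {c t : ℕ} (ht : t % 2 = 1) (u : V) (b : Bool) :
    Broadcasts 𝒯 c t u b ↔ t / 2 ≡ 𝒯.virtualDist u [MOD 3] ∧ b = true := by
  rw [Broadcasts, if_pos ht]

theorem broadcasts_even_iff {c t : ℕ} (ht : t % 2 = 0) (u : V) (b : Bool) :
    Broadcasts 𝒯 c t u b ↔ 𝒯.Fast u ∧
      IsFastTurn (blockSize (Fintype.card V)) 𝒯.maxRank c (G.dist s u) (𝒯.rank u) t := by
  rw [Broadcasts, if_neg (by omega), IsFastTurn]

theorem IsGBST.isSoleBroadcaster_of_fastEdge (hT : 𝒯.IsGBST) (hG : G.Connected) {c t : ℕ}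
    (ht : t % 2 = 0) {u v : V} (huv : 𝒯.FastEdge u v)
    (hturn : IsFastTurn (blockSize (Fintype.card V)) 𝒯.maxRank c (G.dist s u) (𝒯.rank u) t)
    (b : V → Bool) : IsSoleBroadcaster G (fun x => Broadcasts 𝒯 c t x (b x)) u v := by
  obtain ⟨hv, rfl, hr⟩ := huv
  have hd := 𝒯.dist_parent v hv
  refine ⟨𝒯.adj_parent v hv, (broadcasts_even_iff ht _ _).2 ⟨⟨v, hv, rfl, hr⟩, hturn⟩,
    fun h => ?_, fun x hxv hne h => ?_⟩
  · have hlevel := hturn.2.trans ((broadcasts_even_iff ht _ _).1 h).2.2.symm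
    unfold Nat.ModEq at hlevel
    omega
  · obtain ⟨⟨y, hy, hyx, hry⟩, hxturn⟩ := (broadcasts_even_iff ht _ _).1 h
    have hdx : G.dist s x = G.dist s (𝒯.parent v) := by
      have hlower := dist_le_dist_add_one s hxv.symm
      have hupper := dist_le_dist_add_one s hxv
      have hlevel := hturn.2.trans hxturn.2.symm
      unfold Nat.ModEq at hlevel
      omega
    have hrank : 𝒯.rank x = 𝒯.rank (𝒯.parent v) :=
      (hdx ▸ hxturn).rank_eq hturn (𝒯.one_le_rank hG _) (𝒯.one_le_rank hG _)
        (𝒯.rank_le_maxRank _) (𝒯.rank_le_maxRank _)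
    have hdy := 𝒯.dist_parent y hy
    rw [hyx] at hdy
    exact hT x y (𝒯.parent v) v ⟨hy, hyx, hry⟩ ⟨hv, rfl, hr⟩ hne (by omega) (by omega) hxv

end Broadcasts

end RankedBFSTree

/-! ### Spreading on an abstract layout -/

/-- The data of a ranked BFS tree and of the schedule on it that govern how fast a message
spreads: levels, virtual distances, ranks and parents of the nodes, the number of rounds of a Decay
phase, the block size and the largest rank. -/
structure SpreadLayout (V : Type*) where
  level : V → ℕ
  virtualDist : V → ℕ
  rank : V → ℕ
  parent : V → V
  decayLength : ℕ
  blockSize : ℕ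
  maxRank : ℕ

namespace SpreadLayout

variable {V : Type*} (P : SpreadLayout V)

/-- The number of the block of `blockSize` consecutive levels that contains the level of the parent
of `w`. -/
def block (w : V) : ℕ := (P.level w - 1) / P.blockSize

/-- The nodes above level `lo` whose level and virtual distance add up to at most `hi`: a message
reaches such a node through nodes of level at most `hi`. -/
def InZone (lo hi : ℕ) (w : V) : Prop := lo < P.level w ∧ P.level w + P.virtualDist w ≤ hi

/-- The relations between the parameters that hold for Robust FASTBC. -/
structure IsAdmissible : Prop where
  one_le_blockSize : 1 ≤ P.blockSize
  one_le_decayLength : 1 ≤ P.decayLength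
  decayLength_le : P.decayLength ≤ 2 ^ P.blockSize
  one_le_maxRank : 1 ≤ P.maxRank
  maxRank_le : P.maxRank ≤ 2 * P.decayLength
  virtualDist_le : ∀ w, P.virtualDist w ≤ 2 * P.decayLength + 1

/-- One Decay phase: if `f t u ≤ Q` for the possible predecessors `u` of `w` and `f t w ≤ B`, then
`f` drops at `w` to `(1 - q) B + q Q` within `6 * decayLength` rounds. -/
def SlowStep (f : ℕ → V → ℝ) (t₀ t₁ : ℕ) (q : ℝ) (w : V) : Prop :=
  ∀ (t : ℕ) (B Q : ℝ), t₀ ≤ t → t + 6 * P.decayLength ≤ t₁ → f t w ≤ B →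
    (∀ u, P.virtualDist u + 1 = P.virtualDist w → P.level u ≤ P.level w + 1 → f t u ≤ Q) →
    f (t + 6 * P.decayLength) w ≤ (1 - q) * B + q * Q

/-- The edge from the parent of `w` to `w` is fast, and in each of its turns the value at `w` moves
towards the value at the parent. -/
structure FastStep (c : ℕ) (f : ℕ → V → ℝ) (t₀ t₁ : ℕ) (ρ : ℝ) (w : V) : Prop where
  level_parent : P.level (P.parent w) + 1 = P.level w
  virtualDist_parent : P.virtualDist (P.parent w) = P.virtualDist w
  rank_parent : P.rank (P.parent w) = P.rank w
  step : ∀ t, t₀ ≤ t → t < t₁ → t % 2 = 0 →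
    IsFastTurn P.blockSize P.maxRank c (P.level (P.parent w)) (P.rank (P.parent w)) t →
    f (t + 1) w ≤ (1 - ρ) * f t w + ρ * f t (P.parent w)

/-- The rules for the probabilities `f t w` that `w` is uninformed after `t` rounds, in the time
interval from `t₀` to `t₁` and on the zone given by `lo` and `hi`; the nodes up to level `lo` are
informed. -/
structure SpreadRules (c : ℕ) (f : ℕ → V → ℝ) (lo hi t₀ t₁ : ℕ) (ρ q : ℝ) : Prop where
  le_one : ∀ t w, t₀ ≤ t → t ≤ t₁ → f t w ≤ 1
  succ_le : ∀ t w, t₀ ≤ t → t < t₁ → f (t + 1) w ≤ f t w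
  low : ∀ t w, t₀ ≤ t → t ≤ t₁ → P.level w ≤ lo → f t w ≤ 0
  step : ∀ w, P.InZone lo hi w → P.SlowStep f t₀ t₁ q w ∨ P.FastStep c f t₀ t₁ ρ w

/-- `θ` is a possible decay factor per round: over `72 * c * blockSize * decayLength` rounds it
amounts to half a Decay phase, and it leaves room for the failures inside one block, for which there
are `2 ^ blockSize` possibilities. -/
structure IsDecayRate (c : ℕ) (ρ q θ : ℝ) : Prop where
  pos : 0 < θ
  le_one : θ ≤ 1
  pow_eq : θ ^ (72 * (c * P.blockSize) * P.decayLength) = 1 - q / 2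
  tail_le : 2 * (2 ^ P.blockSize * (1 - ρ / 2) ^ (c * P.blockSize / 3)) ≤
    θ ^ (2 * (c * P.blockSize)) * (1 - θ ^ (2 * (c * P.blockSize)))

/-- Up to a constant the bound that is proved for the probability that `w` is uninformed after `t`
rounds: exponential decay at rate `θ`, delayed by `4 * c * blockSize` rounds for each block above
level `lo`, with a factor `32 / q` for each hop of the virtual distance. -/
noncomputable def envelope (c lo t₀ : ℕ) (q θ : ℝ) (t : ℕ) (w : V) : ℝ :=
  (32 / q) ^ P.virtualDist w *
    θ⁻¹ ^ (4 * (c * P.blockSize) * (P.block w - lo / P.blockSize)) * θ ^ (t - t₀)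

variable {P} {c lo hi t₀ t₁ : ℕ} {ρ q θ : ℝ} {f : ℕ → V → ℝ}

section Envelope

theorem IsDecayRate.half_le_pow (hθ : P.IsDecayRate c ρ q θ) (hq1 : q ≤ 1) {n : ℕ}
    (hn : n ≤ 72 * (c * P.blockSize) * P.decayLength) : 1 / 2 ≤ θ ^ n :=
  calc 1 / 2 ≤ 1 - q / 2 := by linarith
    _ = θ ^ (72 * (c * P.blockSize) * P.decayLength) := hθ.pow_eq.symm
    _ ≤ θ ^ n := pow_le_pow_of_le_one hθ.pos.le hθ.le_one hn

theorem envelope_pos (hθ : 0 < θ) (hq : 0 < q) (t : ℕ) (w : V) :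
    0 < P.envelope c lo t₀ q θ t w := by
  unfold envelope
  positivity

theorem envelope_add {t : ℕ} (ht : t₀ ≤ t) (n : ℕ) (w : V) :
    P.envelope c lo t₀ q θ (t + n) w = P.envelope c lo t₀ q θ t w * θ ^ n := by
  rw [envelope, envelope, Nat.sub_add_comm ht, pow_add, mul_assoc _ _ (θ ^ n)]

theorem envelope_congr {x w : V} (hd : P.virtualDist x = P.virtualDist w)
    (hb : P.block x = P.block w) (t : ℕ) :
    P.envelope c lo t₀ q θ t x = P.envelope c lo t₀ q θ t w := by
  rw [envelope, envelope, hd, hb]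

theorem IsDecayRate.half_le_envelope (hθ : P.IsDecayRate c ρ q θ) (hq0 : 0 < q) (hq1 : q ≤ 1)
    {t : ℕ} (ht : t - t₀ ≤ 72 * (c * P.blockSize) * P.decayLength) (w : V) :
    1 / 2 ≤ P.envelope c lo t₀ q θ t w := by
  have hhop : (1 : ℝ) ≤ 32 / q := by
    rw [le_div_iff₀ hq0]
    linarith
  have hweight : 1 ≤ (32 / q) ^ P.virtualDist w *
      θ⁻¹ ^ (4 * (c * P.blockSize) * (P.block w - lo / P.blockSize)) :=
    one_le_mul_of_one_le_of_one_le (one_le_pow₀ hhop)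
      (one_le_pow₀ ((one_le_inv₀ hθ.pos).2 hθ.le_one))
  exact (hθ.half_le_pow hq1 ht).trans (le_mul_of_one_le_left (pow_nonneg hθ.pos.le _) hweight)

theorem envelope_next_block (hθ : 0 < θ) {x w : V} (hd : P.virtualDist x = P.virtualDist w)
    (hb : P.block x + 1 = P.block w) (hx : lo < P.level x) (t : ℕ) :
    P.envelope c lo t₀ q θ t w * θ ^ (4 * (c * P.blockSize)) = P.envelope c lo t₀ q θ t x := by
  have hlo : lo / P.blockSize ≤ P.block x := Nat.div_le_div_right (by omega)
  have hdelay : P.block w - lo / P.blockSize = P.block x - lo / P.blockSize + 1 := by omega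
  rw [envelope, envelope, hd, hdelay, mul_add_one, pow_add, mul_right_comm, ← mul_assoc,
    mul_assoc _ (θ⁻¹ ^ (4 * (c * P.blockSize))), ← mul_pow, inv_mul_cancel₀ hθ.ne', one_pow,
    mul_one]

/-- A hop of the virtual distance may lead one level up, hence into the next block. -/
theorem IsDecayRate.envelope_pred_le (hθ : P.IsDecayRate c ρ q θ) (hq0 : 0 < q) (hq1 : q ≤ 1)
    (hP : P.IsAdmissible) {u w : V} (hd : P.virtualDist u + 1 = P.virtualDist w)
    (hl : P.level u ≤ P.level w + 1) (t : ℕ) :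
    16 * P.envelope c lo t₀ q θ t u ≤ q * P.envelope c lo t₀ q θ t w := by
  set a := 4 * (c * P.blockSize)
  set m := P.block w - lo / P.blockSize
  have hdelay : P.block u - lo / P.blockSize ≤ m + 1 := by
    have : P.block u ≤ P.block w + 1 :=
      calc P.block u ≤ (P.level w - 1 + P.blockSize) / P.blockSize :=
            Nat.div_le_div_right (by have := hP.one_le_blockSize; omega)
        _ = P.block w + 1 := Nat.add_div_right _ hP.one_le_blockSize
    omega
  have hblock : θ⁻¹ ^ a ≤ 2 := by
    have hle : a ≤ 72 * (c * P.blockSize) * P.decayLength :=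
      (Nat.mul_le_mul_right _ (by norm_num)).trans (Nat.le_mul_of_pos_right _ hP.one_le_decayLength)
    rw [inv_pow]
    exact inv_le_of_inv_le₀ two_pos (by simpa using hθ.half_le_pow hq1 hle)
  have hθ0 := hθ.pos
  calc 16 * P.envelope c lo t₀ q θ t u
      ≤ 16 * ((32 / q) ^ P.virtualDist u * θ⁻¹ ^ (a * (m + 1)) * θ ^ (t - t₀)) := by
        unfold envelope
        gcongr
        exact (one_le_inv₀ hθ0).2 hθ.le_one
    _ = 16 * ((32 / q) ^ P.virtualDist u * (θ⁻¹ ^ (a * m) * θ⁻¹ ^ a) * θ ^ (t - t₀)) := by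
        rw [mul_add_one, pow_add]
    _ ≤ 16 * ((32 / q) ^ P.virtualDist u * (θ⁻¹ ^ (a * m) * 2) * θ ^ (t - t₀)) := by gcongr
    _ = q * P.envelope c lo t₀ q θ t w := by
        rw [envelope, ← hd, pow_succ]
        field_simp
        ring

end Envelope

theorem exists_modEq_block {N R t : ℕ} (hN : 1 ≤ N) (hR : 1 ≤ R) (ht : N * R ≤ t) (y : ℤ) :
    ∃ j : ℕ, N * (j + 1) ≤ t ∧ t ≤ N * (j + 1) + N * R ∧ y ≡ (j : ℤ) [ZMOD (R : ℕ)] := by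
  have hRN : R ≤ t / N := by rwa [Nat.le_div_iff_mul_le hN, mul_comm]
  have hRpos : (0 : ℤ) < (R : ℤ) := by omega
  have hlt := Int.emod_lt_of_pos (y - (t / N - R : ℕ)) hRpos
  have hnonneg := Int.emod_nonneg (y - (t / N - R : ℕ)) hRpos.ne'
  refine ⟨t / N - R + ((y - (t / N - R : ℕ)) % (R : ℤ)).toNat, ?_, ?_, ?_⟩
  · exact (Nat.mul_le_mul_left N (by omega)).trans (Nat.mul_div_le t N)
  · rw [← mul_add]
    exact (Nat.lt_mul_div_succ t hN).le.trans (Nat.mul_le_mul_left N (by omega))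
  · rw [Nat.cast_add, Int.toNat_of_nonneg hnonneg]
    have := (Int.mod_modEq (y - (t / N - R : ℕ)) (R : ℤ)).symm.add_left ((t / N - R : ℕ) : ℤ)
    rwa [add_sub_cancel] at this

theorem exists_isFastTurn {S R l r j i : ℕ}
    (hact : ((l / S : ℕ) : ℤ) - 6 * r ≡ (j : ℤ) [ZMOD 6 * R]) (hi : 6 * (i + 1) ≤ 2 * (c * S)) :
    ∃ t, 2 * (c * S) * j + 6 * i ≤ t ∧ t < 2 * (c * S) * j + 6 * (i + 1) ∧ t % 2 = 0 ∧
      IsFastTurn S R c l r t := by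
  set T := 2 * (c * S) * j
  obtain ⟨t, hle, hlt, heven, hmod⟩ : ∃ t, T + 6 * i ≤ t ∧ t < T + 6 * (i + 1) ∧ t % 2 = 0 ∧
      l % 3 = t % 3 :=
    ⟨T + 6 * i + (6 - T % 6 + 4 * (l % 3)) % 6, by omega, by omega, by omega, by omega⟩
  have hj : t / 2 / (c * S) = j := by
    have hsucc : 2 * (c * S) * (j + 1) = T + 2 * (c * S) := mul_add_one _ _
    rw [Nat.div_div_eq_div_mul]
    refine Nat.div_eq_of_lt_le ?_ ?_ <;> rw [mul_comm] <;> omega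
  exact ⟨t, hle, hlt, heven, hj ▸ hact, hmod⟩

theorem FastStep.block_parent {w : V} (hw : P.FastStep c f t₀ t₁ ρ w)
    (hlevel : P.level (P.parent w) ≠ 0) :
    P.block (P.parent w) = P.block w ∨ P.block (P.parent w) + 1 = P.block w := by
  obtain ⟨l, hl⟩ := Nat.exists_eq_succ_of_ne_zero hlevel
  rw [block, block, ← hw.level_parent, hl, Nat.succ_eq_add_one, Nat.add_sub_cancel,
    Nat.add_sub_cancel, Nat.succ_div]
  split_ifs
  exacts [Or.inr rfl, Or.inl rfl]

namespace SpreadRules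

theorem antitone (h : P.SpreadRules c f lo hi t₀ t₁ ρ q) {t t' : ℕ} (w : V)
    (h0 : t₀ ≤ t) (htt : t ≤ t') (h1 : t' ≤ t₁) : f t' w ≤ f t w := by
  induction t', htt using Nat.le_induction with
  | base => exact le_rfl
  | succ n hn ih => exact (h.succ_le n w (h0.trans hn) h1).trans (ih (by omega))

theorem fast_step_le (h : P.SpreadRules c f lo hi t₀ t₁ ρ q) (hρ0 : 0 ≤ ρ) (hρ1 : ρ ≤ 1) {w : V}
    (hw : P.FastStep c f t₀ t₁ ρ w) {j i : ℕ} (h0 : t₀ ≤ 2 * (c * P.blockSize) * j)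
    (h1 : 2 * (c * P.blockSize) * (j + 1) ≤ t₁)
    (hact : (P.block w : ℤ) - 6 * P.rank w ≡ (j : ℤ) [ZMOD 6 * P.maxRank])
    (hi : 6 * (i + 1) ≤ 2 * (c * P.blockSize)) :
    f (2 * (c * P.blockSize) * j + 6 * (i + 1)) w ≤
      (1 - ρ) * f (2 * (c * P.blockSize) * j + 6 * i) w +
        ρ * f (2 * (c * P.blockSize) * j + 6 * i) (P.parent w) := by
  have hlevel : P.level w - 1 = P.level (P.parent w) := by
    have := hw.level_parent
    omega
  rw [block, hlevel, ← hw.rank_parent] at hact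
  rw [mul_add_one] at h1
  obtain ⟨t, hle, hlt, heven, hturn⟩ := exists_isFastTurn hact hi
  calc f (2 * (c * P.blockSize) * j + 6 * (i + 1)) w
      ≤ f (t + 1) w := h.antitone w (by omega) (by omega) (by omega)
    _ ≤ (1 - ρ) * f t w + ρ * f t (P.parent w) := hw.step t (by omega) (by omega) heven hturn
    _ ≤ _ := by
        have : 0 ≤ 1 - ρ := by linarith
        gcongr
        · exact h.antitone w (by omega) hle (by omega)
        · exact h.antitone _ (by omega) hle (by omega)

/-- Progress along a fast stretch during one active block of rounds. Doubling the bound with each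
level pays for the convex combination with the value at the parent. -/
theorem le_add_of_active (h : P.SpreadRules c f lo hi t₀ t₁ ρ q) (hρ0 : 0 ≤ ρ) (hρ1 : ρ ≤ 1)
    {j d r b : ℕ} {U Q : ℝ} (hU : 0 ≤ U) (hQ : 0 ≤ Q) (h0 : t₀ ≤ 2 * (c * P.blockSize) * j)
    (h1 : 2 * (c * P.blockSize) * (j + 1) ≤ t₁)
    (hact : (b : ℤ) - 6 * r ≡ (j : ℤ) [ZMOD 6 * P.maxRank])
    (hslow : ∀ x, P.InZone lo hi x → P.virtualDist x = d → P.block x = b →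
      P.SlowStep f t₀ t₁ q x → f (2 * (c * P.blockSize) * j) x ≤ U)
    (hprev : ∀ x, P.InZone lo hi x → P.virtualDist x = d → P.block x + 1 = b → P.rank x = r →
      f (2 * (c * P.blockSize) * j) x ≤ U)
    (hall : ∀ x, P.InZone lo hi x → P.virtualDist x = d → P.block x = b →
      f (2 * (c * P.blockSize) * j) x ≤ Q)
    (i : ℕ) (hi' : 6 * i ≤ 2 * (c * P.blockSize)) (x : V) (hx : P.InZone lo hi x)
    (hxd : P.virtualDist x = d) (hxb : P.block x = b) (hxr : P.rank x = r) :
    f (2 * (c * P.blockSize) * j + 6 * i) x ≤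
      U + Q * 2 ^ (P.level x - b * P.blockSize) * (1 - ρ / 2) ^ i := by
  have hγ : 0 ≤ 1 - ρ / 2 := by linarith
  have hend : 2 * (c * P.blockSize) * j + 2 * (c * P.blockSize) ≤ t₁ := by rwa [← mul_add_one]
  induction i generalizing x with
  | zero =>
    have hpow : Q ≤ Q * 2 ^ (P.level x - b * P.blockSize) :=
      le_mul_of_one_le_right hQ (one_le_pow₀ one_le_two)
    simpa using (hall x hx hxd hxb).trans (hpow.trans (le_add_of_nonneg_left hU))
  | succ i ih =>
    set T := 2 * (c * P.blockSize) * j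
    rcases h.step x hx with hs | hfast
    · exact ((h.antitone x h0 (Nat.le_add_right T _) (by omega)).trans
        (hslow x hx hxd hxb hs)).trans (le_add_of_nonneg_right (by positivity))
    have hlevel := hfast.level_parent
    have hxzone := hx
    obtain ⟨-, hhi⟩ := hx
    have hstart : b * P.blockSize ≤ P.level (P.parent x) := by
      rw [← hxb]
      exact (Nat.div_mul_le_self _ _).trans (by omega)
    have hparent : f (T + 6 * i) (P.parent x) ≤
        U + Q * 2 ^ (P.level (P.parent x) - b * P.blockSize) * (1 - ρ / 2) ^ i := by
      rcases le_or_gt (P.level (P.parent x)) lo with hlo | hlo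
      · exact (h.low _ _ (by omega) (by omega) hlo).trans (by positivity)
      have hzone : P.InZone lo hi (P.parent x) := ⟨hlo, by have := hfast.virtualDist_parent; omega⟩
      have hd := hfast.virtualDist_parent.trans hxd
      have hr := hfast.rank_parent.trans hxr
      rcases hfast.block_parent (by omega) with hb | hb
      · exact ih (by omega) _ hzone hd (hb.trans hxb) hr
      · exact ((h.antitone _ h0 (Nat.le_add_right T _) (by omega)).trans
          (hprev _ hzone hd (hb.trans hxb) hr)).trans (le_add_of_nonneg_right (by positivity))
    have hpow : (2 : ℝ) ^ (P.level x - b * P.blockSize) =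
        2 * 2 ^ (P.level (P.parent x) - b * P.blockSize) := by
      rw [← pow_succ']
      congr 1
      omega
    have hself := ih (by omega) x hxzone hxd hxb hxr
    have : 0 ≤ 1 - ρ := by linarith
    rw [hpow] at hself ⊢
    calc f (T + 6 * (i + 1)) x
        ≤ (1 - ρ) * f (T + 6 * i) x + ρ * f (T + 6 * i) (P.parent x) :=
          h.fast_step_le hρ0 hρ1 hfast h0 h1 (by rwa [hxb, hxr]) hi'
      _ ≤ (1 - ρ) *
              (U + Q * (2 * 2 ^ (P.level (P.parent x) - b * P.blockSize)) * (1 - ρ / 2) ^ i) +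
            ρ * (U + Q * 2 ^ (P.level (P.parent x) - b * P.blockSize) * (1 - ρ / 2) ^ i) := by
          gcongr
      _ = _ := by ring

end SpreadRules
end SpreadLayout

namespace SpreadLayout

variable {V : Type*} {P : SpreadLayout V} {c lo hi t₀ t₁ : ℕ} {ρ q θ : ℝ} {f : ℕ → V → ℝ}

variable (P) in
/-- The invariant of the induction on time. A node that is reached by a Decay step satisfies a
stronger bound at all times, and one that is reached by a fast edge satisfies it at the end of each
active block of rounds. -/
structure EnvelopeBound (c lo t₀ t₁ : ℕ) (q θ : ℝ) (f : ℕ → V → ℝ) (t : ℕ) (w : V) : Prop where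
  of_slow : P.SlowStep f t₀ t₁ q w → f t w ≤ 2 * P.envelope c lo t₀ q θ t w
  of_active : ∀ j : ℕ, t = 2 * (c * P.blockSize) * (j + 1) →
    (P.block w : ℤ) - 6 * P.rank w ≡ (j : ℤ) [ZMOD 6 * P.maxRank] →
    f t w ≤ 8 * P.envelope c lo t₀ q θ t w
  le : f t w ≤ 16 * P.envelope c lo t₀ q θ t w

theorem IsDecayRate.envelopeBound_of_early (hθ : P.IsDecayRate c ρ q θ) (hq0 : 0 < q)
    (hq1 : q ≤ 1) {t : ℕ} (ht : t - t₀ ≤ 72 * (c * P.blockSize) * P.decayLength) {w : V}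
    (hf : f t w ≤ 1) : P.EnvelopeBound c lo t₀ t₁ q θ f t w := by
  have := hθ.half_le_envelope hq0 hq1 ht (lo := lo) w
  exact ⟨fun _ => by linarith, fun _ _ _ => by linarith, by linarith⟩

theorem InZone.pred (w : V) {u : V} (hw : P.InZone lo hi w)
    (hd : P.virtualDist u + 1 = P.virtualDist w) (hl : P.level u ≤ P.level w + 1)
    (hu : lo < P.level u) : P.InZone lo hi u :=
  ⟨hu, by have := hw.2; omega⟩

namespace SpreadRules

/-- A Decay phase gains the factor `1 - q / 2`, as the envelope of the predecessors is smaller by a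
factor of order `q`. -/
theorem slow_le_envelope (h : P.SpreadRules c f lo hi t₀ t₁ ρ q) (hP : P.IsAdmissible) (hc : 1 ≤ c)
    (hq0 : 0 < q) (hq1 : q ≤ 1) (hθ : P.IsDecayRate c ρ q θ) {t : ℕ} (h0 : t₀ ≤ t)
    (h1 : t + 72 * (c * P.blockSize) * P.decayLength ≤ t₁) {w : V} (hw : P.InZone lo hi w)
    (hs : P.SlowStep f t₀ t₁ q w) (hself : f t w ≤ 2 * P.envelope c lo t₀ q θ t w)
    (hpred : ∀ u, P.InZone lo hi u → f t u ≤ 16 * P.envelope c lo t₀ q θ t u) :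
    f (t + 72 * (c * P.blockSize) * P.decayLength) w ≤
      2 * P.envelope c lo t₀ q θ (t + 72 * (c * P.blockSize) * P.decayLength) w := by
  set E := P.envelope c lo t₀ q θ t w
  have hE0 : 0 < E := envelope_pos hθ.pos hq0 t w
  have hphase : 6 * P.decayLength ≤ 72 * (c * P.blockSize) * P.decayLength :=
    Nat.mul_le_mul_right _ (by have := Nat.mul_pos hc hP.one_le_blockSize; omega)
  have hpred' : ∀ u, P.virtualDist u + 1 = P.virtualDist w → P.level u ≤ P.level w + 1 →
      f t u ≤ q * E := by
    intro u hd hl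
    rcases le_or_gt (P.level u) lo with hlo | hlo
    · exact (h.low t u h0 (by omega) hlo).trans (by positivity)
    · exact (hpred u (hw.pred w hd hl hlo)).trans (hθ.envelope_pred_le hq0 hq1 hP hd hl t)
  calc f (t + 72 * (c * P.blockSize) * P.decayLength) w
      ≤ f (t + 6 * P.decayLength) w := h.antitone w (by omega) (by omega) h1
    _ ≤ (1 - q) * (2 * E) + q * (q * E) :=
        hs t _ _ h0 (by omega) hself hpred'
    _ ≤ 2 * (E * (1 - q / 2)) := by nlinarith [mul_nonneg hq0.le (mul_nonneg hE0.le hq0.le)]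
    _ = _ := by rw [envelope_add h0, hθ.pow_eq]

theorem active_le_envelope (h : P.SpreadRules c f lo hi t₀ t₁ ρ q) (hP : P.IsAdmissible)
    (hρ0 : 0 ≤ ρ) (hρ1 : ρ ≤ 1) (hq0 : 0 < q) (hq1 : q ≤ 1) (hθ : P.IsDecayRate c ρ q θ) {j : ℕ}
    (hj : 1 ≤ j) (h0 : t₀ ≤ 2 * (c * P.blockSize) * j)
    (h1 : 2 * (c * P.blockSize) * (j + 1) ≤ t₁)
    (hbound : ∀ x, P.InZone lo hi x →
      P.EnvelopeBound c lo t₀ t₁ q θ f (2 * (c * P.blockSize) * j) x)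
    {w : V} (hw : P.InZone lo hi w)
    (hact : (P.block w : ℤ) - 6 * P.rank w ≡ (j : ℤ) [ZMOD 6 * P.maxRank]) :
    f (2 * (c * P.blockSize) * (j + 1)) w ≤
      8 * P.envelope c lo t₀ q θ (2 * (c * P.blockSize) * (j + 1)) w := by
  set T := 2 * (c * P.blockSize) * j with hT
  set E := P.envelope c lo t₀ q θ T w
  set a := θ ^ (2 * (c * P.blockSize)) with ha
  set γ := (1 - ρ / 2) ^ (c * P.blockSize / 3)
  have hE0 : 0 < E := envelope_pos hθ.pos hq0 T w
  have hsq : a ^ 2 = θ ^ (4 * (c * P.blockSize)) := by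
    rw [ha, ← pow_mul]
    ring_nf
  have hhalf : 1 / 2 ≤ a ^ 2 := hsq ▸ hθ.half_le_pow hq1
    ((Nat.mul_le_mul_right _ (by norm_num)).trans (Nat.le_mul_of_pos_right _ hP.one_le_decayLength))
  have hprev : ∀ x, P.InZone lo hi x → P.virtualDist x = P.virtualDist w →
      P.block x + 1 = P.block w → P.rank x = P.rank w → f T x ≤ 8 * (E * a ^ 2) := by
    intro x hx hd hb hr
    obtain ⟨j, rfl⟩ := Nat.exists_eq_add_of_le' hj
    rw [hsq, envelope_next_block hθ.pos hd hb hx.1]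
    refine (hbound x hx).of_active j rfl ?_
    rw [← hb, ← hr] at hact
    push_cast at hact
    have hact' := hact.sub_right 1
    rwa [add_sub_cancel_right, sub_right_comm, add_sub_cancel_right] at hact'
  have hoffset : P.level w - P.block w * P.blockSize ≤ P.blockSize := by
    have hdiv := Nat.lt_div_mul_add (a := P.level w - 1) hP.one_le_blockSize
    rw [← block] at hdiv
    omega
  rw [mul_add_one, ← hT] at h1 ⊢
  calc f (T + 2 * (c * P.blockSize)) w
      ≤ f (T + 6 * (c * P.blockSize / 3)) w := h.antitone w (by omega) (by omega) h1
    _ ≤ 8 * (E * a ^ 2) + 16 * E * 2 ^ (P.level w - P.block w * P.blockSize) * γ :=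
        h.le_add_of_active hρ0 hρ1 (by positivity) (by positivity) h0 (by rwa [mul_add_one]) hact
          (fun x hx hd hb hs => by
            have hx2 := (hbound x hx).of_slow hs
            rw [envelope_congr hd hb] at hx2
            nlinarith)
          hprev (fun x hx hd hb => (hbound x hx).le.trans_eq (by rw [envelope_congr hd hb]))
          _ (by omega) w hw rfl rfl rfl
    _ ≤ 8 * (E * a ^ 2) + 16 * E * 2 ^ P.blockSize * γ := by
        have : 0 ≤ γ := pow_nonneg (by linarith) _
        gcongr
        exact one_le_two
    _ = 8 * E * (a ^ 2 + 2 * (2 ^ P.blockSize * γ)) := by ring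
    _ ≤ 8 * E * (a ^ 2 + a * (1 - a)) := by
        have htail := hθ.tail_le
        gcongr 8 * E * (_ + ?_)
    _ = 8 * P.envelope c lo t₀ q θ (T + 2 * (c * P.blockSize)) w := by
        rw [envelope_add h0]
        ring

theorem exists_recent_active (hP : P.IsAdmissible) (hc : 1 ≤ c) {t : ℕ}
    (ht : 72 * (c * P.blockSize) * P.decayLength ≤ t) (w : V) :
    ∃ j : ℕ, 2 * (c * P.blockSize) * (j + 1) ≤ t ∧
      t ≤ 2 * (c * P.blockSize) * (j + 1) + 72 * (c * P.blockSize) * P.decayLength ∧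
      (P.block w : ℤ) - 6 * P.rank w ≡ (j : ℤ) [ZMOD 6 * P.maxRank] := by
  have hcS : 1 ≤ c * P.blockSize := Nat.mul_pos hc hP.one_le_blockSize
  have hperiod : 2 * (c * P.blockSize) * (6 * P.maxRank) ≤
      72 * (c * P.blockSize) * P.decayLength :=
    calc 2 * (c * P.blockSize) * (6 * P.maxRank)
        ≤ 2 * (c * P.blockSize) * (6 * (2 * P.decayLength)) := by
          have := hP.maxRank_le
          gcongr
      _ = 24 * (c * P.blockSize * P.decayLength) := by ring
      _ ≤ 72 * (c * P.blockSize * P.decayLength) := Nat.mul_le_mul_right _ (by norm_num)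
      _ = _ := by ring
  obtain ⟨j, hle, hge, hj⟩ := exists_modEq_block (N := 2 * (c * P.blockSize)) (R := 6 * P.maxRank)
    (by omega) (by have := hP.one_le_maxRank; omega) (hperiod.trans ht)
    ((P.block w : ℤ) - 6 * P.rank w)
  exact ⟨j, hle, by omega, by exact_mod_cast hj⟩

theorem le_envelope_of_recent (h : P.SpreadRules c f lo hi t₀ t₁ ρ q) (hq0 : 0 < q) (hq1 : q ≤ 1)
    (hθ : P.IsDecayRate c ρ q θ) {e t : ℕ} (h0 : t₀ ≤ e) (hle : e ≤ t)
    (hlt : t ≤ e + 72 * (c * P.blockSize) * P.decayLength) (h1 : t ≤ t₁) {w : V}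
    (hrecent : f e w ≤ 8 * P.envelope c lo t₀ q θ e w) :
    f t w ≤ 16 * P.envelope c lo t₀ q θ t w := by
  have hE0 := (envelope_pos (P := P) (c := c) (lo := lo) (t₀ := t₀) hθ.pos hq0 e w).le
  have hhalf := hθ.half_le_pow hq1 (n := t - e) (by omega)
  calc f t w ≤ f e w := h.antitone w h0 hle h1
    _ ≤ 8 * P.envelope c lo t₀ q θ e w := hrecent
    _ = 16 * (P.envelope c lo t₀ q θ e w * (1 / 2)) := by ring
    _ ≤ 16 * (P.envelope c lo t₀ q θ e w * θ ^ (t - e)) := by gcongr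
    _ = 16 * P.envelope c lo t₀ q θ t w := by rw [← envelope_add h0, Nat.add_sub_cancel' hle]

theorem envelopeBound (h : P.SpreadRules c f lo hi t₀ t₁ ρ q) (hP : P.IsAdmissible) (hc : 1 ≤ c)
    (hρ0 : 0 ≤ ρ) (hρ1 : ρ ≤ 1) (hq0 : 0 < q) (hq1 : q ≤ 1) (hθ : P.IsDecayRate c ρ q θ) {t : ℕ}
    (h0 : t₀ ≤ t) (h1 : t ≤ t₁) {w : V} (hw : P.InZone lo hi w) :
    P.EnvelopeBound c lo t₀ t₁ q θ f t w := by
  induction t using Nat.strong_induction_on generalizing w with | _ t ih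
  set M := 72 * (c * P.blockSize) * P.decayLength with hM
  set N := 2 * (c * P.blockSize)
  rcases le_or_gt (t - t₀) M with hearly | hlate
  · exact hθ.envelopeBound_of_early hq0 hq1 hearly (h.le_one t w h0 h1)
  have hNM : N ≤ M := (Nat.mul_le_mul_right _ (by norm_num)).trans
    (Nat.le_mul_of_pos_right _ hP.one_le_decayLength)
  have hactive : ∀ j : ℕ, t = N * (j + 1) →
      (P.block w : ℤ) - 6 * P.rank w ≡ (j : ℤ) [ZMOD 6 * P.maxRank] →
      f t w ≤ 8 * P.envelope c lo t₀ q θ t w := by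
    intro j ht hact
    have hsucc := mul_add_one N j
    have hj : 1 ≤ j := Nat.one_le_iff_ne_zero.2 (by rintro rfl; omega)
    have hpos : 0 < N := Nat.mul_pos two_pos (Nat.mul_pos hc hP.one_le_blockSize)
    have hstart : t₀ ≤ N * j := by omega
    have hend : N * j < t := by omega
    rw [ht] at h1 ⊢
    exact h.active_le_envelope hP hρ0 hρ1 hq0 hq1 hθ hj hstart h1
      (fun x hx => ih _ hend hstart (hend.le.trans (ht.trans_le h1)) hx) hw hact
  refine ⟨fun hs => ?_, hactive, ?_⟩
  · have hadd : t - M + M = t := by omega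
    have hpos : 0 < M := Nat.mul_pos (Nat.mul_pos (by norm_num)
      (Nat.mul_pos hc hP.one_le_blockSize)) hP.one_le_decayLength
    have hstart : t₀ ≤ t - M := by omega
    have hlt : t - M < t := by omega
    have hphase := h.slow_le_envelope hP hc hq0 hq1 hθ hstart (hadd.trans_le h1) hw hs
      ((ih _ hlt hstart (hlt.le.trans h1) hw).of_slow hs)
      fun u hu => (ih _ hlt hstart (hlt.le.trans h1) hu).le
    rwa [← hM, hadd] at hphase
  · have hMt : M ≤ t := by omega
    obtain ⟨j, hle, hge, hj⟩ := exists_recent_active hP hc hMt w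
    set e := N * (j + 1) with he
    have hrecent : f e w ≤ 8 * P.envelope c lo t₀ q θ e w := by
      rcases hle.eq_or_lt with heq | hlt
      · rw [heq]
        exact hactive j heq.symm hj
      · exact (ih e hlt (by omega) (by omega) hw).of_active j he hj
    exact h.le_envelope_of_recent hq0 hq1 hθ (by omega) hle hge h1 hrecent

end SpreadRules
end SpreadLayout

namespace SpreadLayout

universe u

variable {V : Type u} {P : SpreadLayout V} {c lo hi t₀ t₁ : ℕ} {ρ q θ : ℝ} {f : ℕ → V → ℝ}

theorem div_le_one_sub_of_pow_eq {a : ℝ} (ha0 : 0 ≤ a) {n : ℕ} (hn : 1 ≤ n)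
    (ha : a ^ n = 1 - q / 2) : q / (2 * n) ≤ 1 - a := by
  have hbernoulli := one_add_mul_le_pow (by linarith : -2 ≤ a - 1) n
  rw [add_sub_cancel, ha] at hbernoulli
  have : (0 : ℝ) < n := by exact_mod_cast hn
  rw [div_le_iff₀ (by positivity)]
  linarith

theorem two_pow_mul_tail_le (hP : P.IsAdmissible) {γ : ℝ} (hγ0 : 0 ≤ γ) (hγ1 : γ ≤ 1)
    (hq1 : q ≤ 1) {n : ℕ} (hγ : γ ^ n < q / 1152) (hc : 3 * n ≤ c) :
    2 * (2 ^ P.blockSize * γ ^ (c * P.blockSize / 3)) ≤ q / (144 * P.decayLength) := by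
  have hL : (0 : ℝ) < P.decayLength := by exact_mod_cast hP.one_le_decayLength
  have hLS : (P.decayLength : ℝ) ≤ 2 ^ P.blockSize := by exact_mod_cast hP.decayLength_le
  have hexp : n * P.blockSize ≤ c * P.blockSize / 3 := by
    rw [Nat.le_div_iff_mul_le (by norm_num)]
    calc n * P.blockSize * 3 = 3 * n * P.blockSize := by ring
      _ ≤ c * P.blockSize := Nat.mul_le_mul_right _ hc
  have hbound : P.decayLength * (2 ^ P.blockSize * γ ^ (c * P.blockSize / 3)) ≤ q / 288 :=
    calc P.decayLength * (2 ^ P.blockSize * γ ^ (c * P.blockSize / 3))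
        ≤ 2 ^ P.blockSize * (2 ^ P.blockSize * γ ^ (n * P.blockSize)) := by
          gcongr ?_ * (_ * ?_)
          exact pow_le_pow_of_le_one hγ0 hγ1 hexp
      _ = (4 * γ ^ n) ^ P.blockSize := by
          rw [pow_mul, ← mul_assoc, ← mul_pow, ← mul_pow]
          norm_num
      _ ≤ 4 * γ ^ n :=
          pow_le_of_le_one (by positivity) (by linarith)
            (Nat.one_le_iff_ne_zero.1 hP.one_le_blockSize)
      _ ≤ q / 288 := by linarith
  rw [le_div_iff₀ (by positivity)]
  linarith

theorem exists_isDecayRate (hρ0 : 0 < ρ) (hρ1 : ρ ≤ 1) (hq0 : 0 < q) (hq1 : q ≤ 1) :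
    ∃ c₀ : ℕ, 1 ≤ c₀ ∧ ∀ c, c₀ ≤ c → ∀ (V : Type u) (P : SpreadLayout V), P.IsAdmissible →
      ∃ θ, P.IsDecayRate c ρ q θ := by
  obtain ⟨n, hn⟩ := exists_pow_lt_of_lt_one (by positivity : 0 < q / 1152)
    (by linarith : 1 - ρ / 2 < 1)
  refine ⟨3 * n + 1, by omega, fun c hc V P hP => ?_⟩
  have hcS : 0 < c * P.blockSize := Nat.mul_pos (by omega) hP.one_le_blockSize
  have hL : 0 < P.decayLength := hP.one_le_decayLength
  have : (0 : ℝ) < P.decayLength := by exact_mod_cast hL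
  set N := 72 * (c * P.blockSize) * P.decayLength with hN
  have hroot : 0 < 1 - q / 2 := by linarith
  set θ : ℝ := (1 - q / 2) ^ ((N : ℝ)⁻¹)
  have hθ0 : 0 < θ := Real.rpow_pos_of_pos hroot _
  have hθ1 : θ ≤ 1 := Real.rpow_le_one hroot.le (by linarith) (by positivity)
  have hθN : θ ^ N = 1 - q / 2 := Real.rpow_inv_natCast_pow hroot.le (by positivity)
  refine ⟨θ, hθ0, hθ1, hθN, ?_⟩
  set a := θ ^ (2 * (c * P.blockSize)) with ha
  have ha0 : 0 < a := pow_pos hθ0 _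
  have haL : a ^ (36 * P.decayLength) = 1 - q / 2 := by
    rw [ha, ← pow_mul, ← hθN, hN]
    ring_nf
  have hhalf : 1 / 2 ≤ a :=
    calc (1 : ℝ) / 2 ≤ a ^ (36 * P.decayLength) := by linarith
      _ ≤ a := pow_le_of_le_one ha0.le (pow_le_one₀ hθ0.le hθ1) (by positivity)
  have hgap := div_le_one_sub_of_pow_eq ha0.le (by omega) haL
  calc 2 * (2 ^ P.blockSize * (1 - ρ / 2) ^ (c * P.blockSize / 3))
      ≤ q / (144 * P.decayLength) :=
        two_pow_mul_tail_le hP (by linarith) (by linarith) hq1 hn (by omega)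
    _ = 1 / 2 * (q / (2 * (36 * P.decayLength : ℕ))) := by
        push_cast
        field_simp
        norm_num
    _ ≤ a * (1 - a) := mul_le_mul hhalf hgap (by positivity) ha0.le

theorem block_sub_mul_le (hS : 1 ≤ P.blockSize) {Δ : ℕ} {w : V} (hw : P.level w ≤ lo + Δ) :
    (P.block w - lo / P.blockSize) * P.blockSize ≤ Δ + P.blockSize := by
  have hblock : P.block w * P.blockSize ≤ lo + Δ := (Nat.div_mul_le_self _ _).trans (by omega)
  have hlo := Nat.lt_div_mul_add (a := lo) hS
  rw [Nat.sub_mul]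
  omega

/-- The run time `8 c (Δ + h L S)` makes up for the delay of the envelope, and the rest lets each
of `h` periods contribute the factor `(1 - q / 2) ^ n`. -/
theorem envelope_le (hP : P.IsAdmissible) (hq0 : 0 < q) (hq1 : q ≤ 1)
    (hθ : P.IsDecayRate c ρ q θ) {Δ h n : ℕ} (hLh : P.decayLength ≤ h)
    (ht : t₀ + (8 * c + 72 * c * n) * (Δ + h * P.decayLength * P.blockSize) ≤ t₁) {w : V}
    (hw : P.level w ≤ lo + Δ) :
    P.envelope c lo t₀ q θ t₁ w ≤ ((32 / q) ^ 3 * (1 - q / 2) ^ n) ^ h := by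
  have hL := hP.one_le_decayLength
  set m := P.block w - lo / P.blockSize with hm
  have htime : 4 * (c * P.blockSize) * m + 72 * (c * P.blockSize) * P.decayLength * (n * h) ≤
      t₁ - t₀ := by
    have hS : P.blockSize ≤ h * P.decayLength * P.blockSize :=
      Nat.le_mul_of_pos_left _ (Nat.mul_pos (by omega) hL)
    calc 4 * (c * P.blockSize) * m + 72 * (c * P.blockSize) * P.decayLength * (n * h)
        = 4 * c * (m * P.blockSize) + 72 * c * n * (h * P.decayLength * P.blockSize) := by ring
      _ ≤ 4 * c * (2 * (Δ + h * P.decayLength * P.blockSize)) +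
            72 * c * n * (Δ + h * P.decayLength * P.blockSize) := by
          have hblocks : m * P.blockSize ≤ 2 * (Δ + h * P.decayLength * P.blockSize) :=
            (block_sub_mul_le hP.one_le_blockSize hw).trans (by omega)
          exact Nat.add_le_add (Nat.mul_le_mul_left _ hblocks)
            (Nat.mul_le_mul_left _ (Nat.le_add_left _ _))
      _ = (8 * c + 72 * c * n) * (Δ + h * P.decayLength * P.blockSize) := by ring
      _ ≤ t₁ - t₀ := by omega
  have hhop : (1 : ℝ) ≤ 32 / q := by
    rw [le_div_iff₀ hq0]
    linarith
  have hvd : P.virtualDist w ≤ 3 * h := by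
    have := hP.virtualDist_le w
    omega
  have hθ0 := hθ.pos
  calc P.envelope c lo t₀ q θ t₁ w
      ≤ (32 / q) ^ (3 * h) * θ⁻¹ ^ (4 * (c * P.blockSize) * m) *
          θ ^ (4 * (c * P.blockSize) * m + 72 * (c * P.blockSize) * P.decayLength * (n * h)) := by
        rw [envelope, ← hm]
        gcongr ?_ * _ * ?_
        · exact pow_le_pow_right₀ hhop hvd
        · exact pow_le_pow_of_le_one hθ0.le hθ.le_one htime
    _ = ((32 / q) ^ 3 * (1 - q / 2) ^ n) ^ h := by
        rw [pow_add, pow_mul _ _ (n * h), hθ.pow_eq, inv_pow, mul_assoc,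
          inv_mul_cancel_left₀ (pow_pos hθ0 _).ne', pow_mul, pow_mul, mul_pow]

theorem exists_spread_constants {r : ℝ} (hr : 0 < r) (hρ0 : 0 < ρ) (hρ1 : ρ ≤ 1) (hq0 : 0 < q)
    (hq1 : q ≤ 1) :
    ∃ c₀ : ℕ, ∀ c : ℕ, c₀ ≤ c → ∃ C : ℕ, 1 ≤ C ∧ ∀ (V : Type u) (P : SpreadLayout V)
      (f : ℕ → V → ℝ) (lo Δ hi t₀ t₁ h : ℕ), P.IsAdmissible → P.SpreadRules c f lo hi t₀ t₁ ρ q →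
      P.decayLength ≤ h → t₀ + C * (Δ + h * P.decayLength * P.blockSize) ≤ t₁ →
      ∀ w, P.level w ≤ lo + Δ → P.level w + P.virtualDist w ≤ hi → f t₁ w ≤ r ^ h := by
  obtain ⟨c₀, hc₀, hrate⟩ := exists_isDecayRate hρ0 hρ1 hq0 hq1
  have hK : 0 < 16 * (32 / q) ^ 3 := by positivity
  obtain ⟨n, hn⟩ := exists_pow_lt_of_lt_one (div_pos hr hK)
    (by linarith : 1 - q / 2 < 1)
  rw [lt_div_iff₀ hK] at hn
  refine ⟨c₀, fun c hc => ⟨8 * c + 72 * c * n, by omega, ?_⟩⟩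
  intro V P f lo Δ hi t₀ t₁ h hP hrules hLh ht w hw hwhi
  have h01 : t₀ ≤ t₁ := (Nat.le_add_right _ _).trans ht
  rcases le_or_gt (P.level w) lo with hlo | hlo
  · exact (hrules.low t₁ w h01 le_rfl hlo).trans (by positivity)
  obtain ⟨θ, hθ⟩ := hrate c hc V P hP
  have hbound := hrules.envelopeBound hP (hc₀.trans hc) hρ0.le hρ1 hq0 hq1 hθ h01 le_rfl ⟨hlo, hwhi⟩
  have hh : h ≠ 0 := by
    have := hP.one_le_decayLength
    omega
  have hroot : 0 ≤ 1 - q / 2 := by linarith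
  calc f t₁ w ≤ 16 * P.envelope c lo t₀ q θ t₁ w := hbound.le
    _ ≤ 16 ^ h * ((32 / q) ^ 3 * (1 - q / 2) ^ n) ^ h :=
        mul_le_mul (le_self_pow₀ (by norm_num) hh) (envelope_le hP hq0 hq1 hθ hLh ht hw)
          (envelope_pos hθ.pos hq0 _ _).le (by positivity)
    _ = ((1 - q / 2) ^ n * (16 * (32 / q) ^ 3)) ^ h := by
        rw [← mul_pow]
        ring_nf
    _ ≤ r ^ h := by gcongr

end SpreadLayout

/-! ### Reception histories -/

section Histories

variable {V Packet Packet' : Type} {G : SimpleGraph V} {model : FaultModel}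

/-- The node whose fault spoils a transmission from `u` to `v`. -/
def culprit (model : FaultModel) (u v : V) : V :=
  match model with
  | FaultModel.sender => u
  | FaultModel.receiver => v

theorem exists_isSoleBroadcaster_iff {x : V → Option Packet} {v : V} :
    (∃ u, IsSoleBroadcaster G (fun u => x u ≠ none) u v) ↔
      x v = none ∧ ∃! u, G.Adj u v ∧ x u ≠ none := by
  constructor
  · rintro ⟨u, huv, hu, hv, hothers⟩
    exact ⟨not_ne_iff.1 hv, u, ⟨huv, hu⟩, fun u' hu' =>
      by_contra fun hne => hothers u' hu'.1 hne hu'.2⟩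
  · rintro ⟨hv, u, ⟨huv, hu⟩, huniq⟩
    exact ⟨u, huv, hu, not_ne_iff.2 hv, fun u' hu'v hne hu' => hne (huniq u' ⟨hu'v, hu'⟩)⟩

theorem receive_eq_ite {x : V → Option Packet} {fault : V → Bool} {u v : V}
    (h : IsSoleBroadcaster G (fun u => x u ≠ none) u v) :
    receive G model x fault v = if fault (culprit model u v) = true then none else x u := by
  have hex := exists_isSoleBroadcaster_iff.1 ⟨u, h⟩
  have hchoose : hex.2.choose = u := hex.2.unique hex.2.choose_spec.1 ⟨h.adj, h.broadcasts⟩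
  unfold receive
  rw [dif_pos hex]
  cases model <;> simp only [hchoose, culprit] <;> congr

theorem receive_eq_none {x : V → Option Packet} {fault : V → Bool} {v : V}
    (h : ¬ ∃ u, IsSoleBroadcaster G (fun u => x u ≠ none) u v) :
    receive G model x fault v = none :=
  dif_neg (mt exists_isSoleBroadcaster_iff.2 h)

theorem exists_of_receive_eq_some {x : V → Option Packet} {fault : V → Bool} {v : V} {y : Packet}
    (h : receive G model x fault v = some y) : ∃ u, x u = some y := by
  by_cases hex : ∃ u, IsSoleBroadcaster G (fun u => x u ≠ none) u v
  · obtain ⟨u, hu⟩ := hex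
    rw [receive_eq_ite hu] at h
    exact ⟨u, (ite_eq_iff.1 h).elim (fun h => nomatch h.2) And.right⟩
  · rw [receive_eq_none hex] at h
    exact nomatch h

theorem receive_map (g : Packet → Packet') (x : V → Option Packet) (fault : V → Bool) (v : V) :
    receive G model (fun u => (x u).map g) fault v = (receive G model x fault v).map g := by
  have hmap : (fun u => (x u).map g ≠ none) = fun u => x u ≠ none := by
    simp only [ne_eq, Option.map_eq_none_iff]
  by_cases hex : ∃ u, IsSoleBroadcaster G (fun u => x u ≠ none) u v
  · obtain ⟨u, hu⟩ := hex
    rw [receive_eq_ite hu, receive_eq_ite (hmap ▸ hu)]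
    split_ifs <;> rfl
  · rw [receive_eq_none hex, receive_eq_none (hmap ▸ hex)]
    rfl

variable {s : V} {T : ℕ} {Msgs Msgs' : Type}

theorem history_succ (S : CodingSchedule V Msgs Packet T) (m : Msgs) (fault : Fin T → V → Bool)
    {r : ℕ} (hr : r < T) (v : V) :
    history G s model S m fault (r + 1) v = receive G model
      (fun u => S.act ⟨r, hr⟩ u (initialKnowledge s m u) (history G s model S m fault r u))
      (fault ⟨r, hr⟩) v :: history G s model S m fault r v := by
  rw [history, dif_pos hr]

theorem history_subset_succ (S : CodingSchedule V Msgs Packet T) (m : Msgs)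
    (fault : Fin T → V → Bool) (r : ℕ) (v : V) :
    history G s model S m fault r v ⊆ history G s model S m fault (r + 1) v := by
  rw [history]
  split_ifs
  · exact List.subset_cons_self _ _
  · exact List.Subset.refl _

theorem length_history (S : CodingSchedule V Msgs Packet T) (m : Msgs) (fault : Fin T → V → Bool)
    (r : ℕ) (v : V) : (history G s model S m fault r v).length = min r T := by
  induction r with
  | zero => simp [history]
  | succ r ih =>
    rw [history]
    split_ifs with hr
    · rw [List.length_cons]
      omega
    · omega

theorem history_congr {S S' : CodingSchedule V Msgs Packet T} (m : Msgs)
    {fault fault' : Fin T → V → Bool} (r : ℕ)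
    (hact : ∀ i : Fin T, (i : ℕ) < r → S.act i = S'.act i)
    (hfault : ∀ i : Fin T, (i : ℕ) < r → fault i = fault' i) :
    history G s model S m fault r = history G s model S' m fault' r := by
  induction r with
  | zero => rfl
  | succ r ih =>
    have ih := ih (fun i hi => hact i (by omega)) fun i hi => hfault i (by omega)
    funext v
    by_cases hr : r < T
    · rw [history_succ _ _ _ hr, history_succ _ _ _ hr, ih, hact ⟨r, hr⟩ (Nat.lt_succ_self r),
        hfault ⟨r, hr⟩ (Nat.lt_succ_self r)]
    · rw [history, history, dif_neg hr, dif_neg hr, ih]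

theorem forall_mem_history {S : CodingSchedule V Msgs Packet T} (Valid : Packet → Prop) {m : Msgs}
    (hvalid : ∀ i u hist, (∀ y, some y ∈ hist → Valid y) →
      ∀ y, S.act i u (initialKnowledge s m u) hist = some y → Valid y)
    (fault : Fin T → V → Bool) (r : ℕ) (v : V) :
    ∀ y, some y ∈ history G s model S m fault r v → Valid y := by
  induction r generalizing v with
  | zero => simp [history]
  | succ r ih =>
    by_cases hr : r < T
    · intro y hy
      rw [history_succ _ _ _ hr] at hy
      rcases List.mem_cons.1 hy with hy | hy
      · obtain ⟨u, hu⟩ := exists_of_receive_eq_some hy.symm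
        exact hvalid _ u _ (ih u) y hu
      · exact ih v y hy
    · rw [history, dif_neg hr]
      exact ih v

theorem history_map {S : CodingSchedule V Msgs Packet T} {S' : CodingSchedule V Msgs' Packet' T}
    (g : Packet → Packet') (Valid : Packet → Prop) {m : Msgs} {m' : Msgs'}
    (hvalid : ∀ i u hist, (∀ y, some y ∈ hist → Valid y) →
      ∀ y, S.act i u (initialKnowledge s m u) hist = some y → Valid y)
    (hact : ∀ i u hist, (∀ y, some y ∈ hist → Valid y) →
      S'.act i u (initialKnowledge s m' u) (hist.map (Option.map g)) =
        (S.act i u (initialKnowledge s m u) hist).map g)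
    (fault : Fin T → V → Bool) (r : ℕ) (v : V) :
    history G s model S' m' fault r v =
      (history G s model S m fault r v).map (Option.map g) := by
  induction r generalizing v with
  | zero => simp [history]
  | succ r ih =>
    by_cases hr : r < T
    · simp only [history_succ _ _ _ hr, List.map_cons, ← receive_map, ih]
      congr 2
      funext u
      exact hact _ u _ (forall_mem_history Valid hvalid fault r u)
    · rw [history, history, dif_neg hr, dif_neg hr]
      exact ih v

end Histories

/-! ### Random linear network coding in batches -/

section Packets

variable {F : Type} [Field F] {k ℓ : ℕ}

theorem combine_eq_sum {N : ℕ} (α : Fin N → F) (L : List (RLNCPacket F k ℓ)) :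
    combine α L = ∑ j, α j • L.getD j 0 := by
  unfold combine
  induction N generalizing L with
  | zero => simp
  | succ N ih =>
    cases L with
    | nil => simp
    | cons y L =>
      rw [List.ofFn_succ, List.zipWith_cons_cons, List.sum_cons, ih, Fin.sum_univ_succ]
      simp

theorem combine_map {ℓ' N : ℕ} (g : RLNCPacket F k ℓ →ₗ[F] RLNCPacket F k ℓ') (α : Fin N → F)
    (L : List (RLNCPacket F k ℓ)) : combine α (L.map g) = g (combine α L) := by
  simp only [combine_eq_sum, map_sum, map_smul, ← map_zero g, List.getD_map]

/-- The packet with the coefficients of `y` and the combination of the messages `m` that they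
describe. -/
noncomputable def liftPacket (m : FieldMessages F k ℓ) :
    RLNCPacket F k 0 →ₗ[F] RLNCPacket F k ℓ :=
  (LinearMap.id.prod (Fintype.linearCombination F m)).comp (LinearMap.fst F (Fin k → F) (Fin 0 → F))

theorem liftPacket_apply (m : FieldMessages F k ℓ) (y : RLNCPacket F k 0) :
    liftPacket m y = (y.1, ∑ i, y.1 i • m i) :=
  rfl

theorem knownPackets_map_liftPacket {V : Type} (s u : V) (m : FieldMessages F k ℓ)
    (hist : List (Option (RLNCPacket F k 0))) :
    knownPackets (initialKnowledge s m u) (hist.map (Option.map (liftPacket m))) =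
      (knownPackets (initialKnowledge s 0 u) hist).map (liftPacket m) := by
  unfold knownPackets initialKnowledge
  rw [List.map_append, List.reduceOption_map]
  congr 1
  split_ifs
  · simp [List.map_ofFn, liftPacket_apply, Function.comp_def, Pi.single_apply, ite_smul]
  · rfl

theorem mem_knownPackets_of_mem {init : Option (FieldMessages F k ℓ)}
    {hist : List (Option (RLNCPacket F k ℓ))} {y : RLNCPacket F k ℓ} (h : some y ∈ hist) :
    y ∈ knownPackets init hist :=
  List.mem_append_right _ (List.reduceOption_mem_iff.2 h)

theorem knownPackets_subset {init : Option (FieldMessages F k ℓ)}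
    {hist hist' : List (Option (RLNCPacket F k ℓ))} (h : hist ⊆ hist') :
    knownPackets init hist ⊆ knownPackets init hist' := by
  intro y hy
  rcases List.mem_append.1 hy with hy | hy
  · exact List.mem_append_left _ hy
  · exact mem_knownPackets_of_mem (h (List.reduceOption_mem_iff.1 hy))

theorem length_knownPackets_le (init : Option (FieldMessages F k ℓ))
    (hist : List (Option (RLNCPacket F k ℓ))) :
    (knownPackets init hist).length ≤ k + hist.length := by
  unfold knownPackets
  rw [List.length_append]
  refine add_le_add ?_ (List.reduceOption_length_le hist)
  cases init <;> simp

theorem rlncDecode_map_liftPacket {L : List (RLNCPacket F k 0)} (m : FieldMessages F k ℓ)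
    (h : ∀ μ : Fin k → F, μ ≠ 0 → ∃ y ∈ L, y.1 ⬝ᵥ μ ≠ 0) :
    rlncDecode (L.map (liftPacket m)) = some m := by
  have hsol : ∀ y ∈ L.map (liftPacket m), ∑ i, y.1 i • m i = y.2 := by
    intro y hy
    obtain ⟨x, -, rfl⟩ := List.mem_map.1 hy
    rfl
  have huniq : ∃! m' : FieldMessages F k ℓ,
      ∀ y ∈ L.map (liftPacket m), ∑ i, y.1 i • m' i = y.2 := by
    refine ⟨m, hsol, fun m' hm' => ?_⟩
    by_contra! hne
    obtain ⟨i, hi⟩ := Function.ne_iff.1 hne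
    obtain ⟨j, hj⟩ := Function.ne_iff.1 hi
    obtain ⟨y, hy, hyμ⟩ := h (fun i => m' i j - m i j)
      (Function.ne_iff.2 ⟨i, sub_ne_zero.2 hj⟩)
    have hcoord := congrFun (hm' _ (List.mem_map_of_mem hy)) j
    simp only [liftPacket_apply, Finset.sum_apply, Pi.smul_apply, smul_eq_mul] at hcoord
    refine hyμ ?_
    simp only [dotProduct, mul_sub, Finset.sum_sub_distrib, hcoord, sub_self]
  unfold rlncDecode
  rw [dif_pos huniq]
  exact congrArg some (huniq.unique huniq.choose_spec.1 hsol)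

/-- The coefficient vector `x` only involves messages of the batch `β`, where `bat i` is the batch
of message `i`. -/
def InBatch (bat : Fin k → ℕ) (β : ℕ) (x : Fin k → F) : Prop := ∀ i, bat i ≠ β → x i = 0

variable {bat : Fin k → ℕ} {β : ℕ} {μ : Fin k → F}

theorem inBatch_single (i : Fin k) (a : F) :
    InBatch bat (bat i) (Pi.single i a : Fin k → F) :=
  fun _ hj => Pi.single_eq_of_ne (fun h => hj (congrArg bat h)) _

theorem InBatch.exists_eq (h : InBatch bat β μ) (hμ : μ ≠ 0) : ∃ i, μ i ≠ 0 ∧ bat i = β := by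
  obtain ⟨i, hi⟩ := Function.ne_iff.1 hμ
  exact ⟨i, hi, by_contra fun hne => hi (h i hne)⟩

theorem inBatch_combine {N : ℕ} (α : Fin N → F) {L : List (RLNCPacket F k ℓ)}
    (h : ∀ y ∈ L, InBatch bat β y.1) : InBatch bat β (combine α L).1 := by
  intro i hi
  rw [combine_eq_sum, Prod.fst_sum, Finset.sum_apply]
  refine Finset.sum_eq_zero fun j _ => ?_
  by_cases hj : (j : ℕ) < L.length
  · rw [List.getD_eq_getElem _ _ hj]
    exact mul_eq_zero_of_right _ (h _ (List.getElem_mem hj) i hi)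
  · rw [List.getD_eq_default _ _ (not_lt.1 hj)]
    exact mul_zero _

/-- Some packet of the list belongs to the batch `β` and is not orthogonal to `μ`. A node decodes
the batch once it is informed about every nonzero `μ`. -/
def Informed (bat : Fin k → ℕ) (β : ℕ) (μ : Fin k → F) (L : List (RLNCPacket F k ℓ)) : Prop :=
  ∃ y ∈ L, InBatch bat β y.1 ∧ y.1 ⬝ᵥ μ ≠ 0

theorem Informed.mono {L L' : List (RLNCPacket F k ℓ)} (h : Informed bat β μ L) (hL : L ⊆ L') :
    Informed bat β μ L' :=
  let ⟨y, hy, h⟩ := h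
  ⟨y, hL hy, h⟩

open Classical in
/-- The packets of the batch `β`. -/
noncomputable def batchPackets (bat : Fin k → ℕ) (β : ℕ) (L : List (RLNCPacket F k ℓ)) :
    List (RLNCPacket F k ℓ) :=
  L.filter fun y => InBatch bat β y.1

theorem mem_batchPackets {L : List (RLNCPacket F k ℓ)} {y : RLNCPacket F k ℓ} :
    y ∈ batchPackets bat β L ↔ y ∈ L ∧ InBatch bat β y.1 := by
  simp [batchPackets]

theorem batchPackets_map_liftPacket (m : FieldMessages F k ℓ) (L : List (RLNCPacket F k 0)) :
    batchPackets bat β (L.map (liftPacket m)) = (batchPackets bat β L).map (liftPacket m) := by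
  rw [batchPackets, List.filter_map]
  rfl

/-- The inner products with `μ` of the packets of the batch `β`, padded with zeros. -/
noncomputable def testValues (bat : Fin k → ℕ) (β : ℕ) (μ : Fin k → F)
    (L : List (RLNCPacket F k ℓ)) (N : ℕ) (j : Fin N) : F :=
  ((batchPackets bat β L).getD j 0).1 ⬝ᵥ μ

theorem combine_batchPackets_dotProduct {N : ℕ} (α : Fin N → F) (L : List (RLNCPacket F k ℓ)) :
    (combine α (batchPackets bat β L)).1 ⬝ᵥ μ = α ⬝ᵥ testValues bat β μ L N := by
  rw [combine_eq_sum, Prod.fst_sum, sum_dotProduct]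
  simp only [Prod.smul_fst, smul_dotProduct, smul_eq_mul]
  rfl

theorem Informed.exists_testValues_ne_zero {L : List (RLNCPacket F k ℓ)} {N : ℕ}
    (h : Informed bat β μ L) (hN : L.length ≤ N) : ∃ j, testValues bat β μ L N j ≠ 0 := by
  obtain ⟨y, hy, hyb, hyμ⟩ := h
  obtain ⟨j, hj, hjy⟩ := List.getElem_of_mem (mem_batchPackets.2 ⟨hy, hyb⟩)
  refine ⟨⟨j, hj.trans_le ((List.length_filter_le _ _).trans hN)⟩, ?_⟩
  rwa [testValues, List.getD_eq_getElem _ _ hj, hjy]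

end Packets

/-- The random choices of the algorithm and the faults in `T` rounds. -/
abbrev Outcome (V F : Type) (k T : ℕ) : Type := Seed V F k T × (Fin T → V → Bool)

section BatchRLNC

variable {F : Type} [Field F] {k : ℕ} {V : Type} [Fintype V] {G : SimpleGraph V} {s : V}
  (𝒯 : RankedBFSTree G s) (model : FaultModel) (c : ℕ) {T : ℕ} (bat : Fin k → ℕ)
  (sel : ℕ → V → ℕ)

open Classical in
/-- Robust FASTBC with random linear network coding in batches: in round `t` the node `u` only
combines packets of the batch `sel t u`. -/
noncomputable def batchRLNC (ℓ : ℕ) (seed : Seed V F k T) :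
    CodingSchedule V (FieldMessages F k ℓ) (RLNCPacket F k ℓ) T where
  act t u init hist :=
    if Broadcasts 𝒯 c t u (seed t u).1 then
      some (combine (seed t u).2 (batchPackets bat (sel t u) (knownPackets init hist)))
    else none
  decode _ init hist := rlncDecode (knownPackets init hist)

theorem batchRLNC_const (ℓ : ℕ) (seed : Seed V F k T) :
    batchRLNC 𝒯 c (fun _ => 0) (fun _ _ => 0) ℓ seed = robustFastbcRLNC 𝒯 c ℓ seed := by
  simp [batchRLNC, robustFastbcRLNC, batchPackets, InBatch]

/-- The coefficient vectors that `u` knows after `t` rounds, given the random choices and the faults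
`ω`. They do not depend on the messages, so they are the packets known to `u` when the messages have
length `0`. -/
noncomputable def coeffsKnown (ω : Outcome V F k T) (t : ℕ) (u : V) :
    List (RLNCPacket F k 0) :=
  knownPackets (initialKnowledge s 0 u)
    (history G s model (batchRLNC 𝒯 c bat sel 0 ω.1) 0 ω.2 t u)

variable {ℓ : ℕ}

theorem history_batchRLNC (seed : Seed V F k T) (fault : Fin T → V → Bool)
    (m : FieldMessages F k ℓ) (t : ℕ) (u : V) :
    history G s model (batchRLNC 𝒯 c bat sel ℓ seed) m fault t u =
      (history G s model (batchRLNC 𝒯 c bat sel 0 seed) 0 fault t u).map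
        (Option.map (liftPacket m)) := by
  refine history_map (liftPacket m) (fun _ => True) (fun _ _ _ _ _ _ => trivial)
    (fun i u hist _ => ?_) fault t u
  unfold batchRLNC
  dsimp only
  split_ifs
  · rw [knownPackets_map_liftPacket, batchPackets_map_liftPacket, combine_map, Option.map_some]
  · rfl

theorem knownPackets_batchRLNC (ω : Outcome V F k T)
    (m : FieldMessages F k ℓ) (t : ℕ) (u : V) :
    knownPackets (initialKnowledge s m u)
      (history G s model (batchRLNC 𝒯 c bat sel ℓ ω.1) m ω.2 t u) =
      (coeffsKnown 𝒯 model c bat sel ω t u).map (liftPacket m) := by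
  rw [history_batchRLNC, knownPackets_map_liftPacket]
  rfl

/-- After the last round every node is informed about every nonzero vector of every batch. -/
def AllInformed (ω : Outcome V F k T) : Prop :=
  ∀ u β, ∀ μ : Fin k → F, μ ≠ 0 → InBatch bat β μ →
    Informed bat β μ (coeffsKnown 𝒯 model c bat sel ω T u)

variable {𝒯 model c bat sel}

theorem AllInformed.exists_dotProduct_ne_zero {ω : Outcome V F k T}
    (h : AllInformed 𝒯 model c bat sel ω) (u : V) {μ : Fin k → F} (hμ : μ ≠ 0) :
    ∃ y ∈ coeffsKnown 𝒯 model c bat sel ω T u, y.1 ⬝ᵥ μ ≠ 0 := by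
  classical
  obtain ⟨i, hi⟩ := Function.ne_iff.1 hμ
  obtain ⟨y, hy, hyb, hyμ⟩ := h u (bat i) (fun j => if bat j = bat i then μ j else 0)
    (Function.ne_iff.2 ⟨i, by simpa using hi⟩) fun j hj => if_neg hj
  refine ⟨y, hy, ?_⟩
  convert hyμ using 1
  refine Finset.sum_congr rfl fun j _ => ?_
  by_cases hj : bat j = bat i
  · simp only [if_pos hj]
  · rw [hyb j hj, zero_mul, zero_mul]

theorem AllInformed.succeeds {ω : Outcome V F k T}
    (h : AllInformed 𝒯 model c bat sel ω) (m : FieldMessages F k ℓ) :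
    Succeeds G s model (batchRLNC 𝒯 c bat sel ℓ ω.1) m ω.2 := by
  intro u
  change rlncDecode (knownPackets _ _) = _
  rw [knownPackets_batchRLNC]
  exact rlncDecode_map_liftPacket m fun _ => h.exists_dotProduct_ne_zero u

theorem informed_root (ω : Outcome V F k T) (t : ℕ) {β : ℕ} {μ : Fin k → F}
    (hμ : μ ≠ 0) (hβ : InBatch bat β μ) :
    Informed bat β μ (coeffsKnown 𝒯 model c bat sel ω t s) := by
  obtain ⟨i, hi, rfl⟩ := hβ.exists_eq hμ
  refine ⟨(Pi.single i 1, 0), List.mem_append_left _ ?_, inBatch_single i 1, ?_⟩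
  · simp only [initialKnowledge, if_true]
    exact List.mem_ofFn.2 ⟨i, rfl⟩
  · rwa [single_one_dotProduct]

theorem coeffsKnown_subset_succ (ω : Outcome V F k T) (t : ℕ) (u : V) :
    coeffsKnown 𝒯 model c bat sel ω t u ⊆ coeffsKnown 𝒯 model c bat sel ω (t + 1) u :=
  knownPackets_subset (history_subset_succ _ _ _ _ _)

theorem length_coeffsKnown_le (ω : Outcome V F k T) (t : ℕ) (u : V) :
    (coeffsKnown 𝒯 model c bat sel ω t u).length ≤ k + T :=
  (length_knownPackets_le _ _).trans
    (Nat.add_le_add_left ((length_history _ _ _ _ _).trans_le (min_le_right _ _)) _)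

theorem coeffsKnown_congr {ω ω' : Outcome V F k T} (t : ℕ)
    (hseed : ∀ i : Fin T, (i : ℕ) < t → ω.1 i = ω'.1 i)
    (hfault : ∀ i : Fin T, (i : ℕ) < t → ω.2 i = ω'.2 i) :
    coeffsKnown 𝒯 model c bat sel ω t = coeffsKnown 𝒯 model c bat sel ω' t := by
  funext u
  unfold coeffsKnown
  rw [history_congr 0 t (fun i hi => ?_) hfault]
  unfold batchRLNC
  dsimp only
  rw [hseed i hi]

theorem informed_succ {ω : Outcome V F k T} {t : ℕ} (ht : t < T) {u w : V}
    {μ : Fin k → F}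
    (hsole : IsSoleBroadcaster G (fun x => Broadcasts 𝒯 c t x (ω.1 ⟨t, ht⟩ x).1) u w)
    (hfault : ω.2 ⟨t, ht⟩ (culprit model u w) = false)
    (hα : (ω.1 ⟨t, ht⟩ u).2 ⬝ᵥ
      testValues bat (sel t u) μ (coeffsKnown 𝒯 model c bat sel ω t u) (k + T) ≠ 0) :
    Informed bat (sel t u) μ (coeffsKnown 𝒯 model c bat sel ω (t + 1) w) := by
  refine ⟨combine (ω.1 ⟨t, ht⟩ u).2 (batchPackets bat (sel t u)
    (coeffsKnown 𝒯 model c bat sel ω t u)), mem_knownPackets_of_mem ?_,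
    inBatch_combine _ fun y hy => (mem_batchPackets.1 hy).2, ?_⟩
  · have hact : (fun x => (batchRLNC 𝒯 c bat sel 0 ω.1).act ⟨t, ht⟩ x (initialKnowledge s 0 x)
        (history G s model (batchRLNC 𝒯 c bat sel 0 ω.1) 0 ω.2 t x) ≠ none) =
        fun x => Broadcasts 𝒯 c t x (ω.1 ⟨t, ht⟩ x).1 := by
      simp [batchRLNC]
    rw [history_succ _ _ _ ht, receive_eq_ite (hact ▸ hsole), hfault,
      if_neg Bool.false_ne_true]
    exact List.mem_cons.2 (Or.inl (if_pos hsole.broadcasts).symm)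
  · rwa [combine_batchPackets_dotProduct]

end BatchRLNC

/-! ### Resampling one coordinate -/

section Resampling

variable {ι : Type*} [Fintype ι]

theorem measure_pi_eq_lintegral_update [DecidableEq ι] {X : ι → Type*}
    [∀ i, MeasurableSpace (X i)] (μ : ∀ i, Measure (X i)) [∀ i, IsProbabilityMeasure (μ i)]
    {E : Set (∀ i, X i)} (hE : MeasurableSet E) (i : ι) :
    Measure.pi μ E = ∫⁻ x, μ i {a | Function.update x i a ∈ E} ∂Measure.pi μ := by
  have hupdate (x : ∀ i, X i) :
      (∫⋯∫⁻_{i}, E.indicator 1 ∂μ) x = μ i {a | Function.update x i a ∈ E} := by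
    simp only [lmarginal_singleton]
    exact lintegral_indicator_one (measurable_update x hE)
  have hmeas : Measurable (E.indicator 1 : (∀ i, X i) → ENNReal) := measurable_one.indicator hE
  simp only [← lintegral_indicator_one hE, ← hupdate]
  refine lintegral_eq_of_lmarginal_eq {i} hmeas (hmeas.lmarginal μ) ?_
  ext x
  rw [lmarginal_singleton _ i, lmarginal_singleton _ i]
  simp

theorem measureReal_pi_le_integral_of_update [DecidableEq ι] {X : ι → Type*}
    [∀ i, MeasurableSpace (X i)] (μ : ∀ i, Measure (X i)) [∀ i, IsProbabilityMeasure (μ i)]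
    {E : Set (∀ i, X i)} (hE : MeasurableSet E) {g : (∀ i, X i) → ℝ}
    (hg : Integrable g (Measure.pi μ)) (i : ι)
    (h : ∀ x, (μ i).real {a | Function.update x i a ∈ E} ≤ g x) :
    (Measure.pi μ).real E ≤ ∫ x, g x ∂Measure.pi μ := by
  have hg0 : ∀ x, 0 ≤ g x := fun x => measureReal_nonneg.trans (h x)
  refine ENNReal.toReal_le_of_le_ofReal (integral_nonneg hg0) ?_
  rw [measure_pi_eq_lintegral_update μ hE i,
    ofReal_integral_eq_lintegral_ofReal hg (Eventually.of_forall hg0)]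
  refine lintegral_mono fun x => ?_
  rw [← ofReal_measureReal]
  exact ENNReal.ofReal_le_ofReal (h x)

theorem measureReal_prod_pi_le_integral_of_update [DecidableEq ι] {X Y : Type*}
    [MeasurableSpace X] [MeasurableSpace Y] (μ : ι → Measure X) (ν : ι → Measure Y)
    [∀ i, IsProbabilityMeasure (μ i)] [∀ i, IsProbabilityMeasure (ν i)]
    {E : Set ((ι → X) × (ι → Y))} (hE : MeasurableSet E)
    {g : (ι → X) × (ι → Y) → ℝ} (hg : Integrable g ((Measure.pi μ).prod (Measure.pi ν))) (i : ι)
    (h : ∀ x, ((μ i).prod (ν i)).real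
      {q | (Function.update x.1 i q.1, Function.update x.2 i q.2) ∈ E} ≤ g x) :
    ((Measure.pi μ).prod (Measure.pi ν)).real E ≤ ∫ x, g x ∂(Measure.pi μ).prod (Measure.pi ν) := by
  let e := MeasurableEquiv.arrowProdEquivProdArrow X Y ι
  have he : MeasurePreserving e (Measure.pi fun i => (μ i).prod (ν i))
      ((Measure.pi μ).prod (Measure.pi ν)) := measurePreserving_arrowProdEquivProdArrow X Y ι μ ν
  have hupdate (x : ι → X × Y) (q : X × Y) : e (Function.update x i q) =
      (Function.update (e x).1 i q.1, Function.update (e x).2 i q.2) := by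
    refine Prod.ext (funext fun j => ?_) (funext fun j => ?_) <;>
      rcases eq_or_ne j i with rfl | hj <;>
      simp [e, MeasurableEquiv.arrowProdEquivProdArrow, Equiv.arrowProdEquivProdArrow, *]
  rw [← he.measureReal_preimage hE.nullMeasurableSet, ← he.integral_comp' g]
  refine measureReal_pi_le_integral_of_update _ (e.measurable hE)
    (he.integrable_comp_of_integrable hg) i fun x => ?_
  simp only [Set.mem_preimage, hupdate]
  exact h (e x)

theorem measureReal_pi_prod_box {X Y : Type*} [MeasurableSpace X] [MeasurableSpace Y]
    (μ : ι → Measure X) (ν : ι → Measure Y) [∀ i, IsProbabilityMeasure (μ i)]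
    [∀ i, IsProbabilityMeasure (ν i)] (B : ι → Set X) (i : ι) (Z : Set Y) :
    (Measure.pi fun j => (μ j).prod (ν j)).real {q | (∀ j, (q j).1 ∈ B j) ∧ (q i).2 ∈ Z} =
      (∏ j, (μ j).real (B j)) * (ν i).real Z := by
  classical
  have hbox : {q : ι → X × Y | (∀ j, (q j).1 ∈ B j) ∧ (q i).2 ∈ Z} =
      Set.univ.pi fun j => B j ×ˢ (if j = i then Z else Set.univ) := by
    ext q
    simp only [Set.mem_ofPred_eq, Set.mem_univ_pi, Set.mem_prod, forall_and]
    refine and_congr_right fun _ => ⟨fun h j => ?_, fun h => by simpa using h i⟩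
    split_ifs with hj
    · exact hj ▸ h
    · trivial
  have hfactor (j : ι) : (ν j).real (if j = i then Z else Set.univ) =
      if j = i then (ν i).real Z else 1 := by
    split_ifs with hj
    · rw [hj]
    · exact probReal_univ
  rw [hbox, measureReal_def, Measure.pi_pi, ENNReal.toReal_prod]
  change ∏ j, ((μ j).prod (ν j)).real _ = _
  simp only [measureReal_prod_prod, hfactor, Finset.prod_mul_distrib, Finset.prod_ite_eq',
    Finset.mem_univ, if_true]

theorem one_sub_inv_card_le_measureReal_dotProduct_ne_zero {F : Type*} [Field F] [Fintype F]
    [MeasurableSpace F] [DiscreteMeasurableSpace F] {z : ι → F} {i : ι} (hz : z i ≠ 0) :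
    1 - 1 / (Fintype.card F : ℝ) ≤
      (Measure.pi fun _ : ι => ProbabilityTheory.uniformOn (Set.univ : Set F)).real
        {α | α ⬝ᵥ z ≠ 0} := by
  classical
  have hsingle (α : ι → F) :
      (ProbabilityTheory.uniformOn (Set.univ : Set F)).real
        {a | Function.update α i a ∈ {α | α ⬝ᵥ z = 0}} ≤ 1 / (Fintype.card F : ℝ) := by
    have hsub : {a | Function.update α i a ∈ {α | α ⬝ᵥ z = 0}}.encard ≤ 1 := by
      refine Set.encard_le_one_iff_subsingleton.2 fun a ha b hb => ?_
      have hdiff : (Function.update α i a - Function.update α i b) ⬝ᵥ z = 0 := by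
        rw [sub_dotProduct, ha, hb, sub_zero]
      rw [← Function.update_sub, sub_self, ← Pi.single, single_dotProduct] at hdiff
      exact sub_eq_zero.1 ((mul_eq_zero.1 hdiff).resolve_right hz)
    rw [measureReal_def, ProbabilityTheory.uniformOn_univ, ENNReal.toReal_div,
      ENNReal.toReal_natCast, Measure.count_apply MeasurableSet.of_discrete]
    gcongr
    exact ENNReal.toReal_le_of_le_ofReal zero_le_one
      (by rw [ENNReal.ofReal_one]; exact_mod_cast hsub)
  have hzero := measureReal_pi_le_integral_of_update
    (fun _ : ι => ProbabilityTheory.uniformOn (Set.univ : Set F)) (MeasurableSet.of_discrete)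
    (integrable_const _) i hsingle
  rw [integral_const, probReal_univ, one_smul] at hzero
  change _ ≤ Measure.real _ {α : ι → F | α ⬝ᵥ z = 0}ᶜ
  rw [probReal_compl_eq_one_sub MeasurableSet.of_discrete]
  linarith

end Resampling

/-! ### One round of the algorithm -/

theorem decayProb_mem_Icc (n t : ℕ) : decayProb n t ∈ Set.Icc 0 1 :=
  ⟨pow_nonneg (by norm_num) _, pow_le_one₀ (by norm_num) (by norm_num)⟩

instance (n t : ℕ) : IsProbabilityMeasure (coin (decayProb n t)) :=
  coin_isProbabilityMeasure (decayProb_mem_Icc n t).1 (decayProb_mem_Icc n t).2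

section Coin

variable (p : ℝ) [hp : IsProbabilityMeasure (coin p)]

include hp in
theorem mem_Icc_of_isProbabilityMeasure_coin : p ∈ Set.Icc 0 1 := by
  have hsum : ENNReal.ofReal p + ENNReal.ofReal (1 - p) = 1 := by
    simpa [coin] using hp.measure_univ
  rcases lt_or_ge p 0 with hneg | h0
  · rw [ENNReal.ofReal_of_nonpos hneg.le, zero_add, ENNReal.ofReal_eq_one] at hsum
    linarith
  · rcases le_or_gt p 1 with h1 | hgt
    · exact ⟨h0, h1⟩
    · rw [ENNReal.ofReal_of_nonpos (by linarith : 1 - p ≤ 0), add_zero,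
        ENNReal.ofReal_eq_one] at hsum
      linarith

theorem coin_real_true : (coin p).real {true} = p := by
  simp [coin, Measure.real, (mem_Icc_of_isProbabilityMeasure_coin p).1]

theorem coin_real_false : (coin p).real {false} = 1 - p := by
  simp [coin, Measure.real, (mem_Icc_of_isProbabilityMeasure_coin p).2]

end Coin

/-- The probability that a transmission is not faulty and that a given nonzero linear functional
does not vanish at the random coefficients sent. -/
noncomputable def successRate (F : Type*) [Fintype F] (p : ℝ) : ℝ :=
  (1 - p) * (1 - 1 / (Fintype.card F : ℝ))

section SuccessRate

variable (F : Type*) [Fintype F] {p : ℝ}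

theorem successRate_pos [Nontrivial F] (hp : p < 1) : 0 < successRate F p := by
  have hF : 1 / (Fintype.card F : ℝ) < 1 := by
    rw [one_div]
    exact inv_lt_one_of_one_lt₀ (by exact_mod_cast Fintype.one_lt_card)
  exact mul_pos (by linarith) (by linarith)

theorem successRate_nonneg (hp : p ≤ 1) : 0 ≤ successRate F p := by
  rw [successRate, one_div]
  exact mul_nonneg (by linarith) (sub_nonneg.2 (Nat.cast_inv_le_one _))

theorem successRate_le_one (hp : p ∈ Set.Icc 0 1) : successRate F p ≤ 1 := by
  refine mul_le_one₀ (by linarith [hp.1]) ?_ ?_ <;> rw [one_div]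
  · exact sub_nonneg.2 (Nat.cast_inv_le_one _)
  · exact sub_le_self _ (by positivity)

end SuccessRate

/-- The random choices of the algorithm and the faults in one round, where a node draws `N`
coefficients. -/
abbrev RoundOutcome (V F : Type) (N : ℕ) : Type := (V → Bool × (Fin N → F)) × (V → Bool)

/-- The distribution of the random choices of the algorithm in round `t`. -/
noncomputable def roundSeedMeasure (V F : Type) [Fintype V] [MeasurableSpace F] (N t : ℕ) :
    Measure (V → Bool × (Fin N → F)) :=
  Measure.pi fun _ => (coin (decayProb (Fintype.card V) t)).prod
    (Measure.pi fun _ => ProbabilityTheory.uniformOn Set.univ)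

/-- The distribution of the random choices of the algorithm and of the faults in round `t`. -/
noncomputable abbrev roundMeasure (V F : Type) [Fintype V] [MeasurableSpace F] (N t : ℕ) (p : ℝ) :
    Measure (RoundOutcome V F N) :=
  (roundSeedMeasure V F N t).prod (Measure.pi fun _ => coin p)

/-- The distribution of the random choices of the algorithm and of the faults in `T` rounds. -/
noncomputable abbrev outcomeMeasure (V F : Type) [Fintype V] [MeasurableSpace F] (k T : ℕ) (p : ℝ) :
    Measure (Outcome V F k T) :=
  (seedMeasure V F k T).prod (faultMeasure V T p)

section Instances

variable {F : Type} [MeasurableSpace F] {k : ℕ} {V : Type}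

instance [Finite F] [Nonempty F] [Fintype V] (N t : ℕ) :
    IsProbabilityMeasure (roundSeedMeasure V F N t) := by
  unfold roundSeedMeasure
  infer_instance

instance [Finite F] [Nonempty F] [Fintype V] (T : ℕ) :
    IsProbabilityMeasure (seedMeasure V F k T) :=
  inferInstanceAs
    (IsProbabilityMeasure (Measure.pi fun t : Fin T => roundSeedMeasure V F (k + T) t))

instance [Fintype V] (T : ℕ) (p : ℝ) [IsProbabilityMeasure (coin p)] :
    IsProbabilityMeasure (faultMeasure V T p) := by
  unfold faultMeasure
  infer_instance

instance [Finite F] [DiscreteMeasurableSpace F] [Finite V] (T : ℕ) :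
    DiscreteMeasurableSpace (Outcome V F k T) := by
  have : MeasurableSingletonClass (Seed V F k T) := inferInstance
  have : MeasurableSingletonClass (Fin T → V → Bool) := inferInstance
  have : Countable (Outcome V F k T) := Finite.to_countable
  exact MeasurableSingletonClass.toDiscreteMeasurableSpace

end Instances

section Events

variable {F : Type} [Field F] {k : ℕ} {V : Type} [Fintype V] {G : SimpleGraph V} {s : V}

/-- The outcome that agrees with `ω` except for round `i`, where it is `q`. -/
def Outcome.updateRound {T : ℕ} (ω : Outcome V F k T) (i : Fin T) (q : RoundOutcome V F (k + T)) :
    Outcome V F k T :=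
  (Function.update ω.1 i q.1, Function.update ω.2 i q.2)

section

variable (𝒯 : RankedBFSTree G s) (model : FaultModel) (c T : ℕ) (bat : Fin k → ℕ)
  (sel : ℕ → V → ℕ) (β : ℕ) (μ : Fin k → F)

/-- The event that `w` is uninformed after `t` rounds. -/
def uninformedEvent (t : ℕ) (w : V) : Set (Outcome V F k T) :=
  {ω | ¬ Informed bat β μ (coeffsKnown 𝒯 model c bat sel ω t w)}

/-- The probability that `w` is uninformed after `t` rounds. -/
noncomputable def probUninformed [MeasurableSpace F] (p : ℝ) (t : ℕ) (w : V) : ℝ :=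
  (outcomeMeasure V F k T p).real (uninformedEvent 𝒯 model c T bat sel β μ t w)

end

variable {𝒯 : RankedBFSTree G s} {model : FaultModel} {c T : ℕ} {bat : Fin k → ℕ}
  {sel : ℕ → V → ℕ} {β : ℕ} {μ : Fin k → F}

theorem coeffsKnown_updateRound (ω : Outcome V F k T) (i : Fin T)
    (q : RoundOutcome V F (k + T)) :
    coeffsKnown 𝒯 model c bat sel (ω.updateRound i q) i = coeffsKnown 𝒯 model c bat sel ω i :=
  coeffsKnown_congr _ (fun _ hj => Function.update_of_ne (Fin.ne_of_lt hj) _ _)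
    fun _ hj => Function.update_of_ne (Fin.ne_of_lt hj) _ _

theorem uninformedEvent_succ_subset (t : ℕ) (w : V) :
    uninformedEvent 𝒯 model c T bat sel β μ (t + 1) w ⊆
      uninformedEvent 𝒯 model c T bat sel β μ t w :=
  fun _ hω h => hω (h.mono (coeffsKnown_subset_succ _ _ _))

variable [Finite F] [MeasurableSpace F] {p : ℝ}

theorem probUninformed_le_one [IsProbabilityMeasure (coin p)] (t : ℕ) (w : V) :
    probUninformed 𝒯 model c T bat sel β μ p t w ≤ 1 :=
  measureReal_le_one

theorem probUninformed_antitone (w : V) :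
    Antitone fun t => probUninformed 𝒯 model c T bat sel β μ p t w :=
  antitone_nat_of_succ_le fun t => measureReal_mono (uninformedEvent_succ_subset t w)

end Events

section OneRound

variable {F : Type} [Field F] [Fintype F] [MeasurableSpace F] [DiscreteMeasurableSpace F] {k : ℕ}
  {V : Type} [Fintype V] {p : ℝ} [IsProbabilityMeasure (coin p)]

theorem prod_mul_successRate_le_measureReal {N t : ℕ} (B : V → Set Bool) (u v : V) {z : Fin N → F}
    {j : Fin N} (hz : z j ≠ 0) :
    (∏ x, (coin (decayProb (Fintype.card V) t)).real (B x)) * successRate F p ≤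
      (roundMeasure V F N t p).real
        {q | ((∀ x, (q.1 x).1 ∈ B x) ∧ (q.1 u).2 ⬝ᵥ z ≠ 0) ∧ q.2 v = false} := by
  have hseed : (roundSeedMeasure V F N t).real
      {q | (∀ x, (q x).1 ∈ B x) ∧ (q u).2 ∈ {α | α ⬝ᵥ z ≠ 0}} = _ :=
    measureReal_pi_prod_box (fun _ => coin (decayProb (Fintype.card V) t)) _ B u _
  have hfault : (Measure.pi fun _ : V => coin p).real {b | b v = false} = 1 - p := by
    rw [← coin_real_false p]
    exact (measurePreserving_eval (fun _ : V => coin p) v).measureReal_preimage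
      (MeasurableSet.singleton false).nullMeasurableSet
  have hcoeffs := one_sub_inv_card_le_measureReal_dotProduct_ne_zero hz
  have hp1 := (mem_Icc_of_isProbabilityMeasure_coin p).2
  calc (∏ x, (coin (decayProb (Fintype.card V) t)).real (B x)) * successRate F p
      = (∏ x, (coin (decayProb (Fintype.card V) t)).real (B x)) *
          (1 - 1 / (Fintype.card F : ℝ)) * (1 - p) := by
        rw [successRate]
        ring
    _ ≤ (roundSeedMeasure V F N t).real
          {q | (∀ x, (q x).1 ∈ B x) ∧ (q u).2 ∈ {α | α ⬝ᵥ z ≠ 0}} *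
          (Measure.pi fun _ : V => coin p).real {b | b v = false} := by
        rw [hseed, hfault]
        gcongr
    _ = _ := (measureReal_prod_prod _ _).symm

variable {G : SimpleGraph V} {s : V} {𝒯 : RankedBFSTree G s} {model : FaultModel} {c T : ℕ}
  {bat : Fin k → ℕ} {sel : ℕ → V → ℕ} {β : ℕ} {μ : Fin k → F}

theorem measureReal_updateRound_le_of_informed {i : Fin T} {w : V} {N : Finset V}
    {B : V → V → Set Bool}
    (hB : ∀ u ∈ N, ∀ b : V → Bool, (∀ x, b x ∈ B u x) →
      IsSoleBroadcaster G (fun x => Broadcasts 𝒯 c i x (b x)) u w)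
    (hsel : ∀ u ∈ N, sel i u = β) {ω : Outcome V F k T}
    (hN : ∀ u ∈ N, Informed bat β μ (coeffsKnown 𝒯 model c bat sel ω i u)) :
    (roundMeasure V F (k + T) i p).real
        {q | ω.updateRound i q ∈ uninformedEvent 𝒯 model c T bat sel β μ (i + 1) w} ≤
      1 - ∑ u ∈ N, (∏ x, (coin (decayProb (Fintype.card V) i)).real (B u x)) * successRate F p := by
  let z (u : V) : Fin (k + T) → F :=
    testValues bat β μ (coeffsKnown 𝒯 model c bat sel ω i u) (k + T)
  let isolated (u : V) : Set (RoundOutcome V F (k + T)) :=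
    {q | ((∀ x, (q.1 x).1 ∈ B u x) ∧ (q.1 u).2 ⬝ᵥ z u ≠ 0) ∧ q.2 (culprit model u w) = false}
  have hsub : {q | ω.updateRound i q ∈ uninformedEvent 𝒯 model c T bat sel β μ (i + 1) w} ⊆
      (⋃ u ∈ N, isolated u)ᶜ := by
    intro q hq hmem
    obtain ⟨u, hu, ⟨hbox, hcoeffs⟩, hfault⟩ := Set.mem_iUnion₂.1 hmem
    have hinf := informed_succ (model := model) (bat := bat) (sel := sel)
      (𝒯 := 𝒯) (c := c) (ω := ω.updateRound i q) (u := u) (w := w) (μ := μ) i.2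
    rw [coeffsKnown_updateRound, hsel u hu] at hinf
    simp only [Fin.eta, Outcome.updateRound, Function.update_self] at hinf
    exact hq (hinf (hB u hu _ hbox) hfault hcoeffs)
  have hdisj : Set.PairwiseDisjoint (N : Set V) isolated := by
    refine fun u hu u' hu' hne => Set.disjoint_left.2 fun q hq hq' => ?_
    have hsole := hB u hu _ hq.1.1
    exact (hB u' hu' _ hq'.1.1).others_silent u hsole.adj hne hsole.broadcasts
  calc (roundMeasure V F (k + T) i p).real _
      ≤ (roundMeasure V F (k + T) i p).real (⋃ u ∈ N, isolated u)ᶜ := measureReal_mono hsub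
    _ = 1 - ∑ u ∈ N, (roundMeasure V F (k + T) i p).real (isolated u) := by
        rw [probReal_compl_eq_one_sub MeasurableSet.of_discrete,
          measureReal_biUnion_finset hdisj fun _ _ => MeasurableSet.of_discrete]
    _ ≤ _ := by
        refine sub_le_sub_left (Finset.sum_le_sum fun u hu => ?_) 1
        obtain ⟨j, hj⟩ := (hN u hu).exists_testValues_ne_zero (length_coeffsKnown_le ω i u)
        exact prod_mul_successRate_le_measureReal (B u) u (culprit model u w) hj

theorem measureReal_updateRound_le_indicator {i : Fin T} {w : V} {N : Finset V}
    {B : V → V → Set Bool}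
    (hB : ∀ u ∈ N, ∀ b : V → Bool, (∀ x, b x ∈ B u x) →
      IsSoleBroadcaster G (fun x => Broadcasts 𝒯 c i x (b x)) u w)
    (hsel : ∀ u ∈ N, sel i u = β) {a : V → ℝ} (ha0 : ∀ u ∈ N, 0 ≤ a u)
    (ha : ∀ u ∈ N, a u ≤
      (∏ x, (coin (decayProb (Fintype.card V) i)).real (B u x)) * successRate F p)
    (ω : Outcome V F k T) :
    (roundMeasure V F (k + T) i p).real
        {q | ω.updateRound i q ∈ uninformedEvent 𝒯 model c T bat sel β μ (i + 1) w} ≤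
      (1 - ∑ u ∈ N, a u) * (uninformedEvent 𝒯 model c T bat sel β μ i w).indicator 1 ω +
        ∑ u ∈ N, a u * (uninformedEvent 𝒯 model c T bat sel β μ i u).indicator 1 ω := by
  classical
  by_cases hw : ω ∈ uninformedEvent 𝒯 model c T bat sel β μ i w
  · let informed := N.filter fun u => ω ∉ uninformedEvent 𝒯 model c T bat sel β μ i u
    have hinf := measureReal_updateRound_le_of_informed (p := p) (w := w) (N := informed)
      (fun u hu => hB u (Finset.mem_of_mem_filter u hu))
      (fun u hu => hsel u (Finset.mem_of_mem_filter u hu))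
      fun u hu => not_not.1 (Finset.mem_filter.1 hu).2
    have hsum : ∑ u ∈ informed, a u + ∑ u ∈ N, a u *
        (uninformedEvent 𝒯 model c T bat sel β μ i u).indicator 1 ω = ∑ u ∈ N, a u := by
      rw [Finset.sum_filter, ← Finset.sum_add_distrib]
      refine Finset.sum_congr rfl fun u _ => ?_
      by_cases hu : ω ∈ uninformedEvent 𝒯 model c T bat sel β μ i u <;> simp [hu]
    have hweights := Finset.sum_le_sum fun u (hu : u ∈ informed) =>
      ha u (Finset.mem_of_mem_filter u hu)
    rw [Set.indicator_of_mem hw, Pi.one_apply, mul_one]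
    linarith
  · have hempty : {q | ω.updateRound i q ∈ uninformedEvent 𝒯 model c T bat sel β μ (i + 1) w} =
        ∅ := by
      refine Set.eq_empty_of_forall_notMem fun q hq => ?_
      have hq' : ¬ Informed bat β μ (coeffsKnown 𝒯 model c bat sel (ω.updateRound i q) i w) :=
        uninformedEvent_succ_subset _ w hq
      rw [coeffsKnown_updateRound] at hq'
      exact hw hq'
    rw [hempty, measureReal_empty, Set.indicator_of_notMem hw, mul_zero, zero_add]
    exact Finset.sum_nonneg fun u hu =>
      mul_nonneg (ha0 u hu) (Set.indicator_nonneg (fun _ _ => zero_le_one) _)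

theorem probUninformed_succ_le {i : Fin T} {w : V} {N : Finset V} {B : V → V → Set Bool}
    (hB : ∀ u ∈ N, ∀ b : V → Bool, (∀ x, b x ∈ B u x) →
      IsSoleBroadcaster G (fun x => Broadcasts 𝒯 c i x (b x)) u w)
    (hsel : ∀ u ∈ N, sel i u = β) {a : V → ℝ} (ha0 : ∀ u ∈ N, 0 ≤ a u)
    (ha : ∀ u ∈ N, a u ≤
      (∏ x, (coin (decayProb (Fintype.card V) i)).real (B u x)) * successRate F p) :
    probUninformed 𝒯 model c T bat sel β μ p (i + 1) w ≤
      (1 - ∑ u ∈ N, a u) * probUninformed 𝒯 model c T bat sel β μ p i w +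
        ∑ u ∈ N, a u * probUninformed 𝒯 model c T bat sel β μ p i u := by
  have hint (f : Outcome V F k T → ℝ) : Integrable f (outcomeMeasure V F k T p) :=
    Integrable.of_finite
  have hresample := measureReal_prod_pi_le_integral_of_update
    (fun t : Fin T => roundSeedMeasure V F (k + T) t) (fun _ => Measure.pi fun _ : V => coin p)
    MeasurableSet.of_discrete (hint _) i
    (measureReal_updateRound_le_indicator (μ := μ) (bat := bat) (model := model) hB hsel ha0 ha)
  refine hresample.trans_eq ?_
  change ∫ ω, _ ∂outcomeMeasure V F k T p = _
  rw [integral_add (hint _) (hint _), integral_const_mul, integral_finsetSum _ fun _ _ => hint _]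
  simp only [integral_const_mul, integral_indicator_one MeasurableSet.of_discrete]
  rfl

end OneRound

/-! ### The spreading rules for the algorithm -/

theorem half_le_one_sub_inv_two_pow_pow (j : ℕ) :
    (1 : ℝ) / 2 ≤ (1 - 2⁻¹ ^ (j + 1)) ^ 2 ^ j := by
  have hx : (2⁻¹ : ℝ) ^ (j + 1) ≤ 1 := pow_le_one₀ (by norm_num) (by norm_num)
  have hbernoulli := one_add_mul_le_pow (by linarith : -2 ≤ -(2⁻¹ : ℝ) ^ (j + 1)) (2 ^ j)
  have hmul : ((2 ^ j : ℕ) : ℝ) * 2⁻¹ ^ (j + 1) = 1 / 2 := by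
    push_cast
    rw [pow_succ, inv_pow]
    field_simp
  rw [mul_neg, hmul, ← sub_eq_add_neg, ← sub_eq_add_neg] at hbernoulli
  linarith

theorem one_div_le_pow_log_mul_one_sub_pow_log_pow {m : ℕ} (hm : m ≠ 0) :
    1 / (16 * (m : ℝ)) ≤ 2⁻¹ ^ Nat.log 2 m * (1 - 2⁻¹ ^ Nat.log 2 m) ^ (m - 1) := by
  have hlower : 2 ^ Nat.log 2 m ≤ m := Nat.pow_log_le_self 2 hm
  have hupper : m < 2 ^ (Nat.log 2 m + 1) := Nat.lt_pow_succ_log_self one_lt_two m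
  rcases hlog : Nat.log 2 m with _ | j <;> rw [hlog] at hlower hupper
  · obtain rfl : m = 1 := by omega
    norm_num
  · set x : ℝ := 2⁻¹ ^ (j + 1) with hx
    have hx1 : x ≤ 1 := pow_le_one₀ (by norm_num) (by norm_num)
    have hmx : 1 ≤ m * x := by
      have hlower' : (2 : ℝ) ^ (j + 1) ≤ m := by exact_mod_cast hlower
      rwa [hx, inv_pow, ← div_eq_mul_inv, one_le_div (by positivity)]
    have hpow : 1 / 16 ≤ (1 - x) ^ (m - 1) :=
      calc (1 : ℝ) / 16 = (1 / 2) ^ 4 := by norm_num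
        _ ≤ ((1 - x) ^ 2 ^ j) ^ 4 := by
          gcongr
          exact half_le_one_sub_inv_two_pow_pow j
        _ = (1 - x) ^ 2 ^ (j + 1 + 1) := by
          rw [← pow_mul]
          ring
        _ ≤ (1 - x) ^ (m - 1) :=
          pow_le_pow_of_le_one (by linarith) (by linarith [show 0 < x by positivity]) (by omega)
    rw [div_le_iff₀ (by positivity)]
    calc 1 ≤ 16 * (m * x) * (1 / 16) := by linarith
      _ ≤ 16 * (m * x) * (1 - x) ^ (m - 1) := by gcongr
      _ = x * (1 - x) ^ (m - 1) * (16 * m) := by ring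

theorem exists_mod_eq {r M : ℕ} (hr : r < M) (t : ℕ) : ∃ t', t ≤ t' ∧ t' < t + M ∧ t' % M = r := by
  refine ⟨t + (r + (M - 1) * t) % M, Nat.le_add_right _ _,
    Nat.add_lt_add_left (Nat.mod_lt _ (by omega)) t, ?_⟩
  obtain ⟨m, rfl⟩ : ∃ m, M = m + 1 := ⟨M - 1, by omega⟩
  rw [Nat.add_mod_mod, show t + (r + (m + 1 - 1) * t) = r + (m + 1) * t by
    rw [Nat.add_sub_cancel]; ring, Nat.add_mul_mod_self_left, Nat.mod_eq_of_lt hr]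

theorem exists_odd_round {L i : ℕ} (hi : i < L) (d t : ℕ) :
    ∃ t', t ≤ t' ∧ t' < t + 6 * L ∧ t' % 2 = 1 ∧ t' / 2 ≡ d [MOD 3] ∧ t' / 2 / 3 % L = i := by
  obtain ⟨t', hle, hlt, hmod⟩ := exists_mod_eq (by omega : 6 * i + 2 * (d % 3) + 1 < 6 * L) t
  have hdiv := Nat.div_add_mod t' (6 * L)
  rw [hmod, mul_assoc] at hdiv
  have hphase : t' / 2 / 3 = i + L * (t' / (6 * L)) := by
    generalize L * (t' / (6 * L)) = y at hdiv ⊢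
    omega
  refine ⟨t', hle, hlt, by omega, ?_, ?_⟩
  · generalize L * (t' / (6 * L)) = y at hdiv
    unfold Nat.ModEq
    omega
  · rw [hphase, Nat.add_mul_mod_self_left, Nat.mod_eq_of_lt hi]

section IsolatingBox

variable {V : Type*} [DecidableEq V] {N : Finset V} {u : V}

/-- The coins for which, among the nodes in `N`, exactly `u` is told to broadcast. -/
def isolatingBox (N : Finset V) (u x : V) : Set Bool :=
  if x = u then {true} else if x ∈ N then {false} else Set.univ

theorem prod_coin_isolatingBox [Fintype V] (x : ℝ) [IsProbabilityMeasure (coin x)] (hu : u ∈ N) :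
    ∏ y, (coin x).real (isolatingBox N u y) = x * (1 - x) ^ (N.card - 1) := by
  have hfactor (y : V) : (coin x).real (isolatingBox N u y) =
      if y ∈ N then if y = u then x else 1 - x else 1 := by
    unfold isolatingBox
    split_ifs <;> simp_all [-Bool.univ_eq, coin_real_true, coin_real_false]
  rw [Finset.prod_congr rfl fun y _ => hfactor y, Finset.prod_ite_mem, Finset.univ_inter,
    ← Finset.mul_prod_erase _ _ hu, if_pos rfl, Finset.prod_congr rfl fun y hy =>
      if_neg (Finset.ne_of_mem_erase hy), Finset.prod_const, Finset.card_erase_of_mem hu]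

end IsolatingBox

section Steps

variable {F : Type} [Field F] [Fintype F] [MeasurableSpace F] [DiscreteMeasurableSpace F] {k : ℕ}
  {V : Type} [Fintype V] {G : SimpleGraph V} {s : V} {𝒯 : RankedBFSTree G s}
  {model : FaultModel} {c T : ℕ} {bat : Fin k → ℕ} {sel : ℕ → V → ℕ} {β : ℕ} {μ : Fin k → F}
  {p : ℝ} [IsProbabilityMeasure (coin p)]

theorem probUninformed_succ_le_of_fastEdge (hG : G.Connected) (hT : 𝒯.IsGBST) {t : ℕ} (ht : t < T)
    (heven : t % 2 = 0) {u w : V} (huw : 𝒯.FastEdge u w) (hsel : sel t u = β)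
    (hturn : IsFastTurn (blockSize (Fintype.card V)) 𝒯.maxRank c (G.dist s u) (𝒯.rank u) t) :
    probUninformed 𝒯 model c T bat sel β μ p (t + 1) w ≤
      (1 - successRate F p) * probUninformed 𝒯 model c T bat sel β μ p t w +
        successRate F p * probUninformed 𝒯 model c T bat sel β μ p t u := by
  have hrate := successRate_nonneg F (mem_Icc_of_isProbabilityMeasure_coin p).2
  simpa using probUninformed_succ_le (i := ⟨t, ht⟩) (w := w) (N := {u}) (B := fun _ _ => Set.univ)
    (p := p) (model := model) (bat := bat) (sel := sel) (β := β) (μ := μ) (𝒯 := 𝒯) (c := c)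
    (fun u' hu' b _ => Finset.mem_singleton.1 hu' ▸
      hT.isSoleBroadcaster_of_fastEdge hG heven huw hturn b)
    (fun u' hu' => Finset.mem_singleton.1 hu' ▸ hsel) (a := fun _ => successRate F p)
    (fun _ _ => hrate) (fun _ _ => by simp [-Bool.univ_eq])

theorem isSoleBroadcaster_of_forall_mem_isolatingBox [DecidableEq V] (hG : G.Connected) {t d : ℕ}
    (hodd : t % 2 = 1) (hturn : t / 2 ≡ d [MOD 3]) {w : V} (hw : 𝒯.virtualDist w = d + 1)
    {N : Finset V} (hN : ∀ u, u ∈ N ↔ G.Adj u w ∧ 𝒯.virtualDist u = d) {u : V} (hu : u ∈ N)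
    {b : V → Bool} (hb : ∀ x, b x ∈ isolatingBox N u x) :
    IsSoleBroadcaster G (fun x => Broadcasts 𝒯 c t x (b x)) u w := by
  obtain ⟨hadj, hd⟩ := (hN u).1 hu
  simp only [funext fun x => propext (RankedBFSTree.broadcasts_odd_iff hodd x (b x))]
  unfold Nat.ModEq at hturn ⊢
  refine ⟨hadj, ⟨hd ▸ hturn, by simpa [isolatingBox] using hb u⟩, fun h => ?_,
    fun x hx hne h => ?_⟩
  · omega
  · have hlower := 𝒯.virtualDist_le_add_one hG (Or.inl hx)
    have hupper := 𝒯.virtualDist_le_add_one hG (Or.inl hx.symm)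
    have hxN : x ∈ N := (hN x).2 ⟨hx, by omega⟩
    have hbx : b x = false := by simpa [isolatingBox, hne, hxN] using hb x
    exact Bool.false_ne_true (hbx.symm.trans h.2)

theorem probUninformed_succ_le_of_decay (hG : G.Connected) {t d : ℕ} (ht : t < T)
    (hodd : t % 2 = 1) (hturn : t / 2 ≡ d [MOD 3]) {w : V} (hw : 𝒯.virtualDist w = d + 1)
    {N : Finset V} (hN : ∀ u, u ∈ N ↔ G.Adj u w ∧ 𝒯.virtualDist u = d) (hN0 : N.Nonempty)
    (hphase : t / 2 / 3 % decayLength (Fintype.card V) = Nat.log 2 N.card)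
    (hsel : ∀ u ∈ N, sel t u = β) :
    probUninformed 𝒯 model c T bat sel β μ p (t + 1) w ≤
      (1 - successRate F p / 16) * probUninformed 𝒯 model c T bat sel β μ p t w +
        ∑ u ∈ N, successRate F p / 16 / N.card *
          probUninformed 𝒯 model c T bat sel β μ p t u := by
  classical
  have hrate := successRate_nonneg F (mem_Icc_of_isProbabilityMeasure_coin p).2
  have hcard : (N.card : ℝ) ≠ 0 := by exact_mod_cast hN0.card_ne_zero
  have hweight (u : V) (hu : u ∈ N) : successRate F p / 16 / N.card ≤
      (∏ x, (coin (decayProb (Fintype.card V) t)).real (isolatingBox N u x)) *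
        successRate F p := by
    rw [prod_coin_isolatingBox _ hu, decayProb, hphase]
    calc successRate F p / 16 / N.card = 1 / (16 * N.card) * successRate F p := by ring
      _ ≤ _ := mul_le_mul_of_nonneg_right
        (one_div_le_pow_log_mul_one_sub_pow_log_pow hN0.card_ne_zero) hrate
  have hstep := probUninformed_succ_le (i := ⟨t, ht⟩) (w := w) (B := isolatingBox N) (p := p)
    (model := model) (bat := bat) (μ := μ) (𝒯 := 𝒯) (c := c)
    (fun u hu b hb => isSoleBroadcaster_of_forall_mem_isolatingBox hG hodd hturn hw hN hu hb)
    hsel (a := fun _ => successRate F p / 16 / N.card) (fun _ _ => by positivity) hweight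
  rwa [Finset.sum_const, nsmul_eq_mul, mul_div_cancel₀ _ hcard] at hstep

/-- The layout of a ranked BFS tree, with the parameters of Robust FASTBC. -/
noncomputable def RankedBFSTree.spreadLayout (𝒯 : RankedBFSTree G s) : SpreadLayout V where
  level := G.dist s
  virtualDist := 𝒯.virtualDist
  rank := 𝒯.rank
  parent := 𝒯.parent
  decayLength := decayLength (Fintype.card V)
  blockSize := blockSize (Fintype.card V)
  maxRank := 𝒯.maxRank

theorem slowStep_probUninformed (hG : G.Connected) {lo hi t₀ t₁ : ℕ} {δ : ℝ} (ht₁ : t₁ ≤ T)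
    (hsel : ∀ t, t₀ ≤ t → t < t₁ → ∀ u, lo ≤ G.dist s u → G.dist s u ≤ hi → sel t u = β)
    {w : V} (hw : 𝒯.spreadLayout.InZone lo hi w) {d : ℕ} (hd : 𝒯.virtualDist w = d + 1)
    (hpred : ∃ u, G.Adj u w ∧ 𝒯.virtualDist u = d) :
    𝒯.spreadLayout.SlowStep (fun t w => probUninformed 𝒯 model c T bat sel β μ p t w - δ)
      t₀ t₁ (successRate F p / 16) w := by
  classical
  intro t B Q ht₀ ht hB hQ
  have hcoin := mem_Icc_of_isProbabilityMeasure_coin p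
  have hrate := successRate_nonneg F hcoin.2
  have hrate' := successRate_le_one F hcoin
  set L := decayLength (Fintype.card V)
  set N := Finset.univ.filter fun u => G.Adj u w ∧ 𝒯.virtualDist u = d with hNdef
  have hN (u : V) : u ∈ N ↔ G.Adj u w ∧ 𝒯.virtualDist u = d := by simp [hNdef]
  have hN0 : N.Nonempty := hpred.imp fun u hu => (hN u).2 hu
  have hlevel (u : V) (hu : u ∈ N) : lo ≤ G.dist s u ∧ G.dist s u ≤ G.dist s w + 1 := by
    have hlower := dist_le_dist_add_one s ((hN u).1 hu).1
    have hupper := dist_le_dist_add_one s ((hN u).1 hu).1.symm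
    have hlo : lo < G.dist s w := hw.1
    omega
  have hzone : G.dist s w + 1 ≤ hi := by
    have hhi : G.dist s w + 𝒯.virtualDist w ≤ hi := hw.2
    omega
  have hphase : Nat.log 2 N.card < L :=
    (Nat.pow_lt_pow_iff_right one_lt_two).1 <|
      (Nat.pow_log_le_self 2 hN0.card_ne_zero).trans_lt <|
        (Finset.card_lt_univ_of_notMem (x := w) (by simp [hN])).trans_le
          (Nat.le_pow_clog one_lt_two _)
  obtain ⟨t', htt', ht'L, hodd, hturn, hphase'⟩ := exists_odd_round hphase d t
  change t + 6 * L ≤ t₁ at ht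
  have hstep := probUninformed_succ_le_of_decay (model := model) (c := c) (bat := bat) (μ := μ)
    (p := p) hG (by omega : t' < T) hodd hturn hd hN hN0 hphase' fun u hu =>
      hsel t' (by omega) (by omega) u (hlevel u hu).1 ((hlevel u hu).2.trans hzone)
  have hpreds : ∑ u ∈ N, successRate F p / 16 / N.card *
      probUninformed 𝒯 model c T bat sel β μ p t' u ≤ successRate F p / 16 * (Q + δ) :=
    calc _ ≤ ∑ u ∈ N, successRate F p / 16 / N.card * (Q + δ) := by
          refine Finset.sum_le_sum fun u hu => mul_le_mul_of_nonneg_left ?_ (by positivity)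
          have hQu := hQ u (by rw [← ((hN u).1 hu).2] at hd; exact hd.symm) (hlevel u hu).2
          exact (probUninformed_antitone u htt').trans (sub_le_iff_le_add.1 hQu)
      _ = _ := by
        have hcard : (N.card : ℝ) ≠ 0 := by exact_mod_cast hN0.card_ne_zero
        rw [Finset.sum_const, nsmul_eq_mul]
        field_simp
  have hself : (1 - successRate F p / 16) * probUninformed 𝒯 model c T bat sel β μ p t' w ≤
      (1 - successRate F p / 16) * (B + δ) :=
    mul_le_mul_of_nonneg_left
      ((probUninformed_antitone w htt').trans (sub_le_iff_le_add.1 hB)) (by linarith)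
  have hend := probUninformed_antitone (𝒯 := 𝒯) (model := model) (c := c) (T := T) (bat := bat)
    (sel := sel) (β := β) (μ := μ) (p := p) w (by omega : t' + 1 ≤ t + 6 * L)
  change probUninformed 𝒯 model c T bat sel β μ p (t + 6 * L) w - δ ≤ _
  linarith

theorem fastStep_probUninformed (hG : G.Connected) (hT : 𝒯.IsGBST) {lo hi t₀ t₁ : ℕ} {δ : ℝ}
    (ht₁ : t₁ ≤ T)
    (hsel : ∀ t, t₀ ≤ t → t < t₁ → ∀ u, lo ≤ G.dist s u → G.dist s u ≤ hi → sel t u = β)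
    {w : V} (hw : 𝒯.spreadLayout.InZone lo hi w) (hfast : 𝒯.FastEdge (𝒯.parent w) w)
    (hparent : 𝒯.virtualDist (𝒯.parent w) = 𝒯.virtualDist w) :
    𝒯.spreadLayout.FastStep c (fun t w => probUninformed 𝒯 model c T bat sel β μ p t w - δ)
      t₀ t₁ (successRate F p) w := by
  have hdist := 𝒯.dist_parent w hfast.1
  refine ⟨hdist, hparent, hfast.2.2.symm, fun t ht₀ ht heven hturn => ?_⟩
  have hlo : lo < G.dist s w := hw.1
  have hhi : G.dist s w + 𝒯.virtualDist w ≤ hi := hw.2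
  have hstep := probUninformed_succ_le_of_fastEdge (model := model) (c := c) (bat := bat) (μ := μ)
    (p := p) hG hT (by omega : t < T) heven hfast
    (hsel t ht₀ ht (𝒯.parent w) (by omega) (by omega)) hturn
  change _ ≤ (1 - successRate F p) * (_ - δ) + successRate F p *
    (probUninformed 𝒯 model c T bat sel β μ p t (𝒯.parent w) - δ)
  linarith

theorem spreadRules_probUninformed (hG : G.Connected) (hT : 𝒯.IsGBST) {lo hi t₀ t₁ : ℕ} {δ : ℝ}
    (hδ : 0 ≤ δ) (ht₁ : t₁ ≤ T)
    (hsel : ∀ t, t₀ ≤ t → t < t₁ → ∀ u, lo ≤ G.dist s u → G.dist s u ≤ hi → sel t u = β)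
    (hlow : ∀ w, G.dist s w ≤ lo → probUninformed 𝒯 model c T bat sel β μ p t₀ w ≤ δ) :
    𝒯.spreadLayout.SpreadRules c (fun t w => probUninformed 𝒯 model c T bat sel β μ p t w - δ)
      lo hi t₀ t₁ (successRate F p) (successRate F p / 16) where
  le_one _ w _ _ := (sub_le_self _ hδ).trans (probUninformed_le_one _ w)
  succ_le t w _ _ := sub_le_sub_right (probUninformed_antitone w t.le_succ) δ
  low _ w ht₀ _ hw := sub_nonpos.2 ((probUninformed_antitone w ht₀).trans (hlow w hw))
  step w hw := by
    have hws : w ≠ s := by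
      rintro rfl
      have hlo : lo < G.dist w w := hw.1
      simp at hlo
    obtain ⟨d, hd⟩ := Nat.exists_eq_succ_of_ne_zero (mt (𝒯.virtualDist_eq_zero_iff hG).1 hws)
    rcases 𝒯.exists_adj_or_fastEdge hG hd with hpred | ⟨hfast, hparent⟩
    · exact Or.inl (slowStep_probUninformed hG ht₁ hsel hw hd hpred)
    · exact Or.inr (fastStep_probUninformed hG hT ht₁ hsel hw hfast (hparent.trans hd.symm))

end Steps

/-! ### The round bound -/

theorem two_le_decayLength {n : ℕ} (hn : 3 ≤ n) : 2 ≤ decayLength n := by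
  have hclog : Nat.clog 2 3 = 2 := by decide +kernel
  exact hclog ▸ Nat.clog_mono_right 2 hn

theorem one_le_blockSize {n : ℕ} (hn : 3 ≤ n) : 1 ≤ blockSize n :=
  Nat.clog_pos one_lt_two (two_le_decayLength hn)

theorem decayLength_le_two_pow_blockSize (n : ℕ) : decayLength n ≤ 2 ^ blockSize n :=
  Nat.le_pow_clog one_lt_two _

theorem clog_two_le_one_add_log {n : ℕ} (hn : 2 ≤ n) :
    (Nat.clog 2 n : ℝ) ≤ 1 + 3 / 2 * Real.log n := by
  obtain ⟨j, hj⟩ := Nat.exists_eq_add_of_le' (Nat.clog_pos one_lt_two hn)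
  have hpow : 2 ^ j < n := by
    simpa only [hj, Nat.pred_succ, Nat.pred_eq_sub_one, Nat.add_sub_cancel] using
      Nat.pow_pred_clog_lt_self one_lt_two hn
  have hlog : j * Real.log 2 ≤ Real.log n := by
    rw [← Real.log_pow]
    exact Real.log_le_log (by positivity) (by exact_mod_cast hpow.le)
  have hlog2 := Real.log_two_gt_d9
  rw [hj]
  push_cast
  nlinarith [(Nat.cast_nonneg j : (0 : ℝ) ≤ j)]

theorem thirteen_div_twelve_le_log {n : ℕ} (hn : 3 ≤ n) : 13 / 12 ≤ Real.log n := by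
  have hlog3 := Real.one_sub_inv_le_log_of_pos (by positivity : 0 < 3 / Real.exp 1)
  rw [Real.log_div (by norm_num) (by positivity), Real.log_exp, inv_div] at hlog3
  have hmono : Real.log 3 ≤ Real.log n := Real.log_le_log (by norm_num) (by exact_mod_cast hn)
  have := Real.exp_one_lt_d9
  linarith

theorem one_div_thirteen_le_log_log {n : ℕ} (hn : 3 ≤ n) : 1 / 13 ≤ Real.log (Real.log n) := by
  have hlog := thirteen_div_twelve_le_log hn
  calc (1 : ℝ) / 13 = 1 - (13 / 12)⁻¹ := by norm_num
    _ ≤ 1 - (Real.log n)⁻¹ := by gcongr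
    _ ≤ Real.log (Real.log n) := Real.one_sub_inv_le_log_of_pos (by linarith)

theorem decayLength_le_log {n : ℕ} (hn : 3 ≤ n) : (decayLength n : ℝ) ≤ 3 * Real.log n := by
  have hclog := clog_two_le_one_add_log (by omega : 2 ≤ n)
  have hlog := thirteen_div_twelve_le_log hn
  unfold decayLength
  linarith

theorem blockSize_le_log_log {n : ℕ} (hn : 3 ≤ n) :
    (blockSize n : ℝ) ≤ 60 * Real.log (Real.log n) := by
  have hL := two_le_decayLength hn
  have hlog := thirteen_div_twelve_le_log hn
  have hloglog := one_div_thirteen_le_log_log hn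
  have hlogL : Real.log (decayLength n) ≤ 2 + Real.log (Real.log n) := by
    calc Real.log (decayLength n) ≤ Real.log (3 * Real.log n) :=
          Real.log_le_log (by positivity) (decayLength_le_log hn)
      _ = Real.log 3 + Real.log (Real.log n) := Real.log_mul (by norm_num) (by linarith)
      _ ≤ 2 + Real.log (Real.log n) := by
        have := Real.log_le_sub_one_of_pos (by norm_num : (0 : ℝ) < 3)
        linarith
  calc (blockSize n : ℝ) ≤ 1 + 3 / 2 * Real.log (decayLength n) := clog_two_le_one_add_log hL
    _ ≤ 60 * Real.log (Real.log n) := by linarith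

theorem mul_decayLength_mul_blockSize_le_roundBound {n : ℕ} (hn : 3 ≤ n) (D k : ℕ) :
    ((D + (k + decayLength n) * decayLength n * blockSize n : ℕ) : ℝ) ≤
      540 * roundBound n D k := by
  have : 0 ≤ Real.log n := by linarith [thirteen_div_twelve_le_log hn]
  have : 0 ≤ Real.log (Real.log n) := by linarith [one_div_thirteen_le_log_log hn]
  calc ((D + (k + decayLength n) * decayLength n * blockSize n : ℕ) : ℝ)
      = D + (k + decayLength n) * decayLength n * blockSize n := by push_cast; rfl
    _ ≤ D + (k + 3 * Real.log n) * (3 * Real.log n) * (60 * Real.log (Real.log n)) := by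
        gcongr
        exacts [decayLength_le_log hn, decayLength_le_log hn, blockSize_le_log_log hn]
    _ = 1 * D + 180 * (k * Real.log n * Real.log (Real.log n)) +
          540 * (Real.log n ^ 2 * Real.log (Real.log n)) := by ring
    _ ≤ 540 * D + 540 * (k * Real.log n * Real.log (Real.log n)) +
          540 * (Real.log n ^ 2 * Real.log (Real.log n)) := by
        gcongr <;> norm_num
    _ = 540 * roundBound n D k := by
        unfold roundBound
        ring

/-! ### Success of Robust FASTBC -/

theorem RankedBFSTree.spreadLayout_isAdmissible {V : Type} [Fintype V] {G : SimpleGraph V} {s : V}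
    (𝒯 : RankedBFSTree G s) (hG : G.Connected) (hn : 3 ≤ Fintype.card V) :
    𝒯.spreadLayout.IsAdmissible where
  one_le_blockSize := one_le_blockSize hn
  one_le_decayLength := one_le_two.trans (two_le_decayLength hn)
  decayLength_le := decayLength_le_two_pow_blockSize _
  one_le_maxRank := (𝒯.one_le_rank hG s).trans (𝒯.rank_le_maxRank s)
  maxRank_le := by
    have hL := two_le_decayLength hn
    have hclog : 𝒯.maxRank ≤ decayLength (Fintype.card V) + 1 := 𝒯.maxRank_le_clog_add_one hG
    change 𝒯.maxRank ≤ 2 * decayLength (Fintype.card V)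
    omega
  virtualDist_le := 𝒯.virtualDist_le_clog hG

/-- `C` is a progress constant (for the fault probability `p`, the parameter `c` and the error base
`r`) if `C * (Δ + h * L * S)` rounds suffice to carry a batch across `Δ` levels while all nodes of
these levels, and of the `2 * L + 1` levels after them, work on this batch: the probability of being
uninformed then grows by at most `r ^ h`. Here `L` is the decay length and `S` the block size. -/
def IsProgressConstant (F : Type) [Field F] [MeasurableSpace F] (p r : ℝ) (c C : ℕ) : Prop :=
  ∀ (model : FaultModel) (V : Type) [Fintype V] (G : SimpleGraph V) (s : V)
    (𝒯 : RankedBFSTree G s), G.Connected → 3 ≤ Fintype.card V → 𝒯.IsGBST →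
    ∀ (k T : ℕ) (bat : Fin k → ℕ) (sel : ℕ → V → ℕ) (β : ℕ) (μ : Fin k → F)
      (lo Δ hi t₀ t₁ h : ℕ) (δ : ℝ), 0 ≤ δ → t₁ ≤ T →
      (∀ t, t₀ ≤ t → t < t₁ → ∀ u, lo ≤ G.dist s u → G.dist s u ≤ hi → sel t u = β) →
      (∀ w, G.dist s w ≤ lo → probUninformed 𝒯 model c T bat sel β μ p t₀ w ≤ δ) →
      decayLength (Fintype.card V) ≤ h →
      t₀ + C * (Δ + h * decayLength (Fintype.card V) * blockSize (Fintype.card V)) ≤ t₁ →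
      lo + Δ + 2 * decayLength (Fintype.card V) + 1 ≤ hi → ∀ w, G.dist s w ≤ lo + Δ →
      probUninformed 𝒯 model c T bat sel β μ p t₁ w ≤ δ + r ^ h

section Progress

variable {F : Type} [Field F] [Finite F] [MeasurableSpace F] [DiscreteMeasurableSpace F] {p : ℝ}
  [IsProbabilityMeasure (coin p)]

variable (F) in
theorem exists_isProgressConstant (hp1 : p < 1) {r : ℝ} (hr : 0 < r) :
    ∃ c₀ : ℕ, ∀ c : ℕ, c₀ ≤ c → ∃ C : ℕ, 1 ≤ C ∧ IsProgressConstant F p r c C := by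
  cases nonempty_fintype F
  have hrate0 := successRate_pos F hp1
  have hrate1 := successRate_le_one F (mem_Icc_of_isProbabilityMeasure_coin p)
  obtain ⟨c₀, hc₀⟩ := SpreadLayout.exists_spread_constants hr hrate0 hrate1
    (by linarith : 0 < successRate F p / 16) (by linarith)
  refine ⟨c₀, fun c hc => ?_⟩
  obtain ⟨C, hC1, hC⟩ := hc₀ c hc
  refine ⟨C, hC1, ?_⟩
  intro model V _ G s 𝒯 hG hn hT k T bat sel β μ lo Δ hi t₀ t₁ h δ hδ ht₁ hsel hlow hh ht hhi w hw
  have hadm := 𝒯.spreadLayout_isAdmissible hG hn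
  have hwhi : 𝒯.spreadLayout.level w + 𝒯.spreadLayout.virtualDist w ≤ hi :=
    (add_le_add hw (hadm.virtualDist_le w)).trans ((add_assoc _ _ _).symm.trans_le hhi)
  have hspread := hC V 𝒯.spreadLayout _ lo Δ hi t₀ t₁ h hadm
    (spreadRules_probUninformed hG hT hδ ht₁ hsel hlow) hh ht w hw hwhi
  exact sub_le_iff_le_add'.1 hspread

end Progress

section Success

theorem dist_le_diam_of_connected {V : Type*} [Finite V] {G : SimpleGraph V} (hG : G.Connected)
    (u v : V) : G.dist u v ≤ G.diam := by
  have := hG.nonempty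
  exact SimpleGraph.dist_le_diam (SimpleGraph.connected_iff_ediam_ne_top.1 hG)

variable {F : Type} [Field F] {k : ℕ} {V : Type} [Fintype V] {G : SimpleGraph V} {s : V}
  {𝒯 : RankedBFSTree G s} {model : FaultModel} {c C T : ℕ} {bat : Fin k → ℕ} {sel : ℕ → V → ℕ}
  {p r : ℝ} {β : ℕ} {μ : Fin k → F}

section

variable [MeasurableSpace F]

theorem probUninformed_root (t : ℕ) (hμ : μ ≠ 0) (hβ : InBatch bat β μ) :
    probUninformed 𝒯 model c T bat sel β μ p t s = 0 := by
  have hempty : uninformedEvent 𝒯 model c T bat sel β μ t s = ∅ :=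
    Set.eq_empty_of_forall_notMem fun ω hω => hω (informed_root ω t hμ hβ)
  rw [probUninformed, hempty, measureReal_empty]

theorem IsProgressConstant.probUninformed_le_pow (hC : IsProgressConstant F p r c C)
    (hG : G.Connected) (hn : 3 ≤ Fintype.card V) (hT : 𝒯.IsGBST) (hμ : μ ≠ 0)
    (hβ : InBatch bat β μ) {h : ℕ} (hh : decayLength (Fintype.card V) ≤ h)
    (hround : C * (G.diam + h * decayLength (Fintype.card V) * blockSize (Fintype.card V)) ≤ T)
    (w : V) : probUninformed 𝒯 model c T bat (fun _ _ => β) β μ p T w ≤ r ^ h := by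
  have hroot : ∀ w, G.dist s w ≤ 0 →
      probUninformed 𝒯 model c T bat (fun _ _ => β) β μ p 0 w ≤ 0 := by
    intro w hw
    obtain rfl := hG.dist_eq_zero_iff.1 (Nat.le_zero.1 hw)
    exact (probUninformed_root 0 hμ hβ).le
  have hdist : G.dist s w ≤ 0 + G.diam := (zero_add G.diam).symm ▸ dist_le_diam_of_connected hG s w
  simpa only [zero_add] using hC model V G s 𝒯 hG hn hT k T bat (fun _ _ => β) β μ 0 G.diam _ 0 T h
    0 le_rfl le_rfl (fun _ _ _ _ _ _ => rfl) hroot hh (by rwa [zero_add]) le_rfl w hdist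

end

/-- The test vectors that a node has to be informed about, together with their batches. -/
def batchTests (F : Type) [Field F] (bat : Fin k → ℕ) : Set (ℕ × (Fin k → F)) :=
  {x | x.2 ≠ 0 ∧ InBatch bat x.1 x.2}

theorem finite_batchTests [Finite F] : (batchTests F bat).Finite := by
  refine ((Set.finite_range bat).prod Set.finite_univ).subset fun x hx => ⟨?_, Set.mem_univ _⟩
  obtain ⟨i, -, hi⟩ := hx.2.exists_eq hx.1
  exact ⟨i, hi⟩

theorem ncard_batchTests_const_le [Fintype F] :
    (batchTests F fun _ : Fin k => β).ncard ≤ Fintype.card F ^ k := by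
  have hinj : Set.InjOn Prod.snd (batchTests F fun _ : Fin k => β) := by
    intro x hx y hy hxy
    obtain ⟨-, -, hβx⟩ := hx.2.exists_eq hx.1
    obtain ⟨-, -, hβy⟩ := hy.2.exists_eq hy.1
    exact Prod.ext (hβx.symm.trans hβy) hxy
  calc (batchTests F fun _ : Fin k => β).ncard ≤ (Set.univ : Set (Fin k → F)).ncard :=
        Set.ncard_le_ncard_of_injOn _ (fun _ _ => Set.mem_univ _) hinj
    _ = Fintype.card F ^ k := by simp [Set.ncard_univ]

theorem compl_allInformed [Finite F] :
    {ω : Outcome V F k T | AllInformed 𝒯 model c bat sel ω}ᶜ =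
      ⋃ x ∈ Finset.univ ×ˢ (finite_batchTests (bat := bat) (F := F)).toFinset,
        uninformedEvent 𝒯 model c T bat sel x.2.1 x.2.2 T x.1 := by
  ext ω
  simp only [AllInformed, uninformedEvent, Set.mem_compl_iff, Set.mem_ofPred_eq, not_forall,
    Set.mem_iUnion, Finset.mem_product, Finset.mem_univ, true_and, Set.Finite.mem_toFinset,
    Prod.exists, exists_prop]
  simp only [batchTests, Set.mem_ofPred_eq, and_assoc]

variable [MeasurableSpace F]

theorem one_sub_le_measureReal_allInformed [Finite F] [DiscreteMeasurableSpace F]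
    [IsProbabilityMeasure (coin p)] {ε : ℝ}
    (hε : ∀ β (μ : Fin k → F) w, μ ≠ 0 → InBatch bat β μ →
      probUninformed 𝒯 model c T bat sel β μ p T w ≤ ε) :
    1 - Fintype.card V * (batchTests F bat).ncard * ε ≤
      (outcomeMeasure V F k T p).real {ω | AllInformed 𝒯 model c bat sel ω} := by
  have hcompl : (outcomeMeasure V F k T p).real {ω | AllInformed 𝒯 model c bat sel ω}ᶜ ≤
      Fintype.card V * (batchTests F bat).ncard * ε := by
    calc _ ≤ ∑ x ∈ Finset.univ ×ˢ (finite_batchTests (bat := bat) (F := F)).toFinset,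
          probUninformed 𝒯 model c T bat sel x.2.1 x.2.2 p T x.1 := by
          rw [compl_allInformed]
          exact measureReal_biUnion_finset_le _ _
      _ ≤ (Finset.univ ×ˢ (finite_batchTests (bat := bat) (F := F)).toFinset : Finset (V × _)).card
          • ε := by
          refine Finset.sum_le_card_nsmul _ _ _ fun x hx => ?_
          have htest := (Set.Finite.mem_toFinset _).1 (Finset.mem_product.1 hx).2
          exact hε x.2.1 x.2.2 x.1 htest.1 htest.2
      _ = Fintype.card V * (batchTests F bat).ncard * ε := by
          rw [Finset.card_product, ← Set.ncard_eq_toFinset_card _ finite_batchTests,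
            nsmul_eq_mul, Finset.card_univ, Nat.cast_mul]
  rw [probReal_compl_eq_one_sub MeasurableSet.of_discrete] at hcompl
  linarith

theorem mul_inv_pow_le_one_div {a b r : ℝ} (hb : 0 < b) (hr : 0 < r) {h : ℕ} (hab : a * b ≤ r ^ h) :
    a * r⁻¹ ^ h ≤ 1 / b := by
  rw [inv_pow, ← div_eq_mul_inv, div_le_div_iff₀ (by positivity) hb, one_mul]
  exact hab

theorem mul_pow_mul_mul_le {n k q : ℕ} (hq : 1 ≤ q) :
    n * q ^ k * (n * k) ≤ (8 * q) ^ (k + decayLength n) := by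
  have hn : n ≤ 2 ^ decayLength n := Nat.le_pow_clog one_lt_two n
  calc n * q ^ k * (n * k)
      ≤ 2 ^ decayLength n * q ^ k * (2 ^ decayLength n * 2 ^ k) := by
        gcongr
        exact Nat.lt_two_pow_self.le
    _ = (2 * q) ^ k * (2 * 2) ^ decayLength n := by
        rw [mul_pow, mul_pow]
        ring
    _ ≤ (8 * q) ^ k * (8 * q) ^ decayLength n :=
        Nat.mul_le_mul (Nat.pow_le_pow_left (by omega) k) (Nat.pow_le_pow_left (by omega) _)
    _ = (8 * q) ^ (k + decayLength n) := (pow_add _ _ _).symm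

theorem IsProgressConstant.robustFastbcRLNC_succeeds [Fintype F] [DiscreteMeasurableSpace F]
    [IsProbabilityMeasure (coin p)] (hC : IsProgressConstant F p (8 * Fintype.card F)⁻¹ c C)
    (hG : G.Connected) (hn : 3 ≤ Fintype.card V) (hT : 𝒯.IsGBST) (hk : 1 ≤ k)
    (hround : C * 540 * roundBound (Fintype.card V) G.diam k ≤ T) {ℓ : ℕ}
    (m : FieldMessages F k ℓ) :
    1 - 1 / ((Fintype.card V : ℝ) * k) ≤ (outcomeMeasure V F k T p).real
      {ω | Succeeds G s model (robustFastbcRLNC 𝒯 c ℓ ω.1) m ω.2} := by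
  have hF : 1 ≤ Fintype.card F := Fintype.card_pos
  have hV : 0 < (Fintype.card V : ℝ) * k := by
    norm_cast
    exact Nat.mul_pos (by omega) hk
  have hround' : C * (G.diam + (k + decayLength (Fintype.card V)) *
      decayLength (Fintype.card V) * blockSize (Fintype.card V)) ≤ T := by
    have hbound := mul_le_mul_of_nonneg_left
      (mul_decayLength_mul_blockSize_le_roundBound hn G.diam k) (Nat.cast_nonneg (α := ℝ) C)
    rw [← mul_assoc] at hbound
    exact_mod_cast hbound.trans hround
  have huninformed : ∀ β (μ : Fin k → F) w, μ ≠ 0 → InBatch (fun _ => 0) β μ →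
      probUninformed 𝒯 model c T (fun _ => 0) (fun _ _ => 0) β μ p T w ≤
        (8 * Fintype.card F : ℝ)⁻¹ ^ (k + decayLength (Fintype.card V)) := by
    intro β μ w hμ hβ
    obtain ⟨-, -, rfl⟩ := hβ.exists_eq hμ
    exact hC.probUninformed_le_pow hG hn hT hμ hβ (Nat.le_add_left _ _) hround' w
  calc 1 - 1 / ((Fintype.card V : ℝ) * k)
      ≤ 1 - Fintype.card V * Fintype.card F ^ k *
          (8 * Fintype.card F : ℝ)⁻¹ ^ (k + decayLength (Fintype.card V)) :=
        sub_le_sub_left (mul_inv_pow_le_one_div hV (by positivity)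
          (by exact_mod_cast mul_pow_mul_mul_le hF)) 1
    _ ≤ 1 - Fintype.card V * (batchTests F fun _ : Fin k => 0).ncard *
          (8 * Fintype.card F : ℝ)⁻¹ ^ (k + decayLength (Fintype.card V)) := by
        gcongr
        exact_mod_cast ncard_batchTests_const_le
    _ ≤ (outcomeMeasure V F k T p).real
          {ω | AllInformed 𝒯 model c (fun _ => 0) (fun _ _ => 0) ω} :=
        one_sub_le_measureReal_allInformed huninformed
    _ ≤ _ := measureReal_mono fun ω hω => by
        simpa only [Set.mem_ofPred_eq, batchRLNC_const] using hω.succeeds m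

end Success

/-! ### Pipelined batches -/

section Batches

variable {F : Type} [Field F] {k : ℕ}

/-- The vector with the entries `f` in the batch `β` and zeros elsewhere, where each batch consists
of `g` consecutive indices. -/
def batchVector (g β : ℕ) (f : Fin g → F) (i : Fin k) : F :=
  if h : 0 < g ∧ (i : ℕ) / g = β then f ⟨i % g, Nat.mod_lt _ h.1⟩ else 0

theorem InBatch.exists_eq_batchVector {g β : ℕ} (hg : 0 < g) {μ : Fin k → F}
    (hμ : InBatch (fun i => (i : ℕ) / g) β μ) : ∃ f : Fin g → F, μ = batchVector g β f := by
  refine ⟨fun r => if h : g * β + r < k then μ ⟨g * β + r, h⟩ else 0, funext fun i => ?_⟩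
  by_cases hi : (i : ℕ) / g = β
  · have hdiv : g * β + i % g = i := hi ▸ Nat.div_add_mod (i : ℕ) g
    simp only [batchVector, hg, hi, hdiv, i.2, and_self, dif_pos, Fin.eta]
  · rw [hμ i hi, batchVector, dif_neg fun h => hi h.2]

theorem ncard_batchTests_div_le [Fintype F] {g : ℕ} (hg : 0 < g) :
    (batchTests F fun i : Fin k => (i : ℕ) / g).ncard ≤ k * Fintype.card F ^ g := by
  let vector (x : Fin k × (Fin g → F)) : ℕ × (Fin k → F) := (x.1, batchVector g x.1 x.2)
  have hsub : (batchTests F fun i : Fin k => (i : ℕ) / g) ⊆ Set.range vector := by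
    rintro ⟨β, μ⟩ ⟨hμ, hβ⟩
    obtain ⟨f, hf⟩ := hβ.exists_eq_batchVector hg
    obtain ⟨i, -, rfl⟩ := hβ.exists_eq hμ
    exact ⟨(⟨i / g, (Nat.div_le_self _ _).trans_lt i.2⟩, f), Prod.ext rfl hf.symm⟩
  calc (batchTests F fun i : Fin k => (i : ℕ) / g).ncard
      ≤ (Set.range vector).ncard := Set.ncard_le_ncard hsub (Set.finite_range _)
    _ ≤ Nat.card (Fin k × (Fin g → F)) := Finite.card_range_le vector
    _ = k * Fintype.card F ^ g := by simp

end Batches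

/-- The batch that the nodes of level `d` work on in round `t`. The levels are divided into strips
of `Δ` levels and the rounds into phases of `N` rounds, and the batch `β` is active in the strips
`j` and `j + 1` in phase `2 * β + j`. -/
def pipelineBatch (Δ N t d : ℕ) : ℕ := (t / N + 1 - d / Δ) / 2

theorem pipelineBatch_eq {Δ N t β j d : ℕ} (ht : (2 * β + j) * N ≤ t)
    (ht' : t < (2 * β + j + 1) * N) (hd : j * Δ ≤ d) (hd' : d < (j + 2) * Δ) :
    pipelineBatch Δ N t d = β := by
  have hΔ : 0 < Δ := Nat.pos_of_ne_zero (by rintro rfl; omega)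
  have hphase : t / N = 2 * β + j := Nat.div_eq_of_lt_le ht ht'
  have hstrip : j ≤ d / Δ := (Nat.le_div_iff_mul_le hΔ).2 hd
  have hstrip' : d / Δ < j + 2 := (Nat.div_lt_iff_lt_mul hΔ).2 hd'
  unfold pipelineBatch
  omega

/-- The number of rounds in which `k` messages cross `D + 1` levels in batches of `g` messages, with
strips of `Δ` levels and phases of `N` rounds. -/
def pipelineRounds (g Δ N D k : ℕ) : ℕ := (2 * ((k - 1) / g) + (D / Δ + 1)) * N

theorem pipelineRounds_le {C D k L S g : ℕ} (hg : g ≤ k + L) :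
    pipelineRounds g (6 * (g * L * S)) (C * (6 * (g * L * S) + g * L * S)) D k ≤
      C * 21 * (D + (k + L) * L * S) := by
  have hbatches : (k - 1) / g * g * L * S ≤ (k + L) * L * S := by
    gcongr
    have := Nat.div_mul_le_self (k - 1) g
    omega
  have hstrips : 6 * (D / (6 * (g * L * S)) * (g * L * S)) ≤ D := by
    rw [mul_left_comm]
    exact Nat.div_mul_le_self _ _
  have hbatch : g * L * S ≤ (k + L) * L * S := by gcongr
  calc pipelineRounds g (6 * (g * L * S)) (C * (6 * (g * L * S) + g * L * S)) D k
      = C * (14 * ((k - 1) / g * g * L * S) + 7 * (D / (6 * (g * L * S)) * (g * L * S)) +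
          7 * (g * L * S)) := by
        rw [pipelineRounds]
        ring
    _ ≤ C * (21 * (D + (k + L) * L * S)) := by
        refine Nat.mul_le_mul_left C ?_
        omega
    _ = C * 21 * (D + (k + L) * L * S) := (mul_assoc _ _ _).symm

theorem mul_mul_pow_mul_le {n k q g : ℕ} (hk : 1 ≤ k) (hg : n * k ≤ 2 ^ g) :
    n * (k * q ^ g) * n * (n * k) ≤ (8 * q) ^ g := by
  calc n * (k * q ^ g) * n * (n * k) ≤ n * (k * q ^ g) * (n * k) * (n * k) := by
        gcongr
        exact Nat.le_mul_of_pos_right n hk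
    _ = (n * k) * (n * k) * (n * k) * q ^ g := by ring
    _ ≤ 2 ^ g * 2 ^ g * 2 ^ g * q ^ g := by gcongr
    _ = (8 * q) ^ g := by rw [← mul_pow, ← mul_pow, ← mul_pow]; norm_num

section Pipeline

variable {F : Type} [Field F] [MeasurableSpace F] {k : ℕ} {V : Type} [Fintype V]
  {G : SimpleGraph V} {s : V} {𝒯 : RankedBFSTree G s} {model : FaultModel} {c C : ℕ} {p r : ℝ}

theorem IsProgressConstant.probUninformed_pipeline_le (hC : IsProgressConstant F p r c C)
    (hr : 0 ≤ r) (hG : G.Connected) (hn : 3 ≤ Fintype.card V) (hT : 𝒯.IsGBST) {bat : Fin k → ℕ}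
    {β : ℕ} {μ : Fin k → F} (hμ : μ ≠ 0) (hβ : InBatch bat β μ) {g Δ N T : ℕ}
    (hg : decayLength (Fintype.card V) ≤ g) (hΔ : 2 * decayLength (Fintype.card V) + 2 ≤ Δ)
    (hN : C * (Δ + g * decayLength (Fintype.card V) * blockSize (Fintype.card V)) ≤ N) (j : ℕ)
    (hj : (2 * β + j) * N ≤ T) (w : V) (hw : G.dist s w ≤ j * Δ) :
    probUninformed 𝒯 model c T bat (fun t u => pipelineBatch Δ N t (G.dist s u)) β μ p
      ((2 * β + j) * N) w ≤ j * r ^ g := by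
  induction j generalizing w with
  | zero =>
    obtain rfl := hG.dist_eq_zero_iff.1 (Nat.le_zero.1 (hw.trans_eq (zero_mul Δ)))
    rw [probUninformed_root _ hμ hβ, Nat.cast_zero, zero_mul]
  | succ j ih =>
    have hphase : (2 * β + (j + 1)) * N = (2 * β + j) * N + N := by ring
    have hstrip : (j + 1) * Δ = j * Δ + Δ := by ring
    have hstrip' : (j + 2) * Δ = j * Δ + Δ + Δ := by ring
    have hstep := hC model V G s 𝒯 hG hn hT k T bat
      (fun t u => pipelineBatch Δ N t (G.dist s u)) β μ (j * Δ) Δ ((j + 2) * Δ - 1)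
      ((2 * β + j) * N) ((2 * β + (j + 1)) * N) g (j * r ^ g) (by positivity) hj
      (fun t ht ht' u hu hu' => pipelineBatch_eq ht ht' hu (by omega)) (ih (by omega)) hg
      (by omega) (by omega) w (by omega)
    push_cast
    linarith

theorem IsProgressConstant.probUninformed_pipelineRounds_le [Finite F] [DiscreteMeasurableSpace F]
    [IsProbabilityMeasure (coin p)] (hC : IsProgressConstant F p r c C)
    (hr : 0 ≤ r) (hG : G.Connected) (hn : 3 ≤ Fintype.card V) (hT : 𝒯.IsGBST) {g Δ N : ℕ}
    {β : ℕ} {μ : Fin k → F} (hμ : μ ≠ 0) (hβ : InBatch (fun i => (i : ℕ) / g) β μ)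
    (hg : decayLength (Fintype.card V) ≤ g) (hΔ : 2 * decayLength (Fintype.card V) + 2 ≤ Δ)
    (hN : C * (Δ + g * decayLength (Fintype.card V) * blockSize (Fintype.card V)) ≤ N) (w : V) :
    probUninformed 𝒯 model c (pipelineRounds g Δ N G.diam k) (fun i => (i : ℕ) / g)
      (fun t u => pipelineBatch Δ N t (G.dist s u)) β μ p (pipelineRounds g Δ N G.diam k) w ≤
      (G.diam / Δ + 1 : ℕ) * r ^ g := by
  have hβk : β ≤ (k - 1) / g := by
    obtain ⟨i, -, rfl⟩ := hβ.exists_eq hμ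
    exact Nat.div_le_div_right (Nat.le_sub_one_of_lt i.2)
  have hrounds : (2 * β + (G.diam / Δ + 1)) * N ≤ pipelineRounds g Δ N G.diam k := by
    unfold pipelineRounds
    gcongr
  have hw : G.dist s w ≤ (G.diam / Δ + 1) * Δ := by
    rw [mul_comm]
    exact (dist_le_diam_of_connected hG s w).trans (Nat.lt_mul_div_succ _ (by omega)).le
  exact (probUninformed_antitone w hrounds).trans
    (hC.probUninformed_pipeline_le hr hG hn hT hμ hβ hg hΔ hN _ hrounds w hw)

theorem diam_lt_card (hG : G.Connected) : G.diam < Fintype.card V := by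
  have := hG.nonempty
  obtain ⟨u, v, huv⟩ := G.exists_dist_eq_diam
  exact huv ▸ dist_lt_card hG u v

theorem IsProgressConstant.one_sub_le_measureReal_allInformed_pipeline [Fintype F]
    [DiscreteMeasurableSpace F] [IsProbabilityMeasure (coin p)]
    (hC : IsProgressConstant F p (8 * Fintype.card F)⁻¹ c C) (hG : G.Connected)
    (hn : 3 ≤ Fintype.card V) (hT : 𝒯.IsGBST) (hk : 1 ≤ k) {g Δ N : ℕ}
    (hnk : Fintype.card V * k ≤ 2 ^ g) (hg : decayLength (Fintype.card V) ≤ g)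
    (hΔ : 2 * decayLength (Fintype.card V) + 2 ≤ Δ)
    (hN : C * (Δ + g * decayLength (Fintype.card V) * blockSize (Fintype.card V)) ≤ N) :
    1 - 1 / ((Fintype.card V : ℝ) * k) ≤
      (outcomeMeasure V F k (pipelineRounds g Δ N G.diam k) p).real
        {ω | AllInformed 𝒯 model c (fun i => (i : ℕ) / g)
          (fun t u => pipelineBatch Δ N t (G.dist s u)) ω} := by
  have hg0 : 0 < g := by
    have := two_le_decayLength hn
    omega
  have hV : 0 < (Fintype.card V : ℝ) * k := by
    norm_cast
    exact Nat.mul_pos (by omega) hk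
  have hstrips : G.diam / Δ + 1 ≤ Fintype.card V :=
    (Nat.div_le_self _ _).trans_lt (diam_lt_card hG)
  have huninformed : ∀ β (μ : Fin k → F) w, μ ≠ 0 → InBatch (fun i => (i : ℕ) / g) β μ →
      probUninformed 𝒯 model c (pipelineRounds g Δ N G.diam k) (fun i => (i : ℕ) / g)
        (fun t u => pipelineBatch Δ N t (G.dist s u)) β μ p (pipelineRounds g Δ N G.diam k) w ≤
        Fintype.card V * (8 * Fintype.card F : ℝ)⁻¹ ^ g := fun β μ w hμ hβ =>
    (hC.probUninformed_pipelineRounds_le (by positivity) hG hn hT hμ hβ hg hΔ hN w).trans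
      (by gcongr)
  refine le_trans ?_ (one_sub_le_measureReal_allInformed huninformed)
  refine sub_le_sub_left ?_ 1
  calc _ ≤ (Fintype.card V : ℝ) * (k * Fintype.card F ^ g : ℕ) *
          (Fintype.card V * (8 * Fintype.card F : ℝ)⁻¹ ^ g) := by
        gcongr
        exact ncard_batchTests_div_le hg0
    _ = (Fintype.card V * (k * Fintype.card F ^ g : ℕ) * Fintype.card V) *
          (8 * Fintype.card F : ℝ)⁻¹ ^ g := (mul_assoc _ _ _).symm
    _ ≤ 1 / (Fintype.card V * k) := mul_inv_pow_le_one_div hV (by positivity)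
        (by exact_mod_cast mul_mul_pow_mul_le hk hnk)

theorem clog_two_mul_le_add_decayLength (n k : ℕ) : Nat.clog 2 (n * k) ≤ k + decayLength n := by
  refine Nat.clog_le_of_le_pow ?_
  rw [pow_add, mul_comm n k]
  exact Nat.mul_le_mul Nat.lt_two_pow_self.le (Nat.le_pow_clog one_lt_two n)

theorem IsProgressConstant.exists_pipeline [Fintype F] [DiscreteMeasurableSpace F]
    [IsProbabilityMeasure (coin p)] (hC : IsProgressConstant F p (8 * Fintype.card F)⁻¹ c C)
    (hG : G.Connected) (hn : 3 ≤ Fintype.card V) (hT : 𝒯.IsGBST) (hk : 1 ≤ k) :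
    ∃ (T : ℕ) (sel : ℕ → V → ℕ),
      (T : ℝ) ≤ C * 21 * 540 * roundBound (Fintype.card V) G.diam k ∧
      1 - 1 / ((Fintype.card V : ℝ) * k) ≤ (outcomeMeasure V F k T p).real {ω |
        AllInformed 𝒯 model c (fun i => (i : ℕ) / Nat.clog 2 (Fintype.card V * k)) sel ω} := by
  set g := Nat.clog 2 (Fintype.card V * k)
  set L := decayLength (Fintype.card V)
  set S := blockSize (Fintype.card V)
  have hL2 : 2 ≤ L := two_le_decayLength hn
  have hLg : L ≤ g := Nat.clog_mono_right 2 (Nat.le_mul_of_pos_right _ hk)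
  have hstrip : 2 * L + 2 ≤ 6 * (g * L * S) := by
    have : 1 * L * 1 ≤ g * L * S := by
      gcongr
      · omega
      · exact one_le_blockSize hn
    omega
  refine ⟨pipelineRounds g (6 * (g * L * S)) (C * (6 * (g * L * S) + g * L * S)) G.diam k,
    fun t u => pipelineBatch _ _ t (G.dist s u), ?_,
    hC.one_sub_le_measureReal_allInformed_pipeline hG hn hT hk (Nat.le_pow_clog one_lt_two _) hLg
      hstrip le_rfl⟩
  calc _ ≤ ((C * 21 * (G.diam + (k + L) * L * S) : ℕ) : ℝ) := by
        exact_mod_cast pipelineRounds_le (clog_two_mul_le_add_decayLength _ k)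
    _ = C * 21 * ((G.diam + (k + L) * L * S : ℕ) : ℝ) := by push_cast; ring
    _ ≤ C * 21 * (540 * roundBound (Fintype.card V) G.diam k) := by
        gcongr
        exact mul_decayLength_mul_blockSize_le_roundBound hn G.diam k
    _ = C * 21 * 540 * roundBound (Fintype.card V) G.diam k := (mul_assoc _ _ _).symm

end Pipeline

/-! ### Translating schedules -/

section Translation

variable {V Msgs Msgs' Packet Packet' : Type} {T : ℕ}

/-- The schedule that runs `S` with the packets encoded by `enc` and the messages renamed by `φ`. -/
def CodingSchedule.translate (S : CodingSchedule V Msgs Packet T) (enc : Packet → Packet')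
    (dec : Packet' → Packet) (φ : Msgs' ≃ Msgs) : CodingSchedule V Msgs' Packet' T where
  act i u init hist := (S.act i u (init.map φ) (hist.map (Option.map dec))).map enc
  decode u init hist := (S.decode u (init.map φ) (hist.map (Option.map dec))).map φ.symm

theorem initialKnowledge_map (s : V) (m : Msgs) (f : Msgs → Msgs') (u : V) :
    (initialKnowledge s m u).map f = initialKnowledge s (f m) u := by
  unfold initialKnowledge
  split_ifs <;> rfl

theorem Succeeds.translate {G : SimpleGraph V} {s : V} {model : FaultModel}
    {S : CodingSchedule V Msgs Packet T} (Valid : Packet → Prop) {enc : Packet → Packet'}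
    {dec : Packet' → Packet} (hdec : ∀ y, Valid y → dec (enc y) = y) (φ : Msgs' ≃ Msgs) {m : Msgs'}
    (hvalid : ∀ i u hist, (∀ y, some y ∈ hist → Valid y) →
      ∀ y, S.act i u (initialKnowledge s (φ m) u) hist = some y → Valid y)
    {fault : Fin T → V → Bool} (h : Succeeds G s model S (φ m) fault) :
    Succeeds G s model (S.translate enc dec φ) m fault := by
  have hdecode : ∀ hist : List (Option Packet), (∀ y, some y ∈ hist → Valid y) →
      (hist.map (Option.map enc)).map (Option.map dec) = hist := by
    intro hist hhist
    rw [List.map_map]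
    refine (List.map_congr_left fun x hx => ?_).trans (List.map_id hist)
    cases x with
    | none => rfl
    | some y => exact congrArg some (hdec y (hhist y hx))
  have hact : ∀ i u hist, (∀ y, some y ∈ hist → Valid y) →
      (S.translate enc dec φ).act i u (initialKnowledge s m u) (hist.map (Option.map enc)) =
        (S.act i u (initialKnowledge s (φ m) u) hist).map enc := by
    intro i u hist hhist
    simp only [CodingSchedule.translate, initialKnowledge_map, hdecode hist hhist]
  intro u
  rw [history_map enc Valid hvalid hact]
  simp only [CodingSchedule.translate, initialKnowledge_map,
    hdecode _ (forall_mem_history Valid hvalid fault T u), h u, Option.map_some,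
    φ.symm_apply_apply]

end Translation

theorem exists_leftInvOn_range {X Y Z : Type*} [Fintype X] [Fintype Y] [Nonempty X] (Φ : X → Z)
    (h : Fintype.card X ≤ Fintype.card Y) :
    ∃ (enc : Z → Y) (dec : Y → Z), Set.LeftInvOn dec enc (Set.range Φ) := by
  obtain ⟨e⟩ := Function.Embedding.nonempty_of_card_le h
  refine ⟨e ∘ Function.invFun Φ, Φ ∘ Function.invFun e, ?_⟩
  rintro _ ⟨x, rfl⟩
  simp only [Function.comp_apply, Function.leftInverse_invFun e.injective _]
  exact Function.invFun_eq (f := Φ) ⟨x, rfl⟩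

theorem exists_le_measureReal_section {X Y : Type*} [MeasurableSpace X] [MeasurableSpace Y]
    (μ : Measure X) (ν : Measure Y) [IsProbabilityMeasure μ] [IsFiniteMeasure ν]
    {E : Set (X × Y)} (hE : MeasurableSet E) {r : ℝ} (h : r ≤ (μ.prod ν).real E) :
    ∃ x, r ≤ ν.real {y | (x, y) ∈ E} := by
  have hfinite : ∫⁻ x, ν (Prod.mk x ⁻¹' E) ∂μ ≠ ⊤ := by
    rw [← Measure.prod_apply hE]
    exact measure_ne_top _ _
  obtain ⟨x, hx⟩ := exists_lintegral_le hfinite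
  rw [← Measure.prod_apply hE] at hx
  exact ⟨x, h.trans (ENNReal.toReal_mono (measure_ne_top _ _) hx)⟩

section Schedule

variable {F : Type} [Field F] {k : ℕ}

theorem InBatch.exists_fin_eq_batchVector (hk : 0 < k) {g β : ℕ} (hg : 0 < g) {μ : Fin k → F}
    (hβ : InBatch (fun i => (i : ℕ) / g) β μ) :
    ∃ (b : Fin k) (f : Fin g → F), batchVector g b f = μ := by
  by_cases hμ : μ = 0
  · refine ⟨⟨0, hk⟩, 0, ?_⟩
    ext i
    simp [batchVector, hμ]
  · obtain ⟨f, hf⟩ := hβ.exists_eq_batchVector hg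
    obtain ⟨i, -, rfl⟩ := hβ.exists_eq hμ
    exact ⟨⟨i / g, (Nat.div_le_self _ _).trans_lt i.2⟩, f, hf.symm⟩

/-- The packets have `⌈log₂ (n k)⌉` bits for the number of the batch, as many for the coefficients
in the batch, and `a ⌈log₂ (n k)⌉` bits for the combination of the messages. -/
theorem exists_batchPacket_encoding [Fintype F] (hF : Fintype.card F = 2) (a : ℕ) {n : ℕ}
    (hn : 2 ≤ n) (hk : 1 ≤ k) :
    ∃ (enc : RLNCPacket F k (a * Nat.clog 2 (n * k)) → LogBits (a + 2) n k)
      (dec : LogBits (a + 2) n k → RLNCPacket F k (a * Nat.clog 2 (n * k))),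
      ∀ y, (∃ β, InBatch (fun i : Fin k => (i : ℕ) / Nat.clog 2 (n * k)) β y.1) →
        dec (enc y) = y := by
  set g := Nat.clog 2 (n * k) with hg
  have hg0 : 0 < g := Nat.clog_pos one_lt_two (Nat.mul_le_mul hn hk)
  have hkg : k ≤ 2 ^ g := (Nat.le_mul_of_pos_left k (by omega)).trans (Nat.le_pow_clog one_lt_two _)
  have : Nonempty (Fin k) := ⟨⟨0, hk⟩⟩
  have hcard : Fintype.card (Fin k × (Fin g → F) × (Fin (a * g) → F)) ≤
      Fintype.card (LogBits (a + 2) n k) := by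
    simp only [Fintype.card_prod, Fintype.card_fun, Fintype.card_fin, hF, Fintype.card_bool, ← hg]
    calc k * (2 ^ g * 2 ^ (a * g)) ≤ 2 ^ g * (2 ^ g * 2 ^ (a * g)) := by gcongr
      _ = 2 ^ ((a + 2) * g) := by ring
  obtain ⟨enc, dec, hdec⟩ := exists_leftInvOn_range
    (fun x : Fin k × (Fin g → F) × (Fin (a * g) → F) =>
      ((batchVector g x.1 x.2.1, x.2.2) : RLNCPacket F k (a * g))) hcard
  refine ⟨enc, dec, fun y ⟨β, hβ⟩ => hdec ?_⟩
  obtain ⟨b, f, hbf⟩ := hβ.exists_fin_eq_batchVector hk hg0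
  exact ⟨(b, f, y.2), Prod.ext hbf rfl⟩

variable {V : Type} {G : SimpleGraph V} {s : V}

theorem inBatch_of_batchRLNC_act_eq_some [Fintype V] {𝒯 : RankedBFSTree G s} {c T ℓ : ℕ}
    {bat : Fin k → ℕ} {sel : ℕ → V → ℕ} {seed : Seed V F k T} {t : Fin T} {u : V}
    {init : Option (FieldMessages F k ℓ)} {hist : List (Option (RLNCPacket F k ℓ))}
    {y : RLNCPacket F k ℓ} (hy : (batchRLNC 𝒯 c bat sel ℓ seed).act t u init hist = some y) :
    InBatch bat (sel t u) y.1 := by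
  obtain ⟨-, hy⟩ := Option.ite_none_right_eq_some.1 hy
  obtain rfl := Option.some_injective _ hy
  exact inBatch_combine _ fun y hy => (mem_batchPackets.1 hy).2

theorem IsProgressConstant.exists_codingSchedule [Fintype V] [Fintype F] [MeasurableSpace F]
    [DiscreteMeasurableSpace F] {p : ℝ} [IsProbabilityMeasure (coin p)] {c C : ℕ}
    (hC : IsProgressConstant F p (8 * Fintype.card F)⁻¹ c C) (hF : Fintype.card F = 2) (a : ℕ)
    (model : FaultModel) (hG : G.Connected) (s : V) (hn : 3 ≤ Fintype.card V) (hk : 1 ≤ k) :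
    ∃ (T : ℕ) (S : CodingSchedule V (Fin k → LogBits a (Fintype.card V) k)
        (LogBits (a + 2) (Fintype.card V) k) T),
      (T : ℝ) ≤ C * 21 * 540 * roundBound (Fintype.card V) G.diam k ∧
      ∀ m, 1 - 1 / ((Fintype.card V : ℝ) * k) ≤
        (faultMeasure V T p).real {f | Succeeds G s model S m f} := by
  obtain ⟨𝒯, hT⟩ := exists_isGBST hG s
  obtain ⟨T, sel, hTle, hprob⟩ := hC.exists_pipeline (model := model) hG hn hT hk
  obtain ⟨seed, hseed⟩ := exists_le_measureReal_section _ _ MeasurableSet.of_discrete hprob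
  obtain ⟨enc, dec, hdec⟩ := exists_batchPacket_encoding hF a (n := Fintype.card V) (by omega) hk
  have bits : Bool ≃ F := Fintype.equivOfCardEq (hF ▸ Fintype.card_bool)
  let messages : (Fin k → LogBits a (Fintype.card V) k) ≃
      FieldMessages F k (a * Nat.clog 2 (Fintype.card V * k)) :=
    Equiv.piCongrRight fun _ => Equiv.piCongrRight fun _ => bits
  refine ⟨T, (batchRLNC 𝒯 c (fun i => i / Nat.clog 2 (Fintype.card V * k)) sel _ seed).translate
    enc dec messages, hTle, fun m => hseed.trans (measureReal_mono fun f hf => ?_)⟩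
  have hsucceeds := AllInformed.succeeds hf (messages m)
  exact hsucceeds.translate _ hdec messages
    (fun _ _ _ _ _ hy => ⟨_, inBatch_of_batchRLNC_act_eq_some hy⟩)

end Schedule

/-! ### Throughput -/

theorem le_codingThroughput {V : Type} [Fintype V] {G : SimpleGraph V} {s : V}
    {model : FaultModel} {p C : ℝ} {a A : ℕ} (hC : 0 < C) (hn : 3 ≤ Fintype.card V)
    (h : ∀ k : ℕ, 1 ≤ k → ∃ (T : ℕ) (S : CodingSchedule V (Fin k → LogBits a (Fintype.card V) k)
        (LogBits A (Fintype.card V) k) T),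
      (T : ℝ) ≤ C * roundBound (Fintype.card V) G.diam k ∧
      ∀ m, 1 - 1 / ((Fintype.card V : ℝ) * k) ≤
        (faultMeasure V T p).real {f | Succeeds G s model S m f}) :
    ENNReal.ofReal (1 / (2 * C) / (Real.log (Fintype.card V) *
      Real.log (Real.log (Fintype.card V)))) ≤ codingThroughput G s model p a A := by
  set n := Fintype.card V
  set x := Real.log n * Real.log (Real.log n) with hx
  have hx0 : 0 < x :=
    mul_pos (by linarith [thirteen_div_twelve_le_log hn])
      (by linarith [one_div_thirteen_le_log_log hn])
  have hlim : Tendsto (fun k : ℕ => (k : ℝ) * x) atTop atTop :=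
    tendsto_natCast_atTop_atTop.atTop_mul_const hx0
  refine le_limsup_of_frequently_le (Eventually.frequently ?_)
  filter_upwards [eventually_ge_atTop 1,
    hlim.eventually_ge_atTop (G.diam + Real.log n * x)] with k hk hkx
  obtain ⟨T, S, hT, hS⟩ := h k hk
  have hk0 : (0 : ℝ) < k := by exact_mod_cast hk
  have hsucceeds : ∀ m, 1 - 1 / (k : ℝ) ≤
      (faultMeasure V T p).real {f | Succeeds G s model S m f} := fun m =>
    (sub_le_sub_left (one_div_le_one_div_of_le hk0 <| le_mul_of_one_le_left hk0.le <|
      by exact_mod_cast (by omega : 1 ≤ n)) 1).trans (hS m)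
  have hrounds : (T : ℝ) ≤ 2 * C * (k * x) := by
    calc (T : ℝ) ≤ C * (G.diam + Real.log n * x + k * x) := by
          convert hT using 2
          rw [roundBound, hx]
          ring
      _ ≤ C * (k * x + k * x) := by gcongr
      _ = 2 * C * (k * x) := by ring
  refine le_trans ?_ (ENNReal.div_le_div_left (iInf₂_le T ⟨S, hsucceeds⟩) _)
  rw [ENNReal.le_div_iff_mul_le (Or.inr (by exact_mod_cast hk0.ne'))
    (Or.inr (ENNReal.natCast_ne_top k)), ← ENNReal.ofReal_natCast T, ← ENNReal.ofReal_natCast k,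
    ← ENNReal.ofReal_mul (by positivity)]
  refine ENNReal.ofReal_le_ofReal ?_
  calc 1 / (2 * C) / x * T ≤ 1 / (2 * C) / x * (2 * C * (k * x)) := by gcongr
    _ = k := by field_simp

theorem mainTheorem11 :
    -- Robust FASTBC with random linear network coding over a finite field `F`
    (∀ (p : ℝ) (F : Type) [Field F] [Fintype F] [MeasurableSpace F] [DiscreteMeasurableSpace F],
      0 ≤ p → p < 1 →
      ∃ c₀ : ℕ, ∀ c : ℕ, c₀ ≤ c → ∃ C : ℝ, 0 < C ∧
        ∀ (model : FaultModel) (V : Type) [Fintype V] (G : SimpleGraph V) (s : V),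
          G.Connected → 3 ≤ Fintype.card V →
          (∃ 𝒯 : RankedBFSTree G s, 𝒯.IsGBST) ∧
          ∀ 𝒯 : RankedBFSTree G s, 𝒯.IsGBST →
            ∀ k ℓ T : ℕ, 1 ≤ k → C * roundBound (Fintype.card V) G.diam k ≤ T →
            ∀ m : FieldMessages F k ℓ,
              1 - 1 / ((Fintype.card V : ℝ) * k) ≤
                ((seedMeasure V F k T).prod (faultMeasure V T p)).real
                  {ω | Succeeds G s model (robustFastbcRLNC 𝒯 c ℓ ω.1) m ω.2}) ∧
    -- schedules with messages and packets of `O(log (n k))` bits, and the throughput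
    (∀ a : ℕ, ∃ A : ℕ, ∀ p : ℝ, 0 ≤ p → p < 1 →
      ∃ C θ : ℝ, 0 < C ∧ 0 < θ ∧
        ∀ (model : FaultModel) (V : Type) [Fintype V] (G : SimpleGraph V) (s : V),
          G.Connected → 3 ≤ Fintype.card V →
          (∀ k : ℕ, 1 ≤ k →
            ∃ (T : ℕ) (S : CodingSchedule V (Fin k → LogBits a (Fintype.card V) k)
                (LogBits A (Fintype.card V) k) T),
              (T : ℝ) ≤ C * roundBound (Fintype.card V) G.diam k ∧
              ∀ m, 1 - 1 / ((Fintype.card V : ℝ) * k) ≤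
                (faultMeasure V T p).real {f | Succeeds G s model S m f}) ∧
          ENNReal.ofReal (θ / (Real.log (Fintype.card V) *
              Real.log (Real.log (Fintype.card V)))) ≤
            codingThroughput G s model p a A) := by
  refine ⟨fun p F _ _ _ _ hp0 hp1 => ?_, fun a => ⟨a + 2, fun p hp0 hp1 => ?_⟩⟩ <;>
    have := coin_isProbabilityMeasure hp0 hp1.le
  · obtain ⟨c₀, hc₀⟩ :=
      exists_isProgressConstant F hp1 (r := (8 * Fintype.card F : ℝ)⁻¹) (by positivity)
    refine ⟨c₀, fun c hc => ?_⟩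
    obtain ⟨C, hC1, hC⟩ := hc₀ c hc
    refine ⟨C * 540, by positivity, fun model V _ G s hG hn => ⟨exists_isGBST hG s, ?_⟩⟩
    exact fun 𝒯 hT k ℓ T hk hround m => hC.robustFastbcRLNC_succeeds hG hn hT hk hround m
  · have : Fact (Nat.Prime 2) := ⟨Nat.prime_two⟩
    let _ : MeasurableSpace (ZMod 2) := ⊤
    have : DiscreteMeasurableSpace (ZMod 2) := ⟨fun _ => trivial⟩
    obtain ⟨c₀, hc₀⟩ :=
      exists_isProgressConstant (ZMod 2) hp1 (r := (8 * Fintype.card (ZMod 2))⁻¹) (by positivity)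
    obtain ⟨C, hC1, hC⟩ := hc₀ c₀ le_rfl
    refine ⟨C * 21 * 540, 1 / (2 * (C * 21 * 540)), by positivity, by positivity,
      fun model V _ G s hG hn => ?_⟩
    have hschedules (k : ℕ) (hk : 1 ≤ k) :=
      hC.exists_codingSchedule (ZMod.card 2) a model hG s hn hk
    exact ⟨hschedules, le_codingThroughput (by positivity) hn hschedules⟩
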